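/- Let $m,n$ be positive integers. A partition $\pi$ of $\{1,\dots,N\}$ is non-crossing if there are no $a<b<c<d$ with $a,c$ in one block and $b,d$ in a different block; it is positive if $1$ and $N$ lie in the same block; it is $m$-divisible if all its block sizes are divisible by $m$. Let $NC_+(N)$ be the set of positive non-crossing partitions of $\{1,\dots,N\}$, and $NC^{(m)}_+(n)$ the set of $m$-divisible elements of $NC_+(mn)$. The rank of an $m$-divisible non-crossing partition of $\{1,\dots,mn\}$ is its rank in the poset of all such partitions, ordered by refinement. The pseudo-rotation $\kappa_A$ on $NC_+(N)$ is defined as follows (for $N=1$ it is the identity). If $N-1$ lies in the block of $1$ and $N$, then $\kappa_A(\pi)$ is obtained from $\pi$ by rotating all blocks by one unit, $x\mapsto x+1$ modulo $N$. If $\{N-1\}$ is a block of $\pi$ not containing $1$, then this block is replaced by $\{2\}$, and $1$ is added to each element of the other blocks except $1$ and $N$, which stay untouched. Otherwise, $\{b_1<b_2<\dots<N-1\}$ and $\{1,\dots,a,N\}$ are two different blocks of $\pi$ (with $b_1<N-1$); they are replaced by $\{1,b_2+1,\dots,N\}$ and $\{2,\dots,a+1,b_1+1\}$, and the remaining blocks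 are rotated by one unit. For a finite set $M$ acted on by a finite cyclic group $C$ and a polynomial $P(q)$ with non-negative integer coefficients, the triple $(M,P,C)$ exhibits the cyclic sieving phenomenon if for all $\rho\mid\#C$ and all $g\in C$ of order $\rho$ the number of $x\in M$ with $g(x)=x$ is $P(e^{2\pi i/\rho})$. Write $[\alpha]_q=(1-q^\alpha)/(1-q)$, $[k]_q!=[k]_q\cdots[1]_q$ (with $[0]_q!=1$), and $$\begin{bmatrix}M\\k\end{bmatrix}_q=\frac{[M]_q[M-1]_q\cdots[M-k+1]_q}{[k]_q!},\qquad \begin{bmatrix}M\\k_1,\dots,k_r\end{bmatrix}_q=\frac{[M]_q[M-1]_q\cdots[M-k_1-\dots-k_r+1]_q}{[k_1]_q!\cdots[k_r]_q!},$$ an empty product being $1$. **Theorem.** The map $\kappa_A$ is a permutation of $NC_+(mn)$. Let $C$ be the cyclic group that it generates. Let $s,b_1,\dots,b_n$ be non-negative integers with $s\le n-1$ and $b_1+2b_2+\dots+nb_n=n$. Each of the following sets $M$ is stable under $C$, each of the following expressions $P(q)$ is a polynomial with non-negative integer coefficients, and $(M,P,C)$ exhibits the cyclic sieving phenomenon: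 1. $M=NC^{(m)}_+(n)$ and $P(q)=\frac1{[n]_q}\begin{bmatrix}(m+1)n-2\\n-1\end{bmatrix}_q$; 2. $M$ consists of the elements of $NC^{(m)}_+(n)$ all of whose blocks have size $m$, and $P(q)=\frac1{[n]_q}\begin{bmatrix}mn-2\\n-1\end{bmatrix}_q$; 3. $M$ consists of the elements of $NC^{(m)}_+(n)$ of rank $s$ (equivalently, with $n-s$ blocks), and $P(q)=\frac1{[n]_q}\begin{bmatrix}n\\s\end{bmatrix}_q\begin{bmatrix}mn-2\\n-s-1\end{bmatrix}_q$; 4. $M$ consists of the elements of $NC^{(m)}_+(n)$ whose number of blocks of size $mi$ is $b_i$ for $i=1,\dots,n$, and, with $b=b_1+\dots+b_n$, $P(q)=\frac1{[b]_q}\begin{bmatrix}b\\b_1,\dots,b_n\end{bmatrix}_q\begin{bmatrix}mn-2\\b-1\end{bmatrix}_q$. -/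

import Mathlib

open Polynomial

noncomputable section

namespace PosNC

/-! ### The `q`-notation, in the field `ℚ(q)` of rational functions -/

/-- `[α]_q = (1 - q ^ α) / (1 - q)`. -/
def qInt (α : ℤ) : RatFunc ℚ := (1 - RatFunc.X ^ α) / (1 - RatFunc.X)

/-- `[k]_q! = [k]_q [k-1]_q ⋯ [1]_q`. -/
def qFact (k : ℕ) : RatFunc ℚ := ∏ i ∈ Finset.Icc 1 k, qInt i

/-- The falling product `[M]_q [M-1]_q ⋯ [M-k+1]_q`, which is `1` for `k = 0`. -/
def qFalling (M : ℤ) (k : ℕ) : RatFunc ℚ := ∏ i ∈ Finset.range k, qInt (M - i)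

/-- The `q`-binomial coefficient. -/
def qBinom (M : ℤ) (k : ℕ) : RatFunc ℚ := qFalling M k / qFact k

/-- The `q`-multinomial coefficient with lower entries `b 1, …, b n`. -/
def qMultinom (M : ℤ) (n : ℕ) (b : ℕ → ℕ) : RatFunc ℚ :=
  qFalling M (∑ i ∈ Finset.Icc 1 n, b i) / ∏ i ∈ Finset.Icc 1 n, qFact (b i)

/-! ### Non-crossing partitions -/

/-- No two different blocks `B`, `B'` contain `a < b < c < d` with `a, c ∈ B` and `b, d ∈ B'`. -/
def IsNonCrossing {N : ℕ} (π : Finpartition (Finset.Icc 1 N)) : Prop :=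
  ∀ B ∈ π.parts, ∀ B' ∈ π.parts, B ≠ B' →
    ∀ a ∈ B, ∀ b ∈ B', ∀ c ∈ B, ∀ d ∈ B', ¬ (a < b ∧ b < c ∧ c < d)

/-- All block sizes are divisible by `m`. -/
def IsDivisible (m : ℕ) {N : ℕ} (π : Finpartition (Finset.Icc 1 N)) : Prop :=
  ∀ B ∈ π.parts, m ∣ B.card

/-- `1` and `N` lie in the same block. -/
def IsPositive {N : ℕ} (π : Finpartition (Finset.Icc 1 N)) : Prop :=
  ∃ B ∈ π.parts, 1 ∈ B ∧ N ∈ B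

/-- The poset of `m`-divisible non-crossing partitions of `{1, …, mn}`, ordered by refinement. -/
abbrev DivNC (m n : ℕ) : Type :=
  {π : Finpartition (Finset.Icc 1 (m * n)) // IsNonCrossing π ∧ IsDivisible m π}

/-- The positive non-crossing partitions of `{1, …, N}`. -/
abbrev NCPlus (N : ℕ) : Type :=
  {π : Finpartition (Finset.Icc 1 N) // IsNonCrossing π ∧ IsPositive π}

/-- The positive `m`-divisible non-crossing partitions of `{1, …, mn}`. -/
def divNCPlus (m n : ℕ) : Set (NCPlus (m * n)) := {π | IsDivisible m π.1}

/-- Those all of whose blocks have size `m`. -/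
def divNCPlusUniform (m n : ℕ) : Set (NCPlus (m * n)) := {π | ∀ B ∈ π.1.parts, B.card = m}

/-- Those of rank `s` in the poset of all `m`-divisible non-crossing partitions of `{1, …, mn}`
(the rank is the supremum of the lengths of the chains that end in the given element). -/
def divNCPlusRank (m n s : ℕ) : Set (NCPlus (m * n)) :=
  {π | ∃ h : IsDivisible m π.1, Order.height (⟨π.1, π.2.1, h⟩ : DivNC m n) = (s : ℕ∞)}

/-- Those with exactly `b i` blocks of size `m * i`, for `i = 1, …, n`. -/
def divNCPlusType (m n : ℕ) (b : ℕ → ℕ) : Set (NCPlus (m * n)) :=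
  {π | IsDivisible m π.1 ∧
    ∀ i ∈ Finset.Icc 1 n, (π.1.parts.filter fun B => B.card = m * i).card = b i}

/-! ### The pseudo-rotation -/

/-- The effect of the pseudo-rotation on the points of the blocks of a positive `π`.

* If `N - 1` is in the block of `1` and `N`, all points are rotated by one unit.
* If `{N - 1}` is a block, it becomes `{2}`, the points `1` and `N` are fixed, and `1` is
  added to all the others.
* Otherwise `{b₁ < b₂ < ⋯ < N - 1}` and `{1, …, a, N}` are two different blocks with `b₁ < N - 1`.
  They become `{1, b₂ + 1, …, N}` and `{2, …, a + 1, b₁ + 1}`, and all other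
  points are rotated by one unit; so `b₁` goes to `1`, `N` goes to `b₁ + 1`, and every other
  point `x` goes to `x + 1`. (For `N = 1` the result is the identity.) -/
def kappaPoint {N : ℕ} (π : Finpartition (Finset.Icc 1 N)) (x : ℕ) : ℕ :=
  if N - 1 ∈ π.part 1 then
    if x = N then 1 else x + 1
  else if π.part (N - 1) = {N - 1} then
    if x = 1 then 1 else if x = N then N else if x = N - 1 then 2 else x + 1
  else
    let b₁ := sInf {y : ℕ | y ∈ π.part (N - 1)}
    if x = b₁ then 1 else if x = N then b₁ + 1 else x + 1

/-- The set of blocks of the image of `π` under the pseudo-rotation. -/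
def kappaParts {N : ℕ} (π : Finpartition (Finset.Icc 1 N)) : Finset (Finset ℕ) :=
  π.parts.image fun B => B.image (kappaPoint π)

/-- `κ` is the pseudo-rotation, as a permutation of the positive non-crossing partitions of
`{1, …, N}`. -/
def IsPseudoRotation {N : ℕ} (κ : Equiv.Perm (NCPlus N)) : Prop :=
  ∀ π : NCPlus N, (κ π).1.parts = kappaParts π.1

/-! ### Cyclic sieving -/

/-- The triple `(M, P, C)` exhibits the cyclic sieving phenomenon: `M` is a finite set that is
stable under the finite cyclic permutation group `C`, and for all `ρ` that divide the order of `C`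
and all `g ∈ C` of order `ρ`, the number of the elements of `M` that are fixed by `g` is
`P (exp (2πi / ρ))`. The polynomial `P` has coefficients in `ℕ`. -/
def ExhibitsCyclicSieving {X : Type*} (M : Set X) (P : ℕ[X]) (C : Subgroup (Equiv.Perm X)) :
    Prop :=
  M.Finite ∧ Finite C ∧ IsCyclic C ∧ (∀ g ∈ C, ∀ x ∈ M, g x ∈ M) ∧
    ∀ ρ : ℕ, ρ ∣ Nat.card C → ∀ g ∈ C, orderOf g = ρ →
      (({x ∈ M | g x = x}.ncard : ℕ) : ℂ) =
        aeval (Complex.exp (2 * Real.pi * Complex.I / (ρ : ℂ))) P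

/-- The rational function `F ∈ ℚ(q)` is a polynomial with coefficients in `ℕ`, and together with
it `M` and `C` exhibit the cyclic sieving phenomenon. -/
def ExhibitsCyclicSievingFor {X : Type*} (M : Set X) (F : RatFunc ℚ)
    (C : Subgroup (Equiv.Perm X)) : Prop :=
  ∃ P : ℕ[X], algebraMap ℚ[X] (RatFunc ℚ) (P.map (Nat.castRingHom ℚ)) = F ∧
    ExhibitsCyclicSieving M P C

end PosNC

end

/-!
The proof reduces cyclic sieving to a count of fixed points, and the count to words of integers.

A non-crossing partition is determined by the function that sends a point to the minimum of its
block, and by its word, which has at `a` the size of the block with minimum `a`, and `0` if there is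
none (`NCPlus.ext_word`). The words that occur are those of Łukasiewicz, and they are read back by
`ofWord`: a block with minimum `a` ends where the partial sums from `a` return for the first time.

Draw for each block without `1` the chord from its minimum to its maximum, which is a loop for a
singleton. These chords have no ends in common and do not cross, their ends are among
`2, …, N - 1`, and they determine a positive partition (`NCPlus.ext_joined`). The pseudo-rotation
rotates this diagram by one step on the circle of these `N - 2` points (`joined_kappaMap`). So it is
a permutation, and its order is `L = N - 2` (`orderOf_kap`). It preserves the number of blocks of
each size.

Let `L = d * K` with `d ≥ 2`, and let `π` be fixed by the `K`-th power. A chord of `π` that is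
longer than `K` on both sides would cross its image, so every chord has a short side. The code of
`π` has at `x` the size of the block on the short side, if the short arc starts at `x`, and `0`
otherwise. It has period `K`, it determines `π` (`eq_of_code_eq`), and each function
`c : Fin K → ℕ` with `d * ∑ i, c i ≤ N` is a code (`exists_fixed_of_code`): by the cycle lemma, some
rotation of `c` is, after repetition, the word of a partition. Each positive entry of the code
stands for `d` blocks of this size, and one more block takes what is missing from `N`
(`blockCount_of_fixed`). So the fixed points with prescribed block sizes are as many as certain
functions on `Fin K` (`ncard_fixed`). The number of all partitions with prescribed block sizes is
given by the cycle lemma in its usual form (`ncard_mul`). The functions are counted by stars and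
bars and by multinomial coefficients. The rank of an `m`-divisible partition is `n` minus its number
of blocks, since a block of size more than `m` can be cut in two (`height_eq`).

Each expression `P` satisfies `P * [c]_q = B` and `P * [e]_q = A` with products `A` and `B` of
Gaussian polynomials. The ideal of the `p` with `[c]_q ∣ p * B` contains with `[a]_q` and `[b]_q`
also `[gcd a b]_q` (`qNum_gcd_mem`), and it turns out to contain `1`, so `P` is a polynomial.
Its coefficients are non-negative, because `B` is symmetric and unimodal: then `(1 - q) * B` has
non-negative coefficients up to the middle, and the coefficients of `P` follow from those of
`(1 - q ^ c) * P` by recursion (`coeff_nonneg_of_mul_qNum`). The unimodality of the Gaussian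
polynomials is proved with the raising operator of `sl₂` on the functions of subsets
(`gauss_mem_symCone`). The values of `P` at roots of unity are given by the `q`-Lucas theorem
(`aeval_gauss_lucas`), and they agree with the numbers of fixed points (`values_all`,
`values_blocks`, `values_type`).
-/

noncomputable section

namespace PosNC

open Finset

/-! ### Non-crossing partitions and their block minima -/

/-- The least element of the block of `x` (and `0` if `x` is not one of the points). -/
def lo {N : ℕ} (π : Finpartition (Icc 1 N)) (x : ℕ) : ℕ := sInf {y | y ∈ π.part x}

/-- The properties that characterise the function "least element of the block of" of a positive
non-crossing partition of `{1, …, N}`. -/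
structure IsLo (N : ℕ) (f : ℕ → ℕ) : Prop where
  pos : ∀ x, 1 ≤ x → x ≤ N → 1 ≤ f x
  le : ∀ x, 1 ≤ x → x ≤ N → f x ≤ x
  idem : ∀ x, 1 ≤ x → x ≤ N → f (f x) = f x
  nest : ∀ x y, 1 ≤ x → x ≤ N → f x ≤ y → y ≤ x → f x ≤ f y
  last : f N = 1

/-- The points `x` with `f x = a`. -/
def fiber (N : ℕ) (f : ℕ → ℕ) (a : ℕ) : Finset ℕ := {x ∈ Icc 1 N | f x = a}

/-- The number of points `x` with `f x = a`. If `f` is the block minimum of a partition, this is the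
size of the block with minimum `a`, or `0` if `a` is not a block minimum. -/
def word (N : ℕ) (f : ℕ → ℕ) (a : ℕ) : ℕ := (fiber N f a).card

lemma mem_fiber {N : ℕ} {f : ℕ → ℕ} {a x : ℕ} :
    x ∈ fiber N f a ↔ (1 ≤ x ∧ x ≤ N) ∧ f x = a := by
  simp [fiber]

section
variable {N : ℕ} (π : Finpartition (Icc 1 N))

lemma lo_mem {x : ℕ} (h1 : 1 ≤ x) (h2 : x ≤ N) : lo π x ∈ π.part x :=
  Nat.sInf_mem (s := {y | y ∈ π.part x}) ⟨x, π.mem_part (by simp [h1, h2])⟩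

lemma lo_le_of_mem {x y : ℕ} (h : y ∈ π.part x) : lo π x ≤ y := Nat.sInf_le h

lemma lo_eq_of_mem {x y : ℕ} (h : y ∈ π.part x) : lo π y = lo π x := by
  have hx : x ∈ Icc 1 N := π.part_nonempty.1 ⟨y, h⟩
  have : π.part y = π.part x := π.part_eq_of_mem (π.part_mem.2 hx) h
  simp [lo, this]

lemma mem_part_iff_lo {x y : ℕ} (hx1 : 1 ≤ x) (hx : x ≤ N) (hy1 : 1 ≤ y) (hy : y ≤ N) :
    y ∈ π.part x ↔ lo π y = lo π x := by
  refine ⟨lo_eq_of_mem π, fun h => ?_⟩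
  have h1 := lo_mem π hx1 hx
  have h2 := lo_mem π hy1 hy
  rw [h] at h2
  have e1 : π.part (lo π x) = π.part x := π.part_eq_of_mem (π.part_mem.2 (by simp; omega)) h1
  have e2 : π.part (lo π x) = π.part y := π.part_eq_of_mem (π.part_mem.2 (by simp; omega)) h2
  rw [← e1, e2]
  exact π.mem_part (by simp; omega)

lemma part_eq_fiber {x : ℕ} (hx1 : 1 ≤ x) (hx : x ≤ N) :
    π.part x = fiber N (lo π) (lo π x) := by
  ext y
  rw [mem_fiber]
  constructor
  · intro h
    have := π.part_subset x h
    simp only [mem_Icc] at this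
    exact ⟨this, lo_eq_of_mem π h⟩
  · rintro ⟨⟨h1, h2⟩, h⟩
    exact (mem_part_iff_lo π hx1 hx h1 h2).2 h

lemma lo_bounds {x : ℕ} (hx1 : 1 ≤ x) (hx : x ≤ N) : 1 ≤ lo π x ∧ lo π x ≤ x := by
  have h := π.part_subset x (lo_mem π hx1 hx)
  simp only [mem_Icc] at h
  exact ⟨h.1, lo_le_of_mem π (π.mem_part (by simp; omega))⟩

lemma lo_lo {x : ℕ} (hx1 : 1 ≤ x) (hx : x ≤ N) : lo π (lo π x) = lo π x :=
  lo_eq_of_mem π (lo_mem π hx1 hx)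

lemma mem_parts_iff {B : Finset ℕ} :
    B ∈ π.parts ↔ ∃ a, (1 ≤ a ∧ a ≤ N) ∧ lo π a = a ∧ B = fiber N (lo π) a := by
  constructor
  · intro h
    obtain ⟨x, hx⟩ := π.nonempty_of_mem_parts h
    have hx' := π.le h hx
    simp only [mem_Icc] at hx'
    have hb := lo_bounds π hx'.1 hx'.2
    refine ⟨lo π x, ⟨hb.1, by omega⟩, lo_lo π hx'.1 hx'.2, ?_⟩
    rw [← part_eq_fiber π hx'.1 hx'.2, π.part_eq_of_mem h hx]
  · rintro ⟨a, ⟨h1, h2⟩, ha, rfl⟩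
    have := part_eq_fiber π h1 h2
    rw [ha] at this
    rw [← this]
    exact π.part_mem.2 (by simp; omega)

lemma finpartition_ext_lo {π σ : Finpartition (Icc 1 N)}
    (h : ∀ x, 1 ≤ x → x ≤ N → lo π x = lo σ x) : π = σ := by
  have hf : ∀ a, fiber N (lo π) a = fiber N (lo σ) a := by
    intro a; ext x; simp only [mem_fiber]
    constructor <;> rintro ⟨⟨h1, h2⟩, h3⟩ <;> refine ⟨⟨h1, h2⟩, ?_⟩
    · rw [← h x h1 h2, h3]
    · rw [h x h1 h2, h3]
  apply Finpartition.ext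
  ext B
  rw [mem_parts_iff, mem_parts_iff]
  constructor <;> rintro ⟨a, ⟨h1, h2⟩, ha, rfl⟩ <;> refine ⟨a, ⟨h1, h2⟩, ?_, ?_⟩
  · rw [← h a h1 h2, ha]
  · rw [hf]
  · rw [h a h1 h2, ha]
  · rw [hf]

/-- The number of blocks of size `k` is the number of block minima whose word entry is `k`. -/
lemma card_filter_parts {k : ℕ} (hk : 1 ≤ k) :
    (π.parts.filter fun B => B.card = k).card
      = ((Icc 1 N).filter fun a => word N (lo π) a = k).card := by
  symm
  apply Finset.card_bij (fun a _ => fiber N (lo π) a)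
  · intro a ha
    simp only [mem_filter, mem_Icc] at ha
    have : (fiber N (lo π) a).Nonempty := by
      rw [← Finset.card_pos]; have := ha.2; unfold word at this; omega
    obtain ⟨x, hx⟩ := this
    rw [mem_fiber] at hx
    simp only [mem_filter]
    refine ⟨(mem_parts_iff π).2 ⟨a, ha.1, ?_, rfl⟩, ha.2⟩
    rw [← hx.2]; exact lo_lo π hx.1.1 hx.1.2
  · intro a ha b hb hab
    simp only [mem_filter, mem_Icc] at ha hb
    have : (fiber N (lo π) a).Nonempty := by
      rw [← Finset.card_pos]; have := ha.2; unfold word at this; omega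
    obtain ⟨x, hx⟩ := this
    have hx' := hx
    rw [hab] at hx'
    rw [mem_fiber] at hx hx'
    rw [← hx.2, hx'.2]
  · intro B hB
    simp only [mem_filter] at hB
    obtain ⟨a, h1, h2, rfl⟩ := (mem_parts_iff π).1 hB.1
    exact ⟨a, by simp only [mem_filter, mem_Icc]; exact ⟨h1, hB.2⟩, rfl⟩

end

lemma isLo_lo {N : ℕ} (π : NCPlus N) : IsLo N (lo π.1) := by
  obtain ⟨π, hnc, hpos⟩ := π
  refine ⟨fun x h1 h2 => (lo_bounds π h1 h2).1, fun x h1 h2 => (lo_bounds π h1 h2).2,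
    fun x h1 h2 => lo_lo π h1 h2, ?_, ?_⟩
  · intro x y h1 h2 h3 h4
    by_contra hlt
    push Not at hlt
    dsimp only at *
    have hx := lo_bounds π h1 h2
    have hy1 : 1 ≤ y := by omega
    have hy := lo_bounds π hy1 (by omega)
    have hne : lo π y ≠ lo π x := by omega
    have hney : y ≠ lo π x := by
      rintro rfl; rw [lo_lo π h1 h2] at hlt; omega
    have hnex : y ≠ x := by rintro rfl; omega
    refine hnc _ (π.part_mem.2 (show y ∈ Icc 1 N by simp; omega)) _
      (π.part_mem.2 (show x ∈ Icc 1 N by simp; omega)) ?_ (lo π y)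
      (lo_mem π hy1 (by omega)) (lo π x) (lo_mem π h1 h2) y
      (π.mem_part (by simp; omega)) x (π.mem_part (by simp; omega)) ⟨hlt, by omega, by omega⟩
    intro h
    apply hne
    exact (mem_part_iff_lo π h1 h2 hy1 (by omega)).1 (h ▸ π.mem_part (by simp; omega))
  · obtain ⟨B, hB, h1, hN⟩ := hpos
    have hN' := π.le hB hN
    simp only [mem_Icc] at hN'
    have := lo_bounds π (le_refl 1) hN'.1
    have h2 : N ∈ π.part 1 := by rwa [π.part_eq_of_mem hB h1]
    have := lo_eq_of_mem π h2
    dsimp only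
    omega

/-- The positive non-crossing partition with given block minima. -/
def ofLo {N : ℕ} (f : ℕ → ℕ) (hN : 1 ≤ N) (hf : IsLo N f) : NCPlus N := by
  letI : DecidableRel (Setoid.ker f).r := Classical.decRel _
  refine ⟨Finpartition.ofSetSetoid (Setoid.ker f) (Icc 1 N), ?_, ?_⟩
  · set π := Finpartition.ofSetSetoid (Setoid.ker f) (Icc 1 N) with hπ
    have key : ∀ B ∈ π.parts, ∀ x ∈ B, ∀ y ∈ B, (1 ≤ x ∧ x ≤ N) ∧ (1 ≤ y ∧ y ≤ N) ∧ f x = f y := by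
      intro B hB x hx y hy
      have h : y ∈ π.part x := by rwa [π.part_eq_of_mem hB hx]
      have := (Finpartition.mem_part_ofSetSetoid_iff_rel (Icc 1 N)).1 h
      simpa [Setoid.ker] using this
    intro B hB B' hB' hne a ha b hb c hc d hd ⟨hab, hbc, hcd⟩
    obtain ⟨ha', hc', hac⟩ := key B hB a ha c hc
    obtain ⟨hb', hd', hbd⟩ := key B' hB' b hb d hd
    have i1 := hf.le a ha'.1 ha'.2
    have i2 := hf.le b hb'.1 hb'.2
    have i3 := hf.nest c b hc'.1 hc'.2 (by omega) (by omega)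
    have i4 := hf.nest d c hd'.1 hd'.2 (by omega) (by omega)
    apply hne
    have : b ∈ π.part a := by
      apply (Finpartition.mem_part_ofSetSetoid_iff_rel (Icc 1 N)).2
      simp only [mem_Icc]
      refine ⟨ha', hb', ?_⟩
      change f a = f b
      omega
    rw [π.part_eq_of_mem hB ha] at this
    exact π.eq_of_mem_parts hB hB' this hb
  · refine ⟨_, (Finpartition.part_mem _).2 (show 1 ∈ Icc 1 N by simp; omega),
      Finpartition.mem_part _ (by simp; omega), ?_⟩
    apply (Finpartition.mem_part_ofSetSetoid_iff_rel (Icc 1 N)).2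
    refine ⟨by simp; omega, by simp; omega, ?_⟩
    change f 1 = f N
    rw [hf.last]
    have := hf.le 1 (le_refl _) hN
    have := hf.pos 1 (le_refl _) hN
    omega

lemma lo_ofLo {N : ℕ} (f : ℕ → ℕ) (hN : 1 ≤ N) (hf : IsLo N f) {x : ℕ} (h1 : 1 ≤ x)
    (h2 : x ≤ N) : lo (ofLo f hN hf).1 x = f x := by
  have key : ∀ y, y ∈ (ofLo f hN hf).1.part x ↔ (1 ≤ y ∧ y ≤ N) ∧ f x = f y := by
    intro y
    have := @Finpartition.mem_part_ofSetSetoid_iff_rel ℕ _ x (Setoid.ker f) (Icc 1 N)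
      (Classical.decRel _) y
    simp only [mem_Icc] at this
    constructor
    · intro h
      exact (this.1 h).2
    · intro h
      exact this.2 ⟨⟨h1, h2⟩, h⟩
  apply le_antisymm
  · apply lo_le_of_mem
    rw [key]
    have := hf.pos x h1 h2
    have := hf.le x h1 h2
    exact ⟨by omega, (hf.idem x h1 h2).symm⟩
  · have := (key _).1 (lo_mem (ofLo f hN hf).1 h1 h2)
    rw [this.2]
    exact hf.le _ this.1.1 this.1.2

lemma word_congr {N : ℕ} {f g : ℕ → ℕ} (h : ∀ x, 1 ≤ x → x ≤ N → f x = g x) (a : ℕ) :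
    word N f a = word N g a := by
  unfold word fiber
  congr 1
  apply Finset.filter_congr
  intro x hx
  simp only [mem_Icc] at hx
  rw [h x hx.1 hx.2]

/-! ### Łukasiewicz words -/

lemma sum_word (N : ℕ) (f : ℕ → ℕ) (s : Finset ℕ) :
    ∑ t ∈ s, word N f t = ((Icc 1 N).filter fun y => f y ∈ s).card := by
  rw [Finset.card_eq_sum_card_fiberwise (f := f) (t := s) (by intro x hx; simp at hx; exact hx.2)]
  apply Finset.sum_congr rfl
  intro t ht
  unfold word fiber
  congr 1
  ext x
  simp only [mem_filter]
  constructor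
  · rintro ⟨h1, rfl⟩; exact ⟨⟨h1, ht⟩, rfl⟩
  · rintro ⟨⟨h1, _⟩, h2⟩; exact ⟨h1, h2⟩

/-- `b` is the first place at which the partial sums of `w - 1` that start at `a` return to `0`. -/
def FirstReturn (w : ℕ → ℕ) (a b : ℕ) : Prop :=
  a ≤ b ∧ (∀ j, a < j → j ≤ b → j < a + ∑ t ∈ Ico a j, w t) ∧
    a + ∑ t ∈ Ico a (b + 1), w t = b + 1

lemma FirstReturn.unique {w : ℕ → ℕ} {a b c : ℕ} (hb : FirstReturn w a b)
    (hc : FirstReturn w a c) : b = c := by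
  obtain ⟨h1, h2, h3⟩ := hb
  obtain ⟨g1, g2, g3⟩ := hc
  rcases lt_trichotomy b c with h | h | h
  · have := g2 (b + 1) (by omega) (by omega); omega
  · exact h
  · have := h2 (c + 1) (by omega) (by omega); omega

lemma FirstReturn.congr {w v : ℕ → ℕ} {a b : ℕ} (h : ∀ t, a ≤ t → t ≤ b → w t = v t)
    (hb : FirstReturn w a b) : FirstReturn v a b := by
  have key : ∀ j, j ≤ b + 1 → ∑ t ∈ Ico a j, w t = ∑ t ∈ Ico a j, v t := by
    intro j hj
    apply Finset.sum_congr rfl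
    intro t ht
    simp only [mem_Ico] at ht
    exact h t ht.1 (by omega)
  refine ⟨hb.1, fun j h1 h2 => ?_, ?_⟩
  · rw [← key j (by omega)]; exact hb.2.1 j h1 h2
  · rw [← key _ (le_refl _)]; exact hb.2.2

/-- The last point of the block with minimum `a` is `b`. -/
def IsChord (N : ℕ) (f : ℕ → ℕ) (a b : ℕ) : Prop :=
  1 ≤ a ∧ a ≤ b ∧ b ≤ N ∧ f b = a ∧ ∀ y, b < y → y ≤ N → f y ≠ a

lemma IsLo.firstReturn {N : ℕ} {f : ℕ → ℕ} (hf : IsLo N f) {a b : ℕ} (h : IsChord N f a b) :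
    FirstReturn (word N f) a b := by
  obtain ⟨h1, hab, hbN, hfb, hmax⟩ := h
  refine ⟨hab, fun j hj hjb => ?_, ?_⟩
  · rw [sum_word]
    have : insert b (Ico a j) ⊆ {y ∈ Icc 1 N | f y ∈ Ico a j} := by
      intro y hy
      simp only [mem_insert, mem_Ico] at hy
      simp only [mem_filter, mem_Icc, mem_Ico]
      rcases hy with rfl | hy
      · omega
      · have := hf.le y (by omega) (by omega)
        have := hf.nest b y (by omega) hbN (by omega) (by omega)
        omega
    have := card_le_card this
    rw [card_insert_of_notMem (by simp; omega), Nat.card_Ico] at this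
    omega
  · rw [sum_word]
    have : {y ∈ Icc 1 N | f y ∈ Ico a (b + 1)} = Ico a (b + 1) := by
      ext y
      simp only [mem_filter, mem_Icc, mem_Ico]
      constructor
      · rintro ⟨⟨hy1, hyN⟩, hy2, hy3⟩
        have := hf.le y hy1 hyN
        refine ⟨by omega, ?_⟩
        by_contra hc
        have := hf.nest y b hy1 hyN (by omega) (by omega)
        exact hmax y (by omega) hyN (by omega)
      · rintro ⟨hy1, hy2⟩
        have := hf.le y (by omega) (by omega)
        have := hf.nest b y (by omega) hbN (by omega) (by omega)
        omega
    rw [this, Nat.card_Ico]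
    omega

lemma exists_isChord {N : ℕ} {f : ℕ → ℕ} (hf : IsLo N f) {a : ℕ} (h : 0 < word N f a) :
    ∃ b, IsChord N f a b := by
  have hne : (fiber N f a).Nonempty := Finset.card_pos.1 h
  have hm := (fiber N f a).max'_mem hne
  have hm' := mem_fiber.1 hm
  refine ⟨(fiber N f a).max' hne, ?_, ?_, hm'.1.2, hm'.2, ?_⟩
  · rw [← hm'.2]; exact hf.pos _ hm'.1.1 hm'.1.2
  · conv_lhs => rw [← hm'.2]
    exact hf.le _ hm'.1.1 hm'.1.2
  · intro y hy hyN hfy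
    have := (fiber N f a).le_max' y (mem_fiber.2 ⟨⟨by omega, hyN⟩, hfy⟩)
    omega

/-- The chords of a non-crossing partition are determined by its word. -/
lemma IsLo.isChord_iff {N : ℕ} {f : ℕ → ℕ} (hf : IsLo N f) {a b : ℕ} :
    IsChord N f a b ↔ 0 < word N f a ∧ FirstReturn (word N f) a b := by
  constructor
  · intro h
    refine ⟨Finset.card_pos.2 ⟨b, mem_fiber.2 ⟨⟨?_, h.2.2.1⟩, h.2.2.2.1⟩⟩, hf.firstReturn h⟩
    have := h.1; have := h.2.1; omega
  · rintro ⟨h1, h2⟩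
    obtain ⟨c, hc⟩ := exists_isChord hf h1
    rwa [h2.unique (hf.firstReturn hc)]

lemma IsLo.isChord_one {N : ℕ} {f : ℕ → ℕ} (hf : IsLo N f) (hN : 1 ≤ N) : IsChord N f 1 N :=
  ⟨le_refl _, hN, le_refl _, hf.last, fun y h1 h2 => by omega⟩

open Classical in
/-- The minimum of the block of `x`, read off from the word: the last `a ≤ x` that starts a block
which is not yet complete before `x`. -/
def loOfWord (w : ℕ → ℕ) (x : ℕ) : ℕ :=
  Nat.findGreatest (fun a => 1 ≤ a ∧ 0 < w a ∧ ∀ j, a < j → j ≤ x → j < a + ∑ t ∈ Ico a j, w t) x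

section
variable {N : ℕ} {w : ℕ → ℕ}

lemma le_loOfWord {x a : ℕ} (hax : a ≤ x) (h1 : 1 ≤ a) (h2 : 0 < w a)
    (h3 : ∀ j, a < j → j ≤ x → j < a + ∑ t ∈ Ico a j, w t) : a ≤ loOfWord w x := by
  classical
  exact Nat.le_findGreatest hax ⟨h1, h2, h3⟩

lemma FirstReturn.pos_one (hw : FirstReturn w 1 N) : 0 < w 1 := by
  rcases eq_or_lt_of_le hw.1 with h | h
  · have := hw.2.2
    rw [← h] at this
    simp at this
    omega
  · have := hw.2.1 2 (by omega) (by omega)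
    simp at this
    omega

lemma loOfWord_spec (hw : FirstReturn w 1 N) {x : ℕ} (h1 : 1 ≤ x) (h2 : x ≤ N) :
    (1 ≤ loOfWord w x ∧ loOfWord w x ≤ x) ∧ 0 < w (loOfWord w x) ∧
      ∀ j, loOfWord w x < j → j ≤ x → j < loOfWord w x + ∑ t ∈ Ico (loOfWord w x) j, w t := by
  classical
  have := Nat.findGreatest_spec (P := fun a => 1 ≤ a ∧ 0 < w a ∧
    ∀ j, a < j → j ≤ x → j < a + ∑ t ∈ Ico a j, w t) h1
    ⟨le_refl 1, hw.pos_one, fun j h3 h4 => hw.2.1 j h3 (by omega)⟩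
  exact ⟨⟨this.1, Nat.findGreatest_le _⟩, this.2⟩

lemma sum_Ico_split (w : ℕ → ℕ) {a b c : ℕ} (h1 : a ≤ b) (h2 : b ≤ c) :
    ∑ t ∈ Ico a c, w t = ∑ t ∈ Ico a b, w t + ∑ t ∈ Ico b c, w t :=
  (Finset.sum_Ico_consecutive w h1 h2).symm

lemma isLo_loOfWord (hw : FirstReturn w 1 N) : IsLo N (loOfWord w) := by
  refine ⟨fun x h1 h2 => (loOfWord_spec hw h1 h2).1.1, fun x h1 h2 => (loOfWord_spec hw h1 h2).1.2,
    ?_, ?_, ?_⟩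
  · intro x h1 h2
    obtain ⟨⟨g1, g2⟩, g3, g4⟩ := loOfWord_spec hw h1 h2
    apply le_antisymm (loOfWord_spec hw g1 (by omega)).1.2
    exact le_loOfWord (le_refl _) g1 g3 (fun j _ _ => by omega)
  · intro x y h1 h2 h3 h4
    obtain ⟨⟨g1, g2⟩, g3, g4⟩ := loOfWord_spec hw h1 h2
    exact le_loOfWord h3 g1 g3 (fun j h5 h6 => g4 j h5 (by omega))
  · obtain ⟨⟨g1, g2⟩, g3, g4⟩ := loOfWord_spec hw hw.1 (le_refl _)
    by_contra hne
    set a := loOfWord w N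
    have e1 := hw.2.1 a (by omega) g2
    have e2 := hw.2.2
    rw [sum_Ico_split w (show 1 ≤ a by omega) (show a ≤ N + 1 by omega),
      Finset.sum_Ico_succ_top g2] at e2
    rcases eq_or_lt_of_le g2 with h | h
    · rw [h] at e1 e2 g3; simp at e2; omega
    · have := g4 N h (le_refl _)
      omega

lemma exists_firstReturn (hw : FirstReturn w 1 N) {a : ℕ} (h1 : 1 ≤ a) (h2 : a ≤ N)
    (ha : 0 < w a) : ∃ b ≤ N, FirstReturn w a b := by
  have hex : ∃ j, a < j ∧ a + ∑ t ∈ Ico a j, w t ≤ j := by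
    refine ⟨N + 1, by omega, ?_⟩
    have e2 := hw.2.2
    rw [sum_Ico_split w (show 1 ≤ a by omega) (show a ≤ N + 1 by omega)] at e2
    rcases eq_or_lt_of_le h1 with h | h
    · subst h; simp at e2; omega
    · have := hw.2.1 a h h2; omega
  classical
  obtain ⟨k1, k2⟩ := Nat.find_spec hex
  set j := Nat.find hex
  have hmin : ∀ i, a < i → i < j → i < a + ∑ t ∈ Ico a i, w t := by
    intro i h3 h4
    have := Nat.find_min hex h4
    push Not at this
    exact this h3
  refine ⟨j - 1, ?_, by omega, fun i h3 h4 => hmin i h3 (by omega), ?_⟩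
  · have : j ≤ N + 1 := by
      apply Nat.find_min'
      refine ⟨by omega, ?_⟩
      have e2 := hw.2.2
      rw [sum_Ico_split w (show 1 ≤ a by omega) (show a ≤ N + 1 by omega)] at e2
      rcases eq_or_lt_of_le h1 with h | h
      · subst h; simp at e2; omega
      · have := hw.2.1 a h h2; omega
    omega
  · obtain ⟨i, hi⟩ : ∃ i, j = i + 1 := ⟨j - 1, by omega⟩
    rw [hi] at k1 k2 hmin ⊢
    simp only [Nat.add_sub_cancel]
    rw [Finset.sum_Ico_succ_top (by omega)] at k2 ⊢
    rcases eq_or_lt_of_le (show a ≤ i by omega) with h | h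
    · subst h; simp at k2 ⊢; omega
    · have := hmin i h (by omega); omega

lemma word_loOfWord (hw : FirstReturn w 1 N) {a : ℕ} (h1 : 1 ≤ a) (h2 : a ≤ N) :
    word N (loOfWord w) a = w a := by
  -- downward induction on `a`: the blocks that start in `[a, b]` fill this interval
  induction hn : N - a using Nat.strong_induction_on generalizing a with
  | _ n ih =>
  rcases Nat.eq_zero_or_pos (w a) with h0 | hpos
  · rw [h0]
    rw [word, Finset.card_eq_zero, Finset.eq_empty_iff_forall_notMem]
    intro y hy
    rw [mem_fiber] at hy
    have := (loOfWord_spec hw hy.1.1 hy.1.2).2.1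
    rw [hy.2] at this
    omega
  · obtain ⟨b, hbN, hb⟩ := exists_firstReturn hw h1 h2 hpos
    have e1 : ∑ t ∈ Ico a (b + 1), word N (loOfWord w) t = b + 1 - a := by
      rw [sum_word, ← Nat.card_Ico]
      congr 1
      ext y
      simp only [mem_filter, mem_Icc, mem_Ico]
      constructor
      · rintro ⟨⟨hy1, hyN⟩, hy2, hy3⟩
        obtain ⟨⟨g1, g2⟩, g3, g4⟩ := loOfWord_spec hw hy1 hyN
        refine ⟨by omega, ?_⟩
        by_contra hc
        have i1 := g4 (b + 1) hy3 (by omega)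
        have i2 := hb.2.2
        rw [sum_Ico_split w hy2 hy3.le] at i2
        rcases eq_or_lt_of_le hy2 with h | h
        · rw [← h] at i1 i2; simp at i2; omega
        · have := hb.2.1 _ h (by omega); omega
      · rintro ⟨hy1, hy2⟩
        obtain ⟨⟨g1, g2⟩, g3, g4⟩ := loOfWord_spec hw (show 1 ≤ y by omega) (show y ≤ N by omega)
        have := le_loOfWord hy1 h1 hpos (fun j h3 h4 => hb.2.1 j h3 (by omega))
        omega
    have e2 := hb.2.2
    have hab := hb.1
    rw [Finset.sum_eq_sum_Ico_succ_bot (by omega)] at e1 e2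
    have e3 : ∑ t ∈ Ico (a + 1) (b + 1), word N (loOfWord w) t = ∑ t ∈ Ico (a + 1) (b + 1), w t := by
      apply Finset.sum_congr rfl
      intro t ht
      simp only [mem_Ico] at ht
      exact ih (N - t) (by omega) (by omega) (by omega) rfl
    omega

lemma IsLo.loOfWord_word {f : ℕ → ℕ} (hf : IsLo N f) {x : ℕ} (h1 : 1 ≤ x) (h2 : x ≤ N) :
    loOfWord (word N f) x = f x := by
  have hw : FirstReturn (word N f) 1 N := hf.firstReturn (hf.isChord_one (by omega))
  have hx1 := hf.pos x h1 h2
  have hx2 := hf.le x h1 h2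
  have hpos : 0 < word N f (f x) := Finset.card_pos.2 ⟨x, mem_fiber.2 ⟨⟨h1, h2⟩, rfl⟩⟩
  apply le_antisymm
  · by_contra hlt
    push Not at hlt
    obtain ⟨⟨g1, g2⟩, g3, g4⟩ := loOfWord_spec hw h1 h2
    set a := loOfWord (word N f) x
    obtain ⟨b, hb⟩ := exists_isChord hf g3
    have hfa : f a = a := by
      have := hf.idem b (by have := hb.1; have := hb.2.1; omega) hb.2.2.1
      rwa [hb.2.2.2.1] at this
    have hax : a ≠ x := by
      intro h
      rw [h] at hfa
      omega
    have hbx : x ≤ b := by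
      by_contra hc
      have := g4 (b + 1) (by have := hb.2.1; omega) (by omega)
      have := (hf.firstReturn hb).2.2
      omega
    have := hf.nest b x (by omega) hb.2.2.1 (by rw [hb.2.2.2.1]; exact g2) hbx
    rw [hb.2.2.2.1] at this
    omega
  · obtain ⟨b, hb⟩ := exists_isChord hf hpos
    apply le_loOfWord hx2 hx1 hpos
    intro j h3 h4
    have hbx : x ≤ b := by
      by_contra hc
      exact hb.2.2.2.2 x (by omega) h2 rfl
    exact (hf.firstReturn hb).2.1 j h3 (by omega)

end

/-- The positive non-crossing partition with a given Łukasiewicz word. -/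
def ofWord {N : ℕ} (w : ℕ → ℕ) (hw : FirstReturn w 1 N) : NCPlus N :=
  ofLo (loOfWord w) hw.1 (isLo_loOfWord hw)

lemma word_ofWord {N : ℕ} {w : ℕ → ℕ} (hw : FirstReturn w 1 N) {a : ℕ} (h1 : 1 ≤ a)
    (h2 : a ≤ N) : word N (lo (ofWord w hw).1) a = w a := by
  rw [← word_loOfWord hw h1 h2]
  exact word_congr (fun x h1 h2 => lo_ofLo _ _ _ h1 h2) a

lemma NCPlus.ext_word {N : ℕ} {π σ : NCPlus N}
    (h : ∀ a, 1 ≤ a → a ≤ N → word N (lo π.1) a = word N (lo σ.1) a) : π = σ := by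
  have hp := isLo_lo π
  have hs := isLo_lo σ
  apply Subtype.ext
  apply finpartition_ext_lo
  intro x h1 h2
  have h3 : ∀ a, 1 ≤ a → a ≤ N → word N (lo π.1) a = word N (lo σ.1) a := h
  rw [← hp.loOfWord_word h1 h2, ← hs.loOfWord_word h1 h2]
  have hsum : ∀ a j, 1 ≤ a → j ≤ x →
      ∑ t ∈ Ico a j, word N (lo π.1) t = ∑ t ∈ Ico a j, word N (lo σ.1) t := by
    intro a j ha hj
    apply Finset.sum_congr rfl
    intro t ht
    simp only [mem_Ico] at ht
    exact h3 t (by omega) (by omega)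
  have hw1 : FirstReturn (word N (lo π.1)) 1 N := hp.firstReturn (hp.isChord_one (by omega))
  have hw2 : FirstReturn (word N (lo σ.1)) 1 N := hs.firstReturn (hs.isChord_one (by omega))
  apply le_antisymm
  · obtain ⟨⟨g1, g2⟩, g3, g4⟩ := loOfWord_spec hw1 h1 h2
    refine le_loOfWord g2 g1 (by rwa [← h3 _ g1 (by omega)]) fun j h5 h6 => ?_
    rw [← hsum _ _ g1 h6]; exact g4 j h5 h6
  · obtain ⟨⟨g1, g2⟩, g3, g4⟩ := loOfWord_spec hw2 h1 h2
    refine le_loOfWord g2 g1 (by rwa [h3 _ g1 (by omega)]) fun j h5 h6 => ?_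
    rw [hsum _ _ g1 h6]; exact g4 j h5 h6

/-! ### The pseudo-rotation maps positive non-crossing partitions to such partitions -/

lemma IsLo.noncrossing {N : ℕ} {f : ℕ → ℕ} (hf : IsLo N f) {p q r s : ℕ} (hp : 1 ≤ p)
    (hpq : p < q) (hqr : q < r) (hrs : r < s) (hs : s ≤ N) (h1 : f p = f r) (h2 : f q = f s) :
    f p = f q := by
  have i1 := hf.le p hp (by omega)
  have i2 := hf.le q (by omega) (by omega)
  have i3 := hf.nest r q (by omega) (by omega) (by omega) (by omega)
  have i4 := hf.nest s r (by omega) (by omega) (by omega) (by omega)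
  omega

lemma IsLo.one {N : ℕ} {f : ℕ → ℕ} (hf : IsLo N f) (hN : 1 ≤ N) : f 1 = 1 := by
  have := hf.le 1 (le_refl _) hN
  have := hf.pos 1 (le_refl _) hN
  omega

/-- The three cases in the definition of the pseudo-rotation, in terms of block minima. -/
lemma kappaPoint_cases {N : ℕ} (hN : 2 ≤ N) (π : NCPlus N) :
    (lo π.1 (N - 1) = 1 ∧ ∀ x, kappaPoint π.1 x = if x = N then 1 else x + 1) ∨
    (3 ≤ N ∧ lo π.1 (N - 1) = N - 1 ∧
      ∀ x, kappaPoint π.1 x = if x = 1 then 1 else if x = N then N else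
        if x = N - 1 then 2 else x + 1) ∨
    (1 < lo π.1 (N - 1) ∧ lo π.1 (N - 1) < N - 1 ∧
      ∀ x, kappaPoint π.1 x = if x = lo π.1 (N - 1) then 1 else
        if x = N then lo π.1 (N - 1) + 1 else x + 1) := by
  have hf := isLo_lo π
  have h1 : N - 1 ∈ π.1.part 1 ↔ lo π.1 (N - 1) = 1 := by
    rw [mem_part_iff_lo π.1 (le_refl 1) (by omega) (by omega) (by omega), hf.one (by omega)]
  have h2 : lo π.1 (N - 1) ≠ 1 → (π.1.part (N - 1) = {N - 1} ↔ lo π.1 (N - 1) = N - 1) := by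
    intro hlo1
    constructor
    · intro h
      have := lo_mem π.1 (x := N - 1) (by omega) (by omega)
      rw [h] at this
      simpa using this
    · intro h
      rw [part_eq_fiber π.1 (by omega) (by omega), h]
      ext x
      rw [mem_fiber, mem_singleton]
      constructor
      · rintro ⟨⟨g1, g2⟩, g3⟩
        have := hf.le x g1 g2
        by_contra hne
        have : x = N := by omega
        rw [this, hf.last] at g3
        omega
      · intro hx; subst hx; exact ⟨by omega, h⟩
  have hb := lo_bounds π.1 (x := N - 1) (by omega) (by omega)
  by_cases c1 : lo π.1 (N - 1) = 1
  · left
    refine ⟨c1, fun x => ?_⟩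
    rw [kappaPoint, if_pos (h1.2 c1)]
  · right
    by_cases c2 : lo π.1 (N - 1) = N - 1
    · left
      refine ⟨by omega, c2, fun x => ?_⟩
      rw [kappaPoint, if_neg (fun h => c1 (h1.1 h)), if_pos ((h2 c1).2 c2)]
    · right
      refine ⟨by omega, by omega, fun x => ?_⟩
      rw [kappaPoint, if_neg (fun h => c1 (h1.1 h)), if_neg (fun h => c2 ((h2 c1).1 h))]
      rfl

lemma kappaPoint_mem {N : ℕ} (hN : 2 ≤ N) (π : NCPlus N) {x : ℕ} (h1 : 1 ≤ x) (h2 : x ≤ N) :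
    1 ≤ kappaPoint π.1 x ∧ kappaPoint π.1 x ≤ N := by
  rcases kappaPoint_cases hN π with ⟨_, h⟩ | ⟨_, _, h⟩ | ⟨_, _, h⟩ <;> rw [h] <;> split_ifs <;> omega

lemma kappaPoint_injOn {N : ℕ} (hN : 2 ≤ N) (π : NCPlus N) {x y : ℕ} (hx1 : 1 ≤ x) (hx : x ≤ N)
    (hy1 : 1 ≤ y) (hy : y ≤ N) (hxy : kappaPoint π.1 x = kappaPoint π.1 y) : x = y := by
  rcases kappaPoint_cases hN π with ⟨_, h⟩ | ⟨_, _, h⟩ | ⟨_, _, h⟩ <;> rw [h, h] at hxy <;>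
    split_ifs at hxy <;> omega

lemma kappaPoint_surjOn {N : ℕ} (hN : 2 ≤ N) (π : NCPlus N) {y : ℕ} (hy1 : 1 ≤ y) (hy : y ≤ N) :
    ∃ x, (1 ≤ x ∧ x ≤ N) ∧ kappaPoint π.1 x = y := by
  have : (Icc 1 N).image (kappaPoint π.1) = Icc 1 N := by
    apply Finset.eq_of_subset_of_card_le
    · intro z hz
      simp only [mem_image, mem_Icc] at hz ⊢
      obtain ⟨x, hx, rfl⟩ := hz
      exact kappaPoint_mem hN π hx.1 hx.2
    · rw [Finset.card_image_of_injOn]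
      intro x hx z hz h
      simp only [coe_Icc, Set.mem_Icc] at hx hz
      exact kappaPoint_injOn hN π hx.1 hx.2 hz.1 hz.2 h
  have hy' : y ∈ (Icc 1 N).image (kappaPoint π.1) := by rw [this]; simp; omega
  simpa using hy'

/-- The pseudo-rotation creates no crossing: if `a, c` and `b, d` are in the same blocks and the images
of `a, b, c, d` are in increasing order, then `a` and `b` are in the same block. -/
lemma kappaPoint_noncrossing {N : ℕ} (hN : 2 ≤ N) (π : NCPlus N) {a b c d : ℕ}
    (ha : 1 ≤ a ∧ a ≤ N) (hb : 1 ≤ b ∧ b ≤ N) (hc : 1 ≤ c ∧ c ≤ N) (hd : 1 ≤ d ∧ d ≤ N)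
    (hac : lo π.1 a = lo π.1 c) (hbd : lo π.1 b = lo π.1 d)
    (h1 : kappaPoint π.1 a < kappaPoint π.1 b) (h2 : kappaPoint π.1 b < kappaPoint π.1 c)
    (h3 : kappaPoint π.1 c < kappaPoint π.1 d) : lo π.1 a = lo π.1 b := by
  have hf := isLo_lo π
  have hcases := kappaPoint_cases hN π
  generalize kappaPoint π.1 = φ at *
  generalize lo π.1 = f at *
  clear π
  have h01 := hf.one (show 1 ≤ N by omega)
  have h0N := hf.last
  have nc : ∀ p q r s, 1 ≤ p → p < q → q < r → r < s → s ≤ N → f p = f r → f q = f s → f p = f q :=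
    fun p q r s i1 i2 i3 i4 i5 => hf.noncrossing i1 i2 i3 i4 i5
  have la := hf.le a ha.1 ha.2
  have lb := hf.le b hb.1 hb.2
  have lc := hf.le c hc.1 hc.2
  have ld := hf.le d hd.1 hd.2
  have eN : ∀ x, x = N → f x = 1 := by rintro x rfl; exact h0N
  have eN1 : ∀ x, x = N - 1 → f x = f (N - 1) := by rintro x rfl; rfl
  have ea := eN a
  have eb := eN b
  have ec := eN c
  have ed := eN d
  have ea1 := eN1 a
  have eb1 := eN1 b
  have ec1 := eN1 c
  have ed1 := eN1 d
  have n1 := nc a b c d ha.1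
  rcases hcases with ⟨e, h⟩ | ⟨hN3, e, h⟩ | ⟨e1, e2, h⟩
  · -- if `a = N` becomes `1`, the crossing was `b < c < d < N` before the rotation
    simp only [h] at h1 h2 h3
    have n2 := nc b c d N hb.1
    split_ifs at h1 h2 h3 <;> omega
  · simp only [h] at h1 h2 h3
    have key : ∀ x, 1 ≤ x → x ≤ N → f x = N - 1 → x = N - 1 := by
      intro x g1 g2 g3
      have := hf.le x g1 g2
      have := eN x
      omega
    have hac' : a = c → False := by rintro rfl; omega
    have hbd' : b = d → False := by rintro rfl; omega
    have ka : a ≠ N - 1 := fun hh =>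
      hac' (by rw [hh]; exact (key c hc.1 hc.2 (by rw [← hac, ea1 hh, e])).symm)
    have kb : b ≠ N - 1 := fun hh =>
      hbd' (by rw [hh]; exact (key d hd.1 hd.2 (by rw [← hbd, eb1 hh, e])).symm)
    have kc : c ≠ N - 1 := fun hh => ka (key a ha.1 ha.2 (by rw [hac, ec1 hh, e]))
    have kd : d ≠ N - 1 := fun hh => kb (key b hb.1 hb.2 (by rw [hbd, ed1 hh, e]))
    rw [if_neg kb] at h1 h2
    rw [if_neg kc] at h2 h3
    rw [if_neg ka] at h1
    rw [if_neg kd] at h3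
    have l1 : a < b := by clear h2 h3 n1; split_ifs at h1 <;> omega
    have l2 : b < c := by clear h1 h3 n1; split_ifs at h2 <;> omega
    have l3 : c < d := by clear h1 h2 n1; split_ifs at h3 <;> omega
    exact n1 l1 l2 l3 hd.2 hac hbd
  · by_contra hne
    simp only [h] at h1 h2 h3
    have hf1 := hf.idem (N - 1) (by omega) (by omega)
    have em : ∀ x, x = f (N - 1) → f x = f (N - 1) := by
      intro x hx; rw [hx, hf1]
    -- no block other than that of `N - 1` separates its minimum from `N - 1`
    have sep : ∀ x y, 1 ≤ x → x < f (N - 1) → f (N - 1) < y → y < N - 1 → f x ≠ f y := by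
      intro x y g1 g2 g3 g4 g5
      have := hf.noncrossing g1 g2 g3 g4 (by omega) g5 (by rw [hf1])
      have := hf.le x g1 (by omega)
      omega
    have fa := em a
    have fb := em b
    have fc := em c
    have fd := em d
    have s1 := sep 1 d
    have s2 := sep b d
    have s3 := sep 1 c
    have n2 := nc (f (N - 1)) b c d
    have n3 := nc a b c N
    rw [hf1] at n2
    generalize f (N - 1) = m at *
    have hb1 : b ≠ m := by intro hh; rw [if_pos hh] at h1; split_ifs at h1 <;> omega
    have hc1 : c ≠ m := by intro hh; rw [if_pos hh] at h2; split_ifs at h2 <;> omega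
    have hd1 : d ≠ m := by intro hh; rw [if_pos hh] at h3; split_ifs at h3 <;> omega
    rw [if_neg hb1] at h1 h2
    rw [if_neg hc1] at h2 h3
    rw [if_neg hd1] at h3
    by_cases ha1 : a = m
    -- the least of the four images is `1`, the image of the minimum of the block of `N - 1`
    · rw [if_pos ha1] at h1
      have hcN : c ≠ N := by clear * - ha1 fa ec hac e1; omega
      rw [if_neg hcN] at h2 h3
      have hdN : d ≠ N := by
        intro hh; rw [if_pos hh] at h3
        clear * - h3 fa ha1 hac lc; omega
      rw [if_neg hdN] at h3
      have hdN1 : d ≠ N - 1 := by clear * - ha1 fa ed1 hbd hne; omega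
      by_cases hbN : b = N
      · rw [if_pos hbN] at h1 h2
        clear * - h1 h2 h3 s1 hd hdN1 hdN e1 h01 hbd eb hbN
        omega
      · rw [if_neg hbN] at h1 h2
        clear * - h1 h2 h3 s2 n2 hb hc hd hb1 hdN1 hdN e1 hbd hac ha1 fa hne lc
        omega
    · rw [if_neg ha1] at h1
      clear n2 fa fb fc fd
      by_cases haN : a = N
      · have hbN : b ≠ N := by clear * - haN ea eb hne; omega
        have hdN : d ≠ N := by clear * - haN ea ed hne hbd; omega
        rw [if_pos haN] at h1
        rw [if_neg hbN] at h1 h2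
        rw [if_neg hdN] at h3
        have hcN : c ≠ N := by
          intro hh; rw [if_pos hh] at h2
          clear * - h1 h2; omega
        rw [if_neg hcN] at h2 h3
        clear * - h1 h2 h3 s3 hd hdN e1 h01 hac ea haN
        omega
      · rw [if_neg haN] at h1
        by_cases hbN : b = N
        · rw [if_pos hbN] at h1 h2
          have hdN : d ≠ N := by
            intro hh; rw [if_pos hh] at h3
            clear * - h2 h3; omega
          rw [if_neg hdN] at h3
          have hcN : c ≠ N := by
            intro hh; rw [if_pos hh] at h2
            clear * - h2; omega
          rw [if_neg hcN] at h2 h3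
          clear * - h1 h2 h3 s1 hd hdN e1 h01 hbd eb hbN ed1
          omega
        · rw [if_neg hbN] at h1 h2
          by_cases hcN : c = N
          · have hdN : d ≠ N := by
              intro hh; rw [if_pos hh, if_pos hcN] at h3
              clear * - h3; omega
            rw [if_neg hdN, if_pos hcN] at h3
            rw [if_pos hcN] at h2
            clear * - h1 h2 h3 s2 hd hb hdN e1 h01 hbd lb ed1 hb1
            omega
          · rw [if_neg hcN] at h2 h3
            by_cases hdN : d = N
            · rw [if_pos hdN] at h3
              clear * - h1 h2 h3 n3 ha hc e2 hac hbd hdN ed h0N hne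
              omega
            · rw [if_neg hdN] at h3
              clear * - h1 h2 h3 n1 hd hac hbd hne
              omega

/-! ### The pseudo-rotation as a permutation -/

lemma lo_eq_of_mem_parts {N : ℕ} {π : Finpartition (Icc 1 N)} {B : Finset ℕ} (hB : B ∈ π.parts)
    {x y : ℕ} (hx : x ∈ B) (hy : y ∈ B) : lo π x = lo π y := by
  have : x ∈ π.part y := by rwa [π.part_eq_of_mem hB hy]
  exact lo_eq_of_mem π this

lemma bounds_of_mem_parts {N : ℕ} {π : Finpartition (Icc 1 N)} {B : Finset ℕ} (hB : B ∈ π.parts)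
    {x : ℕ} (hx : x ∈ B) : 1 ≤ x ∧ x ≤ N := by
  simpa using π.le hB hx

lemma eq_of_lo_eq {N : ℕ} {π : Finpartition (Icc 1 N)} {B B' : Finset ℕ} (hB : B ∈ π.parts)
    (hB' : B' ∈ π.parts) {x y : ℕ} (hx : x ∈ B) (hy : y ∈ B') (h : lo π x = lo π y) : B = B' := by
  have h1 := bounds_of_mem_parts hB hx
  have h2 := bounds_of_mem_parts hB' hy
  have := (mem_part_iff_lo π h2.1 h2.2 h1.1 h1.2).2 h
  rw [π.part_eq_of_mem hB' hy] at this
  exact π.eq_of_mem_parts hB hB' hx this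

/-- The image of a positive non-crossing partition under the pseudo-rotation. -/
def kappaPartition {N : ℕ} (hN : 2 ≤ N) (π : NCPlus N) : Finpartition (Icc 1 N) :=
  Finpartition.ofExistsUnique (kappaParts π.1)
    (by
      intro p hp x hx
      simp only [kappaParts, mem_image] at hp
      obtain ⟨B, hB, rfl⟩ := hp
      obtain ⟨y, hy, rfl⟩ := mem_image.1 hx
      have := bounds_of_mem_parts hB hy
      rw [mem_Icc]
      exact kappaPoint_mem hN π this.1 this.2)
    (by
      intro a ha
      rw [mem_Icc] at ha
      obtain ⟨x, hx, rfl⟩ := kappaPoint_surjOn hN π ha.1 ha.2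
      refine ⟨(π.1.part x).image (kappaPoint π.1),
        ⟨mem_image_of_mem _ (π.1.part_mem.2 (by simpa using hx)),
          mem_image_of_mem _ (π.1.mem_part (by simpa using hx))⟩, ?_⟩
      rintro t ⟨ht, hxt⟩
      simp only [kappaParts, mem_image] at ht
      obtain ⟨B, hB, rfl⟩ := ht
      obtain ⟨y, hy, hyx⟩ := mem_image.1 hxt
      have hy' := bounds_of_mem_parts hB hy
      have := kappaPoint_injOn hN π hy'.1 hy'.2 hx.1 hx.2 hyx
      subst this
      rw [π.1.part_eq_of_mem hB hy])
    (by
      intro h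
      simp only [kappaParts, mem_image, image_eq_empty] at h
      obtain ⟨B, hB, rfl⟩ := h
      exact π.1.empty_notMem_parts hB)

/-- The image of a positive partition is positive. In each of the three cases, two points of one block
go to `1` and `N`. -/
lemma one_mem_block {N : ℕ} (hN : 2 ≤ N) (π : NCPlus N) (C : Finset ℕ) (hC : C ∈ kappaParts π.1) :
    1 ∈ C ↔ N ∈ C := by
  simp only [kappaParts, mem_image] at hC
  obtain ⟨B, hB, rfl⟩ := hC
  have hf := isLo_lo π
  have h01 := hf.one (show 1 ≤ N by omega)
  have h0N := hf.last
  have key : ∀ x y, 1 ≤ x → x ≤ N → 1 ≤ y → y ≤ N → lo π.1 x = lo π.1 y →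
      kappaPoint π.1 x = 1 → kappaPoint π.1 y = N →
      (1 ∈ B.image (kappaPoint π.1) ↔ N ∈ B.image (kappaPoint π.1)) := by
    intro x y hx1 hx hy1 hy hxy ex ey
    have : ∀ z w, 1 ≤ z → z ≤ N → 1 ≤ w → w ≤ N → lo π.1 z = lo π.1 w →
        kappaPoint π.1 z ∈ B.image (kappaPoint π.1) →
        kappaPoint π.1 w ∈ B.image (kappaPoint π.1) := by
      intro z w hz1 hz hw1 hw hzw h
      obtain ⟨u, hu, huz⟩ := mem_image.1 h
      have hub := bounds_of_mem_parts hB hu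
      have := kappaPoint_injOn hN π hub.1 hub.2 hz1 hz huz
      subst this
      have h2 := (mem_part_iff_lo π.1 hub.1 hub.2 hw1 hw).2 hzw.symm
      rw [π.1.part_eq_of_mem hB hu] at h2
      exact mem_image_of_mem _ h2
    have h3 := this x y hx1 hx hy1 hy hxy
    have h4 := this y x hy1 hy hx1 hx hxy.symm
    rw [ex, ey] at h3 h4
    exact ⟨h3, h4⟩
  rcases kappaPoint_cases hN π with ⟨e, h⟩ | ⟨hN3, e, h⟩ | ⟨e1, e2, h⟩
  · refine key N (N - 1) (by omega) (le_refl _) (by omega) (by omega) (by omega) ?_ ?_ <;>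
      rw [h] <;> split_ifs <;> omega
  · refine key 1 N (by omega) (by omega) (by omega) (by omega) (by omega) ?_ ?_ <;>
      rw [h] <;> split_ifs <;> omega
  · refine key (lo π.1 (N - 1)) (N - 1) (by omega) (by omega) (by omega) (by omega)
      (hf.idem _ (by omega) (by omega)) ?_ ?_ <;> rw [h] <;> split_ifs <;> omega

/-- The pseudo-rotation as a map from the positive non-crossing partitions to themselves. -/
def kappaMap {N : ℕ} (hN : 2 ≤ N) (π : NCPlus N) : NCPlus N := by
  refine ⟨kappaPartition hN π, ?_, ?_⟩
  · intro C hC C' hC' hne a ha b hb c hc d hd ⟨h1, h2, h3⟩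
    obtain ⟨B, hB, rfl⟩ := mem_image.1 (show C ∈ kappaParts π.1 from hC)
    obtain ⟨B', hB', rfl⟩ := mem_image.1 (show C' ∈ kappaParts π.1 from hC')
    obtain ⟨a, ha', rfl⟩ := mem_image.1 ha
    obtain ⟨b, hb', rfl⟩ := mem_image.1 hb
    obtain ⟨c, hc', rfl⟩ := mem_image.1 hc
    obtain ⟨d, hd', rfl⟩ := mem_image.1 hd
    have := kappaPoint_noncrossing hN π (bounds_of_mem_parts hB ha') (bounds_of_mem_parts hB' hb')
      (bounds_of_mem_parts hB hc') (bounds_of_mem_parts hB' hd') (lo_eq_of_mem_parts hB ha' hc')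
      (lo_eq_of_mem_parts hB' hb' hd') h1 h2 h3
    exact hne (by rw [eq_of_lo_eq hB hB' ha' hb' this])
  · have h1 : 1 ∈ Icc 1 N := by simp; omega
    refine ⟨(kappaPartition hN π).part 1, (Finpartition.part_mem _).2 h1,
      Finpartition.mem_part _ h1, ?_⟩
    exact (one_mem_block hN π _ ((Finpartition.part_mem (P := kappaPartition hN π)).2 h1)).1
      (Finpartition.mem_part _ h1)

/-! ### The chord diagram -/

/-- `π` has a block of size `k` which does not contain `1`, and whose first and last points are `a`
and `b`. -/
def HasChord {N : ℕ} (π : NCPlus N) (a b k : ℕ) : Prop :=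
  ∃ B ∈ π.1.parts, 1 ∉ B ∧ a ∈ B ∧ b ∈ B ∧ (∀ x ∈ B, a ≤ x ∧ x ≤ b) ∧ B.card = k

lemma hasChord_iff {N : ℕ} (π : NCPlus N) {a b k : ℕ} :
    HasChord π a b k ↔ 2 ≤ a ∧ IsChord N (lo π.1) a b ∧ word N (lo π.1) a = k := by
  have hf := isLo_lo π
  constructor
  · rintro ⟨B, hB, h1, ha, hb, hab, rfl⟩
    have ha' := bounds_of_mem_parts hB ha
    have hb' := bounds_of_mem_parts hB hb
    have hpart := π.1.part_eq_of_mem hB ha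
    have hloa : lo π.1 a = a := by
      have h2 := lo_mem π.1 ha'.1 ha'.2
      rw [hpart] at h2
      have := (hab _ h2).1
      have := hf.le a ha'.1 ha'.2
      omega
    have hfib : B = fiber N (lo π.1) a := by
      rw [← hpart, part_eq_fiber π.1 ha'.1 ha'.2, hloa]
    refine ⟨?_, ⟨ha'.1, (hab b hb).1, hb'.2, ?_, ?_⟩, ?_⟩
    · have : a ≠ 1 := by rintro rfl; exact h1 ha
      omega
    · rw [lo_eq_of_mem_parts hB hb ha, hloa]
    · intro y hy hyN hya
      have : y ∈ B := by rw [hfib, mem_fiber]; exact ⟨⟨by omega, hyN⟩, hya⟩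
      have := (hab y this).2
      omega
    · rw [word, ← hfib]
  · rintro ⟨h2, ⟨h1, hab, hbN, hfb, hmax⟩, rfl⟩
    have hloa : lo π.1 a = a := by
      have := hf.idem b (by omega) hbN
      rwa [hfb] at this
    refine ⟨fiber N (lo π.1) a, (mem_parts_iff π.1).2 ⟨a, ⟨h1, by omega⟩, hloa, rfl⟩, ?_, ?_, ?_, ?_,
      rfl⟩
    · rw [mem_fiber]; rintro ⟨_, h⟩; rw [hf.one (by omega)] at h; omega
    · rw [mem_fiber]; exact ⟨⟨h1, by omega⟩, hloa⟩
    · rw [mem_fiber]; exact ⟨⟨by omega, hbN⟩, hfb⟩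
    · intro x hx
      rw [mem_fiber] at hx
      have := hf.le x hx.1.1 hx.1.2
      refine ⟨by omega, ?_⟩
      by_contra hc
      exact hmax x (by omega) hx.1.2 hx.2

lemma HasChord.bounds {N : ℕ} {π : NCPlus N} {a b k : ℕ} (h : HasChord π a b k) :
    2 ≤ a ∧ a ≤ b ∧ b + 1 ≤ N ∧ 1 ≤ k := by
  have h' := (hasChord_iff π).1 h
  obtain ⟨h1, ⟨h2, h3, h4, h5, h6⟩, h7⟩ := h'
  have hbN : b ≠ N := by
    rintro rfl
    rw [(isLo_lo π).last] at h5
    omega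
  obtain ⟨B, hB, _, _, _, _, rfl⟩ := h
  exact ⟨h1, h3, by omega, Finset.card_pos.2 (π.1.nonempty_of_mem_parts hB)⟩

lemma HasChord.lo_eq {N : ℕ} {π : NCPlus N} {a b k : ℕ} (h : HasChord π a b k) :
    lo π.1 a = a ∧ lo π.1 b = a := by
  have := h.bounds
  obtain ⟨h1, ⟨h2, h3, h4, h5, h6⟩, h7⟩ := (hasChord_iff π).1 h
  refine ⟨?_, h5⟩
  have := (isLo_lo π).idem b (by omega) (by omega)
  rwa [h5] at this

/-- The last point of a block is determined by the first, and so is the size. -/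
lemma HasChord.unique {N : ℕ} {π : NCPlus N} {a b k b' k' : ℕ} (h : HasChord π a b k)
    (h' : HasChord π a b' k') : b = b' ∧ k = k' := by
  obtain ⟨B, hB, _, ha, hb, hm, rfl⟩ := h
  obtain ⟨B', hB', _, ha', hb', hm', rfl⟩ := h'
  have := π.1.eq_of_mem_parts hB hB' ha ha'
  subst this
  have := hm _ hb'
  have := hm' _ hb
  exact ⟨by omega, rfl⟩

/-- Chords of different blocks do not cross. -/
lemma HasChord.noncrossing {N : ℕ} {π : NCPlus N} {a b k a' b' k' : ℕ} (h : HasChord π a b k)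
    (h' : HasChord π a' b' k') : ¬ (a < a' ∧ a' ≤ b ∧ b < b') := by
  rintro ⟨h1, h2, h3⟩
  have hb := h.bounds
  have hb' := h'.bounds
  have e := h.lo_eq
  have e' := h'.lo_eq
  rcases eq_or_lt_of_le h2 with h4 | h4
  · rw [h4] at e'; omega
  · have := (isLo_lo π).noncrossing (show 1 ≤ a by omega) h1 h4 h3 (by omega) (by rw [e.1, e.2])
      (by rw [e'.1, e'.2])
    omega

/-- Two chords never share an end. -/
lemma HasChord.eq_of_end {N : ℕ} {π : NCPlus N} {a b k a' b' k' : ℕ} (h : HasChord π a b k)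
    (h' : HasChord π a' b' k') (he : a = a' ∨ b = b' ∨ a = b' ∨ b = a') : a = a' ∧ b = b' := by
  have e := h.lo_eq
  have e' := h'.lo_eq
  have haa : a = a' := by
    rcases he with rfl | rfl | rfl | rfl <;> omega
  subst haa
  exact ⟨rfl, (h.unique h').1⟩

section
variable {N : ℕ} (hN : 2 ≤ N) (π : NCPlus N)

/-- The trichotomy for the images of the blocks: a block without `1` and `N - 1` is shifted; one block
becomes the block of `1`; and, if `N - 1` is not in the block of `1`, one block becomes the
block of `2`, whose last point is the successor, on the circle of the points `2, …, N - 1`, of the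
minimum of the block of `N - 1`. -/
lemma kappa_block {N : ℕ} (hN : 2 ≤ N) (π : NCPlus N) {B : Finset ℕ} (hB : B ∈ π.1.parts) :
    (1 ∉ B ∧ N - 1 ∉ B ∧ ∀ x ∈ B, 2 ≤ x ∧ x + 2 ≤ N ∧ kappaPoint π.1 x = x + 1) ∨
    (1 ∈ B.image (kappaPoint π.1) ∧ (1 ∈ B ∨ N - 1 ∈ B)) ∨
    ((1 ∈ B ∨ N - 1 ∈ B) ∧ ∃ a k, HasChord π a (N - 1) k ∧
      2 ∈ B.image (kappaPoint π.1) ∧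
      (if a = N - 1 then 2 else a + 1) ∈ B.image (kappaPoint π.1) ∧
      ∀ y ∈ B.image (kappaPoint π.1), 2 ≤ y ∧ y ≤ if a = N - 1 then 2 else a + 1) := by
  have hf := isLo_lo π
  have h01 := hf.one (show 1 ≤ N by omega)
  have h0N := hf.last
  have memB : ∀ x y, x ∈ B → 1 ≤ y → y ≤ N → lo π.1 y = lo π.1 x → y ∈ B := by
    intro x y hx h1 h2 h3
    have hxb := bounds_of_mem_parts hB hx
    have := (mem_part_iff_lo π.1 hxb.1 hxb.2 h1 h2).2 h3
    rwa [π.1.part_eq_of_mem hB hx] at this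
  have loB : ∀ x y, x ∈ B → y ∈ B → lo π.1 x = lo π.1 y := fun x y => lo_eq_of_mem_parts hB
  have bd : ∀ x, x ∈ B → 1 ≤ x ∧ x ≤ N := fun x => bounds_of_mem_parts hB
  -- the block that does not contain `1` but contains `N - 1` gives a chord
  have chordN : 1 < lo π.1 (N - 1) → ∃ k, HasChord π (lo π.1 (N - 1)) (N - 1) k := by
    intro h
    refine ⟨_, (hasChord_iff π).2 ⟨h, ⟨by omega, hf.le _ (by omega) (by omega), by omega, rfl, ?_⟩,
      rfl⟩⟩
    intro y h1 h2 h3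
    have : y = N := by omega
    rw [this, h0N] at h3
    omega
  by_cases hsmall : 1 ∉ B ∧ N - 1 ∉ B
  · left
    refine ⟨hsmall.1, hsmall.2, fun x hx => ?_⟩
    have hxb := bd x hx
    have hx1 : x ≠ 1 := by rintro rfl; exact hsmall.1 hx
    have hxN1 : x ≠ N - 1 := by rintro rfl; exact hsmall.2 hx
    have hxN : x ≠ N := by
      intro h
      exact hsmall.1 (memB x 1 hx (le_refl _) (by omega) (by rw [h, h01, h0N]))
    refine ⟨by omega, by omega, ?_⟩
    rcases kappaPoint_cases hN π with ⟨e, h⟩ | ⟨hN3, e, h⟩ | ⟨e1, e2, h⟩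
    · rw [h, if_neg hxN]
    · rw [h, if_neg hx1, if_neg hxN, if_neg hxN1]
    · rw [h, if_neg, if_neg hxN]
      intro hxm
      exact hsmall.2 (memB x (N - 1) hx (by omega) (by omega)
        (by rw [hxm, hf.idem _ (by omega) (by omega)]))
  · right
    have hor : 1 ∈ B ∨ N - 1 ∈ B := by
      by_contra hc; push Not at hc; exact hsmall hc
    rcases kappaPoint_cases hN π with ⟨e, h⟩ | ⟨hN3, e, h⟩ | ⟨e1, e2, h⟩
    · left
      refine ⟨?_, hor⟩
      have : N ∈ B := by
        rcases hor with h1 | h1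
        · exact memB 1 N h1 (by omega) (le_refl _) (by rw [h01, h0N])
        · exact memB _ N h1 (by omega) (le_refl _) (by rw [h0N, e])
      rw [mem_image]
      exact ⟨N, this, by rw [h, if_pos rfl]⟩
    · by_cases h1 : 1 ∈ B
      · left
        exact ⟨mem_image.2 ⟨1, h1, by rw [h, if_pos rfl]⟩, hor⟩
      · right
        have hN1 : N - 1 ∈ B := hor.resolve_left h1
        refine ⟨hor, ?_⟩
        obtain ⟨k, hk⟩ := chordN (by omega)
        have hBs : ∀ x ∈ B, x = N - 1 := by
          intro x hx
          have := loB x _ hx hN1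
          have hxb := bd x hx
          have := hf.le x hxb.1 hxb.2
          by_contra hc
          have : x = N := by omega
          have e0 := congrArg (lo π.1) this
          omega
        have hφ : kappaPoint π.1 (N - 1) = 2 := by
          rw [h, if_neg (by omega), if_neg (by omega), if_pos rfl]
        have h2 : 2 ∈ B.image (kappaPoint π.1) := mem_image.2 ⟨N - 1, hN1, hφ⟩
        refine ⟨_, k, hk, h2, ?_, ?_⟩
        · rw [if_pos e]; exact h2
        · intro y hy
          obtain ⟨x, hx, rfl⟩ := mem_image.1 hy
          rw [hBs x hx, hφ, if_pos e]
          omega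
    · by_cases h1 : 1 ∈ B
      · right
        refine ⟨hor, ?_⟩
        obtain ⟨k, hk⟩ := chordN (by omega)
        have hNB : N ∈ B := memB 1 N h1 (by omega) (le_refl _) (by rw [h01, h0N])
        refine ⟨_, k, hk, ?_, ?_, ?_⟩
        · exact mem_image.2 ⟨1, h1, by rw [h, if_neg (by omega), if_neg (by omega)]⟩
        · rw [if_neg (by omega)]
          exact mem_image.2 ⟨N, hNB, by rw [h, if_neg (by omega), if_pos rfl]⟩
        · intro y hy
          obtain ⟨x, hx, rfl⟩ := mem_image.1 hy
          have hx1 : lo π.1 x = 1 := by rw [loB x 1 hx h1, h01]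
          have hxb := bd x hx
          have hidem := hf.idem (N - 1) (by omega) (by omega)
          have hxm : x ≠ lo π.1 (N - 1) := by
            intro hh; rw [hh, hidem] at hx1; omega
          rw [h, if_neg hxm, if_neg (show lo π.1 (N - 1) ≠ N - 1 by omega)]
          by_cases hxN : x = N
          · rw [if_pos hxN]; omega
          · rw [if_neg hxN]
            -- a point of the block of `1` lies before the block of `N - 1`
            have : x < lo π.1 (N - 1) := by
              by_contra hc
              have hxN1 : x ≠ N - 1 := by rintro rfl; omega
              have := hf.noncrossing (le_refl 1) e1 (show lo π.1 (N - 1) < x by omega)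
                (show x < N - 1 by omega) (by omega) (by rw [h01, hx1]) (by rw [hidem])
              omega
            omega
      · left
        have hN1 : N - 1 ∈ B := hor.resolve_left h1
        refine ⟨mem_image.2 ⟨lo π.1 (N - 1), ?_, by rw [h, if_pos rfl]⟩, hor⟩
        exact memB _ _ hN1 (by omega) (by omega) (hf.idem _ (by omega) (by omega))

/-- A chord that does not end at `N - 1` is shifted, and its block keeps its size. -/
lemma hasChord_kappaMap_succ {a b k : ℕ} (ha : 2 ≤ a) :
    HasChord (kappaMap hN π) (a + 1) (b + 1) k ↔ HasChord π a b k ∧ b + 2 ≤ N := by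
  constructor
  · rintro ⟨C, hC, h1, h2, h3, h4, rfl⟩
    obtain ⟨B, hB, rfl⟩ := mem_image.1 (show C ∈ kappaParts π.1 from hC)
    rcases kappa_block hN π hB with ⟨g1, g2, g3⟩ | ⟨g1, _⟩ | ⟨_, a', k', _, g2, _⟩
    · have key : ∀ x, x + 1 ∈ B.image (kappaPoint π.1) → x ∈ B := by
        intro x hx
        obtain ⟨y, hy, hyx⟩ := mem_image.1 hx
        rw [(g3 y hy).2.2] at hyx
        have : x = y := by omega
        rwa [this]
      have hb := key b h3
      refine ⟨⟨B, hB, g1, key a h2, hb, ?_, ?_⟩, (g3 b hb).2.1⟩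
      · intro x hx
        have := h4 _ (mem_image_of_mem _ hx)
        rw [(g3 x hx).2.2] at this
        omega
      · rw [Finset.card_image_of_injOn]
        intro x hx y hy hxy
        rw [(g3 x hx).2.2, (g3 y hy).2.2] at hxy
        omega
    · exact absurd g1 h1
    · have := h4 2 g2
      omega
  · rintro ⟨⟨B, hB, h1, h2, h3, h4, rfl⟩, hbN⟩
    have hN1 : N - 1 ∉ B := by
      intro h
      have := h4 _ h
      omega
    rcases kappa_block hN π hB with ⟨g1, g2, g3⟩ | ⟨_, g⟩ | ⟨g, _⟩
    · refine ⟨B.image (kappaPoint π.1), ?_, ?_, ?_, ?_, ?_, ?_⟩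
      · exact mem_image_of_mem _ hB
      · intro h
        obtain ⟨y, hy, hyx⟩ := mem_image.1 h
        rw [(g3 y hy).2.2] at hyx
        have := (g3 y hy).1
        omega
      · rw [← (g3 a h2).2.2]; exact mem_image_of_mem _ h2
      · rw [← (g3 b h3).2.2]; exact mem_image_of_mem _ h3
      · intro x hx
        obtain ⟨y, hy, rfl⟩ := mem_image.1 hx
        rw [(g3 y hy).2.2]
        have := h4 y hy
        omega
      · rw [Finset.card_image_of_injOn]
        intro x hx y hy hxy
        rw [(g3 x hx).2.2, (g3 y hy).2.2] at hxy
        omega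
    · rcases g with g | g
      · exact absurd g h1
      · exact absurd g hN1
    · rcases g with g | g
      · exact absurd g h1
      · exact absurd g hN1

/-- The chord that ends at `N - 1` becomes the chord that starts at `2`. The block it bounds may change
its size, since it changes places with the block of `1`. -/
lemma hasChord_kappaMap_two {b : ℕ} :
    (∃ k, HasChord (kappaMap hN π) 2 b k) ↔
      ∃ a k, HasChord π a (N - 1) k ∧ b = if a = N - 1 then 2 else a + 1 := by
  constructor
  · rintro ⟨k, C, hC, h1, h2, h3, h4, rfl⟩
    obtain ⟨B, hB, rfl⟩ := mem_image.1 (show C ∈ kappaParts π.1 from hC)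
    rcases kappa_block hN π hB with ⟨g1, g2, g3⟩ | ⟨g1, _⟩ | ⟨_, a', k', g1, g2, g3, g4⟩
    · obtain ⟨y, hy, hyx⟩ := mem_image.1 h2
      have := g3 y hy
      omega
    · exact absurd g1 h1
    · refine ⟨a', k', g1, ?_⟩
      have i1 := (h4 _ g3).2
      have i2 := (g4 _ h3).2
      omega
  · rintro ⟨a, k, h, rfl⟩
    have hf := isLo_lo π
    have hb := h.bounds
    have he := h.lo_eq
    have h01 := hf.one (show 1 ≤ N by omega)
    -- the block that becomes the block of `2`
    obtain ⟨B, hB, hB1, hB2⟩ : ∃ B ∈ π.1.parts, 1 ∉ B.image (kappaPoint π.1) ∧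
        (1 ∈ B ∨ N - 1 ∈ B) := by
      have p1 : 1 ∈ π.1.part 1 := π.1.mem_part (by simp; omega)
      have pN : N - 1 ∈ π.1.part (N - 1) := π.1.mem_part (by simp; omega)
      have m1 : π.1.part 1 ∈ π.1.parts := π.1.part_mem.2 (by simp; omega)
      have mN : π.1.part (N - 1) ∈ π.1.parts := π.1.part_mem.2 (by simp; omega)
      rcases kappaPoint_cases hN π with ⟨e, _⟩ | ⟨hN3, e, hφ⟩ | ⟨e1, e2, hφ⟩
      · omega
      · refine ⟨_, mN, ?_, Or.inr pN⟩
        intro hh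
        obtain ⟨y, hy, hy1⟩ := mem_image.1 hh
        have h3 := lo_eq_of_mem π.1 hy
        rw [hφ] at hy1
        have : y = 1 := by
          have hyb := bounds_of_mem_parts mN hy
          split_ifs at hy1 <;> omega
        have e0 := congrArg (lo π.1) this
        omega
      · refine ⟨_, m1, ?_, Or.inl p1⟩
        intro hh
        obtain ⟨y, hy, hy1⟩ := mem_image.1 hh
        have h3 := lo_eq_of_mem π.1 hy
        have hyb := bounds_of_mem_parts m1 hy
        rw [hφ] at hy1
        have : y = lo π.1 (N - 1) := by
          by_contra hc
          rw [if_neg hc] at hy1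
          split_ifs at hy1 <;> omega
        rw [this, hf.idem _ (by omega) (by omega)] at h3
        omega
    rcases kappa_block hN π hB with ⟨g1, g2, g3⟩ | ⟨g1, _⟩ | ⟨_, a', k', g1, g2, g3, g4⟩
    · rcases hB2 with g | g
      · exact absurd g g1
      · exact absurd g g2
    · exact absurd g1 hB1
    · have := (h.eq_of_end g1 (Or.inr (Or.inl rfl))).1
      subst this
      exact ⟨_, B.image (kappaPoint π.1), mem_image_of_mem _ hB, hB1, g2, g3, g4, rfl⟩

end

/-- The points `p` and `q` are the ends of a chord. -/
def Joined {N : ℕ} (π : NCPlus N) (p q : ℕ) : Prop :=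
  (∃ k, HasChord π p q k) ∨ ∃ k, HasChord π q p k

lemma Joined.symm {N : ℕ} {π : NCPlus N} {p q : ℕ} (h : Joined π p q) : Joined π q p := Or.symm h

/-- The pseudo-rotation rotates the chord diagram by one step on the circle of the points
`2, …, N - 1`. -/
lemma joined_kappaMap {N : ℕ} (hN : 2 ≤ N) (π : NCPlus N) {p q : ℕ} (hp : 2 ≤ p) (hpN : p + 1 ≤ N)
    (hq : 2 ≤ q) (hqN : q + 1 ≤ N) :
    Joined (kappaMap hN π) (if p = N - 1 then 2 else p + 1) (if q = N - 1 then 2 else q + 1) ↔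
      Joined π p q := by
  have fwd : ∀ p q, 2 ≤ p → p + 1 ≤ N → 2 ≤ q → q + 1 ≤ N → (∃ k, HasChord π p q k) →
      Joined (kappaMap hN π) (if p = N - 1 then 2 else p + 1)
        (if q = N - 1 then 2 else q + 1) := by
    rintro p q hp hpN hq hqN ⟨k, h⟩
    have hb := h.bounds
    by_cases hq1 : q = N - 1
    · right
      rw [if_pos hq1]
      subst hq1
      exact (hasChord_kappaMap_two hN π).2 ⟨p, k, h, rfl⟩
    · left
      rw [if_neg hq1, if_neg (by omega)]
      exact ⟨k, (hasChord_kappaMap_succ hN π hp).2 ⟨h, by omega⟩⟩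
  have bwd : ∀ p q, 2 ≤ p → p + 1 ≤ N → 2 ≤ q → q + 1 ≤ N →
      (∃ k, HasChord (kappaMap hN π) (if p = N - 1 then 2 else p + 1)
        (if q = N - 1 then 2 else q + 1) k) → Joined π p q := by
    intro p q hp hpN hq hqN h
    by_cases hp1 : p = N - 1
    · rw [if_pos hp1] at h
      obtain ⟨a, k, h1, h2⟩ := (hasChord_kappaMap_two hN π).1 h
      have hb := h1.bounds
      have : a = q := by split_ifs at h2 <;> omega
      subst this
      subst hp1
      exact Or.inr ⟨k, h1⟩
    · rw [if_neg hp1] at h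
      obtain ⟨k, h⟩ := h
      have hb := h.bounds
      have hq1 : q ≠ N - 1 := by
        intro hh; rw [if_pos hh] at hb; omega
      rw [if_neg hq1] at h
      exact Or.inl ⟨k, ((hasChord_kappaMap_succ hN π hp).1 h).1⟩
  constructor
  · rintro (h | h)
    · exact bwd p q hp hpN hq hqN h
    · exact (bwd q p hq hqN hp hpN h).symm
  · rintro (h | h)
    · exact fwd p q hp hpN hq hqN h
    · exact (fwd q p hq hqN hp hpN h).symm

/-- A positive non-crossing partition is determined by its chords. -/
lemma NCPlus.ext_joined {N : ℕ} {π σ : NCPlus N}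
    (h : ∀ p q, 2 ≤ p → p + 1 ≤ N → 2 ≤ q → q + 1 ≤ N → (Joined π p q ↔ Joined σ p q)) :
    π = σ := by
  have key : ∀ {π σ : NCPlus N},
      (∀ p q, 2 ≤ p → p + 1 ≤ N → 2 ≤ q → q + 1 ≤ N → (Joined π p q ↔ Joined σ p q)) →
      ∀ x, 1 ≤ x → x ≤ N → lo π.1 x ≤ lo σ.1 x := by
    intro π σ h x h1 h2
    have hp := isLo_lo π
    have hs := isLo_lo σ
    have b1 := hp.pos x h1 h2
    have b2 := hp.le x h1 h2
    rcases Nat.lt_or_ge 1 (lo π.1 x) with h3 | h3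
    · obtain ⟨b, hb⟩ := exists_isChord hp (a := lo π.1 x)
        (Finset.card_pos.2 ⟨x, mem_fiber.2 ⟨⟨h1, h2⟩, rfl⟩⟩)
      have hxb : x ≤ b := by
        by_contra hc
        exact hb.2.2.2.2 x (by omega) h2 rfl
      have hc : HasChord π (lo π.1 x) b _ := (hasChord_iff π).2 ⟨h3, hb, rfl⟩
      have hbd := hc.bounds
      have : lo σ.1 b = lo π.1 x := by
        rcases (h _ _ h3 (by omega) (by omega) hbd.2.2.1).1 (Or.inl ⟨_, hc⟩) with ⟨k, h4⟩ | ⟨k, h4⟩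
        · exact h4.lo_eq.2
        · have := h4.bounds
          have e : lo π.1 x = b := by omega
          rw [h4.lo_eq.1, e]
      rw [← this]
      exact hs.nest b x (by omega) (by omega) (by omega) hxb
    · have := hs.pos x h1 h2
      omega
  apply Subtype.ext
  apply finpartition_ext_lo
  intro x h1 h2
  exact le_antisymm (key h x h1 h2) (key (fun p q a b c d => (h p q a b c d).symm) x h1 h2)

lemma kappaMap_injective {N : ℕ} (hN : 2 ≤ N) :
    Function.Injective (kappaMap hN : NCPlus N → NCPlus N) := by
  intro π σ h
  apply NCPlus.ext_joined
  intro p q h1 h2 h3 h4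
  rw [← joined_kappaMap hN π h1 h2 h3 h4, ← joined_kappaMap hN σ h1 h2 h3 h4, h]

/-- The pseudo-rotation as a permutation. -/
def kappa {N : ℕ} (hN : 2 ≤ N) : Equiv.Perm (NCPlus N) :=
  Equiv.ofBijective (kappaMap hN) (Finite.injective_iff_bijective.1 (kappaMap_injective hN))

lemma isPseudoRotation_kappa {N : ℕ} (hN : 2 ≤ N) :
    IsPseudoRotation (kappa hN : Equiv.Perm (NCPlus N)) := fun _ => rfl

/-- The pseudo-rotation preserves the number of blocks of each size. -/
lemma card_filter_kappa {N : ℕ} (hN : 2 ≤ N) (π : NCPlus N) (k : ℕ) :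
    ((kappa hN π).1.parts.filter fun B => B.card = k).card
      = (π.1.parts.filter fun B => B.card = k).card := by
  have hinj : ∀ B ∈ π.1.parts, Set.InjOn (kappaPoint π.1) B := by
    intro B hB x hx y hy hxy
    have h1 := bounds_of_mem_parts hB hx
    have h2 := bounds_of_mem_parts hB hy
    exact kappaPoint_injOn hN π h1.1 h1.2 h2.1 h2.2 hxy
  have hparts : (kappa hN π).1.parts = π.1.parts.image fun B => B.image (kappaPoint π.1) := rfl
  rw [hparts, Finset.filter_image]
  rw [Finset.card_image_of_injOn]
  · congr 1
    apply Finset.filter_congr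
    intro B hB
    rw [Finset.card_image_of_injOn (hinj B hB)]
  · intro B hB B' hB' h
    simp only [coe_filter, Set.mem_ofPred_eq] at hB hB'
    obtain ⟨x, hx⟩ := π.1.nonempty_of_mem_parts hB.1
    have h3 : kappaPoint π.1 x ∈ B'.image (kappaPoint π.1) := by
      dsimp only at h
      rw [← h]
      exact mem_image_of_mem _ hx
    obtain ⟨y, hy, hyx⟩ := mem_image.1 h3
    have h1 := bounds_of_mem_parts hB.1 hx
    have h2 := bounds_of_mem_parts hB'.1 hy
    have := kappaPoint_injOn hN π h2.1 h2.2 h1.1 h1.2 hyx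
    subst this
    exact π.1.eq_of_mem_parts hB.1 hB'.1 hx hy

/-! ### The pseudo-rotation as a rotation of the chord diagram -/

/-- The pseudo-rotation of the positive non-crossing partitions of `{1, …, L + 2}`. -/
def kap (L : ℕ) : Equiv.Perm (NCPlus (L + 2)) := kappa (by omega)

/-- The points `2, …, L + 1`, in cyclic order, indexed by the integers modulo `L`. -/
def pt (L : ℕ) (x : ℤ) : ℕ := (x % L).toNat + 2

section
variable {L : ℕ}

lemma pt_bounds (hL : 1 ≤ L) (x : ℤ) : 2 ≤ pt L x ∧ pt L x ≤ L + 1 := by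
  have h1 := Int.emod_nonneg x (show (L : ℤ) ≠ 0 by omega)
  have h2 := Int.emod_lt_of_pos x (show (0 : ℤ) < L by omega)
  unfold pt; omega

lemma pt_natCast {i : ℕ} (h : i < L) : pt L i = i + 2 := by
  unfold pt
  rw [Int.emod_eq_of_lt (by omega) (by omega)]
  omega

lemma pt_add_mul (x : ℤ) (t : ℤ) : pt L (x + L * t) = pt L x := by
  unfold pt; rw [Int.add_mul_emod_self_left]

lemma pt_add_self (x : ℤ) : pt L (x + L) = pt L x := by
  unfold pt; rw [Int.add_emod_right]

lemma pt_succ (hL : 1 ≤ L) (x : ℤ) :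
    pt L (x + 1) = if pt L x = L + 1 then 2 else pt L x + 1 := by
  have h1 := Int.emod_nonneg x (show (L : ℤ) ≠ 0 by omega)
  have h2 := Int.emod_lt_of_pos x (show (0 : ℤ) < L by omega)
  have h3 := Int.emod_add_mul_ediv x L
  have hx : pt L (x + 1) = pt L (x % L + 1) := by
    rw [← pt_add_mul (x % L + 1) (x / L)]
    congr 1
    omega
  rw [hx]
  have : pt L x = (x % L).toNat + 2 := rfl
  generalize x % L = r at *
  rw [this]
  split_ifs with h
  · have : r + 1 = 0 + L * 1 := by omega
    rw [this, pt_add_mul]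
    simp [pt]
  · unfold pt
    rw [Int.emod_eq_of_lt (by omega) (by omega)]
    omega

/-- The points with indices `x` and `y` are the ends of a chord. -/
def Link (π : NCPlus (L + 2)) (x y : ℤ) : Prop := Joined π (pt L x) (pt L y)

lemma link_kap (hL : 1 ≤ L) (π : NCPlus (L + 2)) (x y : ℤ) :
    Link (kap L π) (x + 1) (y + 1) ↔ Link π x y := by
  have hx := pt_bounds hL x
  have hy := pt_bounds hL y
  have := joined_kappaMap (N := L + 2) (by omega) π hx.1 (by omega) hy.1 (by omega)
  unfold Link
  rw [← this, pt_succ hL, pt_succ hL]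
  rfl

lemma link_kap_pow (hL : 1 ≤ L) (π : NCPlus (L + 2)) (j : ℕ) (x y : ℤ) :
    Link ((kap L ^ j) π) (x + j) (y + j) ↔ Link π x y := by
  induction j with
  | zero => simp
  | succ j ih =>
    rw [pow_succ', Equiv.Perm.mul_apply]
    push_cast
    rw [← add_assoc, ← add_assoc, link_kap hL]
    exact ih

lemma link_kap_zpow (hL : 1 ≤ L) (π : NCPlus (L + 2)) (j : ℤ) (x y : ℤ) :
    Link ((kap L ^ j) π) (x + j) (y + j) ↔ Link π x y := by
  obtain ⟨n, rfl | rfl⟩ := j.eq_nat_or_neg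
  · rw [zpow_natCast, link_kap_pow hL]
  · have := link_kap_pow hL ((kap L ^ (-(n : ℤ))) π) n (x + -n) (y + -n)
    rw [← this]
    simp

lemma NCPlus.ext_link {π σ : NCPlus (L + 2)} (h : ∀ x y, Link π x y ↔ Link σ x y) :
    π = σ := by
  apply NCPlus.ext_joined
  intro p q h1 h2 h3 h4
  have := h ((p - 2 : ℕ) : ℤ) ((q - 2 : ℕ) : ℤ)
  unfold Link at this
  rwa [pt_natCast (by omega), pt_natCast (by omega), Nat.sub_add_cancel h1,
    Nat.sub_add_cancel h3] at this

lemma kap_pow_self (hL : 1 ≤ L) : kap L ^ L = 1 := by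
  ext1 π
  rw [Equiv.Perm.one_apply]
  apply NCPlus.ext_link
  intro x y
  rw [← link_kap_pow hL π L x y]
  unfold Link
  rw [pt_add_self, pt_add_self]

/-- The order of the pseudo-rotation: the partition into `{2}` and its complement has a loop as its
only chord, so that its images under the first `L` powers are different. -/
lemma orderOf_kap (hL : 1 ≤ L) : orderOf (kap L) = L := by
  apply Nat.dvd_antisymm (orderOf_dvd_of_pow_eq_one (kap_pow_self hL))
  set w : ℕ → ℕ := fun a => if a = 1 then L + 1 else if a = 2 then 1 else 0 with hw
  have hsum : ∀ j, 3 ≤ j → ∑ t ∈ Ico 1 j, w t = L + 2 := by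
    intro j hj
    rw [Finset.sum_eq_sum_Ico_succ_bot (by omega), Finset.sum_eq_sum_Ico_succ_bot (by omega),
      Finset.sum_eq_zero]
    · simp [hw]
    · intro t ht
      simp only [mem_Ico] at ht
      simp only [hw]
      rw [if_neg (by omega), if_neg (by omega)]
  have hret : FirstReturn w 1 (L + 2) := by
    refine ⟨by omega, fun j h1 h2 => ?_, ?_⟩
    · rcases Nat.lt_or_ge 2 j with h | h
      · rw [hsum j h]; omega
      · have : j = 2 := by omega
        subst this
        simp [hw]; omega
    · rw [hsum _ (by omega)]; omega
  set π := ofWord w hret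
  have hloop : ∀ x, Link π x x → pt L x = 2 := by
    intro x hx
    have hb := pt_bounds hL x
    obtain ⟨k, hk⟩ : ∃ k, HasChord π (pt L x) (pt L x) k := by rcases hx with h | h <;> exact h
    have h1 := ((hasChord_iff π).1 hk).2.2
    rw [word_ofWord hret (by omega) (by omega)] at h1
    have h2 := hk.bounds
    by_contra hc
    simp only [hw] at h1
    rw [if_neg (by omega), if_neg hc] at h1
    omega
  have h0 : Link π 0 0 := by
    have hb : 0 < word (L + 2) (lo π.1) 2 := by
      rw [word_ofWord hret (by omega) (by omega)]; simp [hw]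
    have : HasChord π 2 2 1 := by
      rw [hasChord_iff, (isLo_lo π).isChord_iff]
      refine ⟨le_refl _, ⟨hb, le_refl _, fun j h1 h2 => by omega, ?_⟩, ?_⟩
      · simp only [Nat.reduceAdd, Finset.sum_singleton, Nat.Ico_succ_singleton]
        rw [word_ofWord hret (by omega) (by omega)]; simp [hw]
      · rw [word_ofWord hret (by omega) (by omega)]; simp [hw]
    unfold Link
    have e : pt L 0 = 2 := by simp [pt]
    rw [e]
    exact Or.inl ⟨1, this⟩
  have h1 := (link_kap_pow hL π (orderOf (kap L)) 0 0).2 h0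
  rw [pow_orderOf_eq_one, Equiv.Perm.one_apply] at h1
  have h2 := hloop _ h1
  have h3 : ((orderOf (kap L) : ℤ) % L).toNat = 0 := by
    unfold pt at h2
    simpa using h2
  have h4 := Int.emod_nonneg (orderOf (kap L) : ℤ) (show (L : ℤ) ≠ 0 by omega)
  have h5 : (orderOf (kap L) : ℤ) % L = 0 := by omega
  exact_mod_cast Int.dvd_of_emod_eq_zero h5

/-! ### Arcs: chords seen from one end -/

/-- Seen from the point with index `x`, there is a chord to the point with index `x + ℓ`, and the
block on this side of the chord has size `k`. -/
def Arc (π : NCPlus (L + 2)) (x : ℤ) (ℓ k : ℕ) : Prop :=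
  HasChord ((kap L ^ (-x)) π) 2 (2 + ℓ) k

lemma arc_kap_zpow (π : NCPlus (L + 2)) (j x : ℤ) (ℓ k : ℕ) :
    Arc ((kap L ^ j) π) (x + j) ℓ k ↔ Arc π x ℓ k := by
  unfold Arc
  rw [← Equiv.Perm.mul_apply, ← zpow_add]
  have e : -(x + j) + j = -x := by ring
  rw [e]

lemma arc_zero {π : NCPlus (L + 2)} {ℓ k : ℕ} : Arc π 0 ℓ k ↔ HasChord π 2 (2 + ℓ) k := by
  simp [Arc]

lemma hasChord_kap_pow (π : NCPlus (L + 2)) {a b k j : ℕ} (ha : 2 ≤ a) (hb : b + j ≤ L + 1) :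
    HasChord ((kap L ^ j) π) (a + j) (b + j) k ↔ HasChord π a b k := by
  induction j with
  | zero => simp
  | succ j ih =>
    rw [pow_succ', Equiv.Perm.mul_apply, ← ih (by omega)]
    have := hasChord_kappaMap_succ (N := L + 2) (by omega) ((kap L ^ j) π) (a := a + j) (b := b + j)
      (k := k) (by omega)
    rw [← add_assoc, ← add_assoc]
    exact this.trans (and_iff_left (by omega))

lemma arc_natCast {π : NCPlus (L + 2)} {i ℓ k : ℕ} (h : i + ℓ < L) :
    Arc π i ℓ k ↔ HasChord π (i + 2) (i + 2 + ℓ) k := by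
  unfold Arc
  rw [← hasChord_kap_pow ((kap L ^ (-(i : ℤ))) π) (j := i) (le_refl 2) (by omega)]
  rw [← zpow_natCast, ← Equiv.Perm.mul_apply, ← zpow_add]
  have e1 : 2 + i = i + 2 := by ring
  have e2 : 2 + ℓ + i = i + 2 + ℓ := by ring
  simp [e1, e2]

lemma Arc.lt {π : NCPlus (L + 2)} {x : ℤ} {ℓ k : ℕ} (h : Arc π x ℓ k) : ℓ < L ∧ 1 ≤ k := by
  have := HasChord.bounds h
  omega

lemma Arc.link (hL : 1 ≤ L) {π : NCPlus (L + 2)} {x : ℤ} {ℓ k : ℕ} (h : Arc π x ℓ k) :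
    Link π x (x + ℓ) := by
  have h1 := h.lt
  rw [← link_kap_zpow hL π (-x)]
  have e0 : x + -x = ((0 : ℕ) : ℤ) := by simp
  have e1 : x + ℓ + -x = ((ℓ : ℕ) : ℤ) := by ring
  unfold Link
  rw [e0, e1, pt_natCast (by omega), pt_natCast h1.1]
  left
  refine ⟨k, ?_⟩
  have h2 := h
  unfold Arc at h2
  rwa [add_comm 2 ℓ] at h2

lemma Link.arc (hL : 1 ≤ L) {π : NCPlus (L + 2)} {x y : ℤ} (h : Link π x y) :
    ∃ k, Arc π x ((y - x) % L).toNat k := by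
  rw [← link_kap_zpow hL π (-x)] at h
  have e0 : x + -x = ((0 : ℕ) : ℤ) := by simp
  have e1 : pt L (y + -x) = 2 + ((y - x) % L).toNat := by unfold pt; rw [← sub_eq_add_neg]; omega
  unfold Link at h
  rw [e0, e1, pt_natCast (by omega)] at h
  rcases h with ⟨k, h⟩ | ⟨k, h⟩
  · exact ⟨k, h⟩
  · have := h.bounds
    have e : 2 + ((y - x) % L).toNat = 2 := by omega
    refine ⟨k, ?_⟩
    unfold Arc
    rw [e] at h ⊢
    exact h

/-- A chord of positive length is an arc from each of its ends. -/
lemma Arc.reverse (hL : 1 ≤ L) {π : NCPlus (L + 2)} {x : ℤ} {ℓ k : ℕ} (h : Arc π x ℓ k)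
    (hℓ : 1 ≤ ℓ) : ∃ k', Arc π (x + ℓ) (L - ℓ) k' := by
  have h1 := h.lt
  obtain ⟨k', hk'⟩ := Link.arc hL (x := x + ℓ) (y := x) (Joined.symm (h.link hL))
  refine ⟨k', ?_⟩
  have : ((x - (x + ℓ)) % L).toNat = L - ℓ := by
    have : x - (x + ℓ) = ((L - ℓ : ℕ) : ℤ) + L * (-1) := by push_cast [h1.1.le]; ring
    rw [this, Int.add_mul_emod_self_left, Int.emod_eq_of_lt (by omega) (by omega)]
    omega
  rwa [this] at hk'

/-- Arcs that do not wrap around do not cross. -/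
lemma Arc.noncrossing {π : NCPlus (L + 2)} {x : ℤ} {t ℓ k ℓ' k' : ℕ} (h : Arc π x ℓ k)
    (h' : Arc π (x + t) ℓ' k') (h1 : 1 ≤ t) (h2 : t ≤ ℓ) (h3 : ℓ < t + ℓ') : L ≤ t + ℓ' := by
  by_contra hc
  push Not at hc
  rw [← arc_kap_zpow π (-x)] at h h'
  have e0 : x + -x = 0 := by simp
  have e1 : x + t + -x = ((t : ℕ) : ℤ) := by ring
  rw [e0, arc_zero] at h
  rw [e1, arc_natCast hc] at h'
  exact h.noncrossing h' ⟨by omega, by omega, by omega⟩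

/-! ### The code of a partition -/

open Classical in
/-- The size of the block with minimum `2` if this block has its last point among
`2, …, K + 2`, and `0` otherwise. -/
def head (K : ℕ) (π : NCPlus (L + 2)) : ℕ :=
  if ∃ ℓ ≤ K, ∃ k, HasChord π 2 (2 + ℓ) k then word (L + 2) (lo π.1) 2 else 0

/-- The code of `π`: the entry at `x` is the size of the block on the short side of the chord at
the point with index `x`, if the arc that starts there has length at most `K`, and `0`
otherwise. -/
def code (K : ℕ) (π : NCPlus (L + 2)) (x : ℤ) : ℕ := head K ((kap L ^ (-x)) π)

lemma code_kap_zpow (K : ℕ) (π : NCPlus (L + 2)) (j x : ℤ) :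
    code K ((kap L ^ j) π) (x + j) = code K π x := by
  unfold code
  rw [← Equiv.Perm.mul_apply, ← zpow_add]
  have e : -(x + j) + j = -x := by ring
  rw [e]

lemma code_eq_iff {K : ℕ} {π : NCPlus (L + 2)} {x : ℤ} {k : ℕ} (hk : 1 ≤ k) :
    code K π x = k ↔ ∃ ℓ ≤ K, Arc π x ℓ k := by
  unfold code head Arc
  constructor
  · intro h
    split_ifs at h with h1
    · obtain ⟨ℓ, hℓ, k', hk'⟩ := h1
      refine ⟨ℓ, hℓ, ?_⟩
      rw [← h, ((hasChord_iff _).1 hk').2.2]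
      exact hk'
    · omega
  · rintro ⟨ℓ, hℓ, h⟩
    rw [if_pos ⟨ℓ, hℓ, k, h⟩]
    exact ((hasChord_iff _).1 h).2.2

lemma word_eq_iff {π : NCPlus (L + 2)} {i k : ℕ} (hk : 1 ≤ k) :
    word (L + 2) (lo π.1) (i + 2) = k ↔ ∃ ℓ, HasChord π (i + 2) (i + 2 + ℓ) k := by
  constructor
  · intro h
    obtain ⟨b, hb⟩ := exists_isChord (isLo_lo π) (a := i + 2) (by omega)
    refine ⟨b - (i + 2), (hasChord_iff π).2 ⟨by omega, ?_, h⟩⟩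
    have := hb.2.1
    rwa [show i + 2 + (b - (i + 2)) = b by omega]
  · rintro ⟨ℓ, h⟩
    exact ((hasChord_iff π).1 h).2.2

/-- If the arcs of length at most `K` at `i` are exactly the blocks with minimum `i + 2`, then the
code and the word agree at this place. -/
lemma word_eq_code {K : ℕ} {π : NCPlus (L + 2)} {i : ℕ}
    (h1 : ∀ ℓ k, HasChord π (i + 2) (i + 2 + ℓ) k → ℓ ≤ K)
    (h2 : ∀ ℓ k, ℓ ≤ K → Arc π i ℓ k → i + ℓ < L) :
    word (L + 2) (lo π.1) (i + 2) = code K π i := by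
  rcases Nat.eq_zero_or_pos (code K π i) with h | h
  · by_contra hc
    rw [h] at hc
    obtain ⟨ℓ, hℓ⟩ := (word_eq_iff (Nat.one_le_iff_ne_zero.2 hc)).1 rfl
    have hb := hℓ.bounds
    have h3 := (code_eq_iff (K := K) (Nat.one_le_iff_ne_zero.2 hc)).2
      ⟨ℓ, h1 _ _ hℓ, (arc_natCast (by omega)).2 hℓ⟩
    omega
  · obtain ⟨ℓ, hℓ, h3⟩ := (code_eq_iff (K := K) h).1 rfl
    exact (word_eq_iff h).2 ⟨ℓ, (arc_natCast (h2 _ _ hℓ h3)).1 h3⟩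

/-- `ℓ` is the length of the arc at `x` in a configuration with code `c`: the first return of the
partial sums of `c - 1`, or `K` if there is no return before. -/
def IsArcLength (K : ℕ) (c : ℤ → ℕ) (x : ℤ) (ℓ : ℕ) : Prop :=
  ℓ ≤ K ∧ (∀ j, 1 ≤ j → j ≤ ℓ → j + 1 ≤ ∑ i ∈ range j, c (x + i)) ∧
    (ℓ < K → ∑ i ∈ range (ℓ + 1), c (x + i) = ℓ + 1) ∧
    (ℓ = K → ∑ i ∈ range K, c (x + i) = K + 1)

lemma IsArcLength.unique {K : ℕ} {c : ℤ → ℕ} {x : ℤ} {ℓ ℓ' : ℕ} (h : IsArcLength K c x ℓ)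
    (h' : IsArcLength K c x ℓ') : ℓ = ℓ' := by
  obtain ⟨h1, h2, h3, _⟩ := h
  obtain ⟨g1, g2, g3, _⟩ := h'
  rcases lt_trichotomy ℓ ℓ' with h | h | h
  · have := g2 (ℓ + 1) (by omega) (by omega); have := h3 (by omega); omega
  · exact h
  · have := h2 (ℓ' + 1) (by omega) (by omega); have := g3 (by omega); omega

lemma sum_Ico_add_two (w : ℕ → ℕ) (i j : ℕ) :
    ∑ t ∈ Ico (i + 2) (i + 2 + j), w t = ∑ s ∈ range j, w (i + s + 2) := by
  rw [Finset.sum_Ico_eq_sum_range]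
  simp only [Nat.add_sub_cancel_left]
  apply Finset.sum_congr rfl
  intro s _
  congr 1
  ring

/-- The code determines the lengths of the short arcs: below an arc that starts at the first point, the
code agrees with the word of the partition, whose partial sums give the ends of the blocks. -/
lemma Arc.isArcLength {K : ℕ} (hK : 1 ≤ K) (hKL : 2 * K ≤ L) {π : NCPlus (L + 2)} {x : ℤ}
    {ℓ k : ℕ} (h : Arc π x ℓ k) (hℓ : ℓ ≤ K) : IsArcLength K (code K π) x ℓ := by
  -- rotate so that the arc starts at the point `2`
  have hrot : ∀ i : ℕ, code K π (x + i) = code K ((kap L ^ (-x)) π) i := by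
    intro i
    rw [← code_kap_zpow K π (-x)]
    congr 1
    ring
  have h' : HasChord ((kap L ^ (-x)) π) 2 (2 + ℓ) k := h
  unfold IsArcLength
  simp only [hrot]
  generalize (kap L ^ (-x)) π = σ at *
  have hret := (isLo_lo σ).firstReturn ((hasChord_iff σ).1 h').2.1
  have nest : ∀ i ℓ' k', i ≤ ℓ → 0 < i → HasChord σ (i + 2) (i + 2 + ℓ') k' → i + ℓ' < ℓ := by
    intro i ℓ' k' h1 h0 h2
    have h3 := h'.noncrossing h2
    by_contra hc
    have h4 : i + 2 + ℓ' = 2 + ℓ := by omega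
    have := h'.eq_of_end h2 (by omega)
    omega
  have hwc : ∀ i, i < ℓ ∨ (i = ℓ ∧ ℓ < K) →
      word (L + 2) (lo σ.1) (i + 2) = code K σ i := by
    intro i hi
    apply word_eq_code
    · intro ℓ' k' h2
      rcases Nat.eq_zero_or_pos i with rfl | h0
      · have := h'.unique h2
        omega
      · have := nest i ℓ' k' (by omega) h0 h2
        omega
    · intro ℓ' k' h2 _
      omega
  have hsum : ∀ j, j ≤ ℓ ∨ (j = ℓ + 1 ∧ ℓ < K) →
      ∑ t ∈ Ico 2 (2 + j), word (L + 2) (lo σ.1) t = ∑ i ∈ range j, code K σ i := by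
    intro j hj
    have := sum_Ico_add_two (word (L + 2) (lo σ.1)) 0 j
    rw [zero_add] at this
    rw [this]
    apply Finset.sum_congr rfl
    intro i hi
    rw [mem_range] at hi
    rw [zero_add]
    exact hwc i (by omega)
  refine ⟨hℓ, fun j h1 h2 => ?_, fun h1 => ?_, fun h1 => ?_⟩
  · rw [← hsum j (Or.inl h2)]
    have := hret.2.1 (2 + j) (by omega) (by omega)
    omega
  · rw [← hsum (ℓ + 1) (Or.inr ⟨rfl, h1⟩)]
    have := hret.2.2
    rw [add_assoc] at this
    omega
  · subst h1
    rw [← hsum ℓ (Or.inl (le_refl _))]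
    have := hret.2.2
    rw [Finset.sum_Ico_succ_top (by omega)] at this
    have h0 : word (L + 2) (lo σ.1) (2 + ℓ) = 0 := by
      by_contra hc
      rw [add_comm 2 ℓ] at hc
      obtain ⟨ℓ', hℓ'⟩ := (word_eq_iff (Nat.one_le_iff_ne_zero.2 hc)).1 rfl
      have := nest ℓ ℓ' _ (le_refl _) (by omega) hℓ'
      omega
    omega

end

section
variable {L K : ℕ}

lemma arc_add_of_fixed {π : NCPlus (L + 2)} (hfix : (kap L ^ K) π = π) (x : ℤ) (ℓ k : ℕ) :
    Arc π (x + K) ℓ k ↔ Arc π x ℓ k := by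
  conv_lhs => rw [← hfix]
  rw [← zpow_natCast, arc_kap_zpow]

lemma code_add_of_fixed {π : NCPlus (L + 2)} (hfix : (kap L ^ K) π = π) (x : ℤ) :
    code K π (x + K) = code K π x := by
  conv_lhs => rw [← hfix]
  rw [← zpow_natCast, code_kap_zpow]

/-- In a partition that is fixed by the `K`-th power of the pseudo-rotation, every chord has a
short side, since otherwise it would cross its image. -/
lemma Arc.short {π : NCPlus (L + 2)} (hfix : (kap L ^ K) π = π) (hK : 1 ≤ K) {x : ℤ} {ℓ k : ℕ}
    (h : Arc π x ℓ k) : ℓ ≤ K ∨ L ≤ ℓ + K := by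
  by_contra hc
  push Not at hc
  have := h.noncrossing ((arc_add_of_fixed hfix x ℓ k).2 h) hK (by omega) (by omega)
  omega

/-- In a fixed partition, each chord is an arc of length at most `K` from one of its ends. -/
lemma Link.short (hL : 1 ≤ L) {π : NCPlus (L + 2)} (hfix : (kap L ^ K) π = π) (hK : 1 ≤ K)
    {x y : ℤ} (h : Link π x y) :
    (∃ ℓ k, ℓ ≤ K ∧ Arc π x ℓ k ∧ pt L y = pt L (x + ℓ)) ∨
      ∃ ℓ k, ℓ ≤ K ∧ Arc π y ℓ k ∧ pt L x = pt L (y + ℓ) := by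
  obtain ⟨k, hk⟩ := h.arc hL
  have h1 := Int.emod_nonneg (y - x) (show (L : ℤ) ≠ 0 by omega)
  have h2 := Int.emod_add_mul_ediv (y - x) L
  set ℓ := ((y - x) % L).toNat with hℓ
  have h3 : x + ℓ + L * ((y - x) / L) = y := by omega
  have h4 := hk.lt
  have hy : pt L y = pt L (x + ℓ) := by rw [← h3, pt_add_mul]
  rcases hk.short hfix hK with hs | hs
  · exact Or.inl ⟨ℓ, k, hs, hk, hy⟩
  · rcases Nat.eq_zero_or_pos ℓ with h0 | h0
    · exact Or.inl ⟨ℓ, k, by omega, hk, hy⟩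
    · right
      obtain ⟨k', hk'⟩ := Link.arc hL (Joined.symm h)
      refine ⟨L - ℓ, k', by omega, ?_, ?_⟩
      · have : ((x - y) % L).toNat = L - ℓ := by
          have e : x - y = ((L - ℓ : ℕ) : ℤ) + L * (-1 - (y - x) / L) := by
            push_cast [h4.1.le]
            linear_combination h3
          rw [e, Int.add_mul_emod_self_left, Int.emod_eq_of_lt (by omega) (by omega)]
          omega
        rwa [this] at hk'
      · have : y + ((L - ℓ : ℕ) : ℤ) = x + L * (1 + (y - x) / L) := by
          push_cast [h4.1.le]
          linear_combination -h3
        rw [this, pt_add_mul]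

/-- A fixed point of the `K`-th power of the pseudo-rotation is determined by its code. -/
lemma eq_of_code_eq (hK : 1 ≤ K) (hKL : 2 * K ≤ L) {π σ : NCPlus (L + 2)}
    (hπ : (kap L ^ K) π = π) (hσ : (kap L ^ K) σ = σ) (h : ∀ x, code K π x = code K σ x) :
    π = σ := by
  have hcode : code K π = code K σ := funext h
  have key : ∀ {π σ : NCPlus (L + 2)}, code K π = code K σ → ∀ {x : ℤ} {ℓ k : ℕ},
      ℓ ≤ K → Arc π x ℓ k → Link σ x (x + ℓ) := by
    intro π σ hc x ℓ k hℓ ha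
    have h1 := (code_eq_iff ha.lt.2).2 ⟨ℓ, hℓ, ha⟩
    rw [hc] at h1
    obtain ⟨ℓ', hℓ', ha'⟩ := (code_eq_iff ha.lt.2).1 h1
    have i1 := ha.isArcLength hK hKL hℓ
    have i2 := ha'.isArcLength hK hKL hℓ'
    rw [hc] at i1
    rw [i1.unique i2]
    exact ha'.link (by omega)
  have key2 : ∀ {π σ : NCPlus (L + 2)}, (kap L ^ K) π = π → code K π = code K σ →
      ∀ x y, Link π x y → Link σ x y := by
    intro π σ hπ hc x y hxy
    rcases hxy.short (by omega) hπ hK with ⟨ℓ, k, h1, h2, h3⟩ | ⟨ℓ, k, h1, h2, h3⟩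
    · have := key hc h1 h2
      unfold Link at this ⊢
      rwa [h3]
    · have := key hc h1 h2
      unfold Link at this ⊢
      rw [h3]
      exact this.symm
  exact NCPlus.ext_link
    fun x y => ⟨key2 hπ hcode x y, key2 hσ hcode.symm x y⟩

end

/-! ### Periodic sequences and the cycle lemma -/

section
variable {K : ℕ} {c : ℤ → ℕ}

lemma periodic_mul (hc : ∀ x, c (x + K) = c x) (x t : ℤ) : c (x + K * t) = c x := by
  have : Function.Periodic c (K : ℤ) := hc
  have h := this.int_mul t x
  rw [mul_comm]
  exact h

lemma sum_period (hc : ∀ x, c (x + K) = c x) (x : ℤ) :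
    ∑ i ∈ range K, c (x + i) = ∑ i ∈ range K, c i := by
  have hstep : ∀ x, ∑ i ∈ range K, c (x + 1 + i) = ∑ i ∈ range K, c (x + i) := by
    intro x
    have h1 := Finset.sum_range_succ (fun i : ℕ => c (x + i)) K
    have h2 := Finset.sum_range_succ' (fun i : ℕ => c (x + i)) K
    rw [h1] at h2
    simp only [hc, Nat.cast_add, Nat.cast_one, Nat.cast_zero, add_zero] at h2
    have h3 : ∀ i : ℕ, x + ((i : ℤ) + 1) = x + 1 + i := fun i => by ring
    simp only [h3] at h2
    omega
  induction x using Int.induction_on with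
  | zero => simp
  | succ i ih => rw [hstep, ih]
  | pred i ih =>
    rw [← hstep, ← ih]
    congr! 3
    ring

lemma sum_range_mul_period (hc : ∀ x, c (x + K) = c x) (d : ℕ) :
    ∑ i ∈ range (d * K), c i = d * ∑ i ∈ range K, c i := by
  induction d with
  | zero => simp
  | succ d ih =>
    rw [Nat.succ_mul, Finset.sum_range_add, ih, Nat.succ_mul]
    congr 1
    have := sum_period hc ((d * K : ℕ) : ℤ)
    rw [← this]
    push_cast
    rfl

lemma sum_shift_eq (c : ℤ → ℕ) (x j : ℕ) :
    ∑ i ∈ range (x + j), c i = ∑ i ∈ range x, c i + ∑ i ∈ range j, c (x + i) := by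
  rw [Finset.sum_range_add]
  push_cast
  rfl

/-- If the entries of a period of length `K` have sum at most `K`, some rotation has the property
that each suffix of length `j` of the period has sum at most `j`. -/
lemma exists_rotation_suffix (hc : ∀ x, c (x + K) = c x) (hK : 1 ≤ K)
    (hS : ∑ i ∈ range K, c i ≤ K) :
    ∃ x : ℤ, ∀ j ≤ K, ∑ i ∈ range j, c (x + (K - j : ℕ) + i) ≤ j := by
  obtain ⟨e, he, hmin⟩ := Finset.exists_min_image (range K)
    (fun j : ℕ => ((∑ i ∈ range j, c i : ℕ) : ℤ) - j) ⟨0, by simp; omega⟩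
  rw [mem_range] at he
  refine ⟨e, fun j hj => ?_⟩
  have h1 := sum_shift_eq c (e + (K - j)) j
  have h2 := sum_shift_eq c e K
  rw [show e + (K - j) + j = e + K by omega, h2, sum_period hc] at h1
  have h3 : ((e + (K - j) : ℕ) : ℤ) = e + (K - j : ℕ) := by push_cast; rfl
  rw [h3] at h1
  rcases Nat.lt_or_ge (e + (K - j)) K with h | h
  · have := hmin (e + (K - j)) (by rw [mem_range]; exact h)
    omega
  · have h4 := hmin (e - j) (by rw [mem_range]; omega)
    have h5 := sum_shift_eq c K (e - j)
    rw [show K + (e - j) = e + (K - j) by omega] at h5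
    have h6 : ∀ i : ℕ, c ((K : ℤ) + i) = c i := fun i => by rw [add_comm, hc]
    simp only [h6] at h5
    omega

/-- If the entries of a period of length `K` have sum more than `K`, some rotation has the property
that each non-empty prefix of length `j ≤ K` has sum more than `j`. -/
lemma exists_rotation_prefix (hc : ∀ x, c (x + K) = c x) (hK : 1 ≤ K)
    (hS : K + 1 ≤ ∑ i ∈ range K, c i) :
    ∃ x : ℕ, x < K ∧ ∀ j, 1 ≤ j → j ≤ K → j + 1 ≤ ∑ i ∈ range j, c (x + i) := by
  classical
  set G : ℕ → ℤ := fun j => ((∑ i ∈ range j, c i : ℕ) : ℤ) - j with hG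
  obtain ⟨e0, he0, hmin0⟩ := Finset.exists_min_image (range K) G ⟨0, by simp; omega⟩
  -- the last place where the walk is minimal
  obtain ⟨e, he, hmax⟩ := Finset.exists_max_image ((range K).filter fun j => G j = G e0) id
    ⟨e0, by simp only [mem_filter, he0, true_and]⟩
  simp only [mem_filter, mem_range, id] at he hmax
  have hmin : ∀ y, y < K → G e ≤ G y := by
    intro y hy
    rw [he.2]
    exact hmin0 y (by rwa [mem_range])
  have hlast : ∀ y, y < K → e < y → G e < G y := by
    intro y hy hey
    rcases lt_or_eq_of_le (hmin y hy) with h | h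
    · exact h
    · have := hmax y ⟨hy, by rw [← h, he.2]⟩
      omega
  refine ⟨e, he.1, fun j h1 h2 => ?_⟩
  have h3 := sum_shift_eq c e j
  rcases Nat.lt_or_ge (e + j) K with h | h
  · have := hlast (e + j) h (by omega)
    simp only [hG] at this
    omega
  · have h4 := hmin (e + j - K) (by omega)
    have h5 := sum_shift_eq c K (e + j - K)
    rw [show K + (e + j - K) = e + j by omega] at h5
    have h6 : ∀ i : ℕ, c ((K : ℤ) + i) = c i := fun i => by rw [add_comm, hc]
    simp only [h6] at h5
    simp only [hG] at h4
    omega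

end

/-! ### Block sizes of the fixed points -/

/-- The number of blocks of size `k`. -/
def blockCount {N : ℕ} (π : NCPlus N) (k : ℕ) : ℕ := (π.1.parts.filter fun B => B.card = k).card

lemma sum_Icc_split (L : ℕ) (g : ℕ → ℕ) :
    ∑ a ∈ Icc 1 (L + 2), g a = g 1 + ∑ i ∈ range L, g (i + 2) + g (L + 2) := by
  have h : Icc 1 (L + 2) = Ico 1 (L + 2 + 1) := by ext; simp
  rw [h, Finset.sum_Ico_succ_top (by omega), Finset.sum_eq_sum_Ico_succ_bot (by omega)]
  have := sum_Ico_add_two g 0 L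
  simp only [zero_add] at this
  rw [add_comm L 2, this]

section
variable {L : ℕ}

lemma word_last (π : NCPlus (L + 2)) : word (L + 2) (lo π.1) (L + 2) = 0 := by
  rw [word, Finset.card_eq_zero, Finset.eq_empty_iff_forall_notMem]
  intro y hy
  rw [mem_fiber] at hy
  have h1 := (isLo_lo π).le y hy.1.1 hy.1.2
  have h2 := (isLo_lo π).last
  have : y = L + 2 := by omega
  rw [this] at hy
  omega

lemma sum_word_eq (π : NCPlus (L + 2)) :
    word (L + 2) (lo π.1) 1 + ∑ i ∈ range L, word (L + 2) (lo π.1) (i + 2) = L + 2 := by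
  have h1 := (isLo_lo π).firstReturn ((isLo_lo π).isChord_one (by omega))
  have h2 := h1.2.2
  have h : Icc 1 (L + 2) = Ico 1 (L + 2 + 1) := by ext; simp
  rw [← h, sum_Icc_split, word_last] at h2
  omega

lemma blockCount_eq (π : NCPlus (L + 2)) {k : ℕ} (hk : 1 ≤ k) :
    blockCount π k = (if word (L + 2) (lo π.1) 1 = k then 1 else 0) +
      ∑ i ∈ range L, if word (L + 2) (lo π.1) (i + 2) = k then 1 else 0 := by
  rw [blockCount, card_filter_parts π.1 hk, Finset.card_filter, sum_Icc_split, word_last,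
    if_neg (show ¬ 0 = k by omega)]
  rfl

lemma blockCount_kap_zpow (π : NCPlus (L + 2)) (j : ℤ) (k : ℕ) :
    blockCount ((kap L ^ j) π) k = blockCount π k := by
  have hnat : ∀ (n : ℕ) (π : NCPlus (L + 2)), blockCount ((kap L ^ n) π) k = blockCount π k := by
    intro n π
    induction n with
    | zero => simp
    | succ n ih =>
      rw [pow_succ', Equiv.Perm.mul_apply, ← ih]
      exact card_filter_kappa _ _ _
  obtain ⟨n, rfl | rfl⟩ := j.eq_nat_or_neg
  · rw [zpow_natCast, hnat]
  · rw [← hnat n ((kap L ^ (-(n : ℤ))) π)]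
    simp

variable {K d : ℕ}

/-- If no arc of length at most `K` leaves a period, the word of a fixed point is its code. -/
lemma word_eq_code_of_suffix (hK : 1 ≤ K) (hd : 2 ≤ d) (hL : L = d * K) {π : NCPlus (L + 2)}
    (hfix : (kap L ^ K) π = π)
    (hs : ∀ j ≤ K, ∑ i ∈ range j, code K π ((K - j : ℕ) + i) ≤ j) {i : ℕ} (hi : i < L) :
    word (L + 2) (lo π.1) (i + 2) = code K π i := by
  have hKL : 2 * K ≤ L := by rw [hL]; exact Nat.mul_le_mul_right K hd
  have hper := code_add_of_fixed hfix
  have inside : ∀ i ℓ k, i < L → ℓ ≤ K → Arc π (i : ℕ) ℓ k → i + ℓ < L := by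
    intro i ℓ k hi hℓ ha
    have h1 := ha.isArcLength hK hKL hℓ
    have hr := Nat.mod_lt i (show 0 < K by omega)
    have hdiv := Nat.mod_add_div i K
    have h2 : ℓ < K - i % K := by
      by_contra hc
      have h3 := h1.2.1 (K - i % K) (by omega) (by omega)
      have h4 := hs (K - i % K) (by omega)
      have h5 : ∀ t : ℕ, code K π ((i : ℤ) + t) = code K π ((K - (K - i % K) : ℕ) + t) := by
        intro t
        have : (i : ℤ) + t = ((K - (K - i % K) : ℕ) + t) + K * ((i / K : ℕ) : ℤ) := by
          rw [show K - (K - i % K) = i % K by omega]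
          have : (i : ℤ) = ((i % K + K * (i / K) : ℕ) : ℤ) := by rw [hdiv]
          conv_lhs => rw [this]
          push_cast
          ring
        rw [this, periodic_mul hper]
      simp only [h5] at h3
      omega
    have h3 : i / K < d := by
      rw [Nat.div_lt_iff_lt_mul (by omega), ← hL]; exact hi
    have h4 : K * (i / K + 1) ≤ K * d := Nat.mul_le_mul_left K h3
    rw [Nat.mul_add, mul_comm K d, ← hL] at h4
    omega
  apply word_eq_code
  · intro ℓ k h
    have hb := h.bounds
    have ha := (arc_natCast (by omega)).2 h
    rcases ha.short hfix hK with h1 | h1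
    · exact h1
    · by_contra hc
      obtain ⟨k', hk'⟩ := ha.reverse (by omega) (by omega)
      have := inside (i + ℓ) (L - ℓ) k' (by omega) (by omega) (by push_cast; exact hk')
      omega
  · intro ℓ k h1 h2
    exact inside i ℓ k hi h1 h2

/-- If all prefixes of a period of the code are large, there is a chord that joins two opposite
points. -/
lemma word_eq_code_of_prefix (hK : 1 ≤ K) (hd : 2 ≤ d) (hL : L = d * K) {π : NCPlus (L + 2)}
    (hfix : (kap L ^ K) π = π)
    (hs : ∀ j, 1 ≤ j → j ≤ K → j + 1 ≤ ∑ i ∈ range j, code K π i) :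
    d = 2 ∧ ∑ i ∈ range K, code K π i = K + 1 ∧
      (∀ i < L, i ≠ K → word (L + 2) (lo π.1) (i + 2) = code K π i) ∧
      word (L + 2) (lo π.1) (K + 2) = 0 := by
  have hKL : 2 * K ≤ L := by rw [hL]; exact Nat.mul_le_mul_right K hd
  have h1 := hs 1 (le_refl 1) hK
  simp only [range_one, sum_singleton, Nat.cast_zero] at h1
  obtain ⟨ℓ, hℓ, ha⟩ := (code_eq_iff (K := K) (π := π) (x := 0) (by omega)).1 rfl
  have hal := ha.isArcLength hK hKL hℓ
  have hℓK : ℓ = K := by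
    by_contra hc
    have h2 := hal.2.2.1 (by omega)
    have h3 := hs (ℓ + 1) (by omega) (by omega)
    simp only [zero_add] at h2
    omega
  subst hℓK
  have hsum := hal.2.2.2 rfl
  simp only [zero_add] at hsum
  have hch := arc_zero.1 ha
  have hL2 : L = 2 * ℓ := by
    by_contra hc
    have h2 := (arc_add_of_fixed hfix 0 ℓ _).2 ha
    rw [zero_add, arc_natCast (by omega)] at h2
    have := hch.eq_of_end h2 (by omega)
    omega
  have hd2 : d = 2 := by
    have : d * ℓ = 2 * ℓ := by omega
    exact Nat.eq_of_mul_eq_mul_right hK this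
  -- chords in the first half lie below the long chord
  have nest : ∀ i ℓ' k', i ≤ ℓ → 0 < i → HasChord π (i + 2) (i + 2 + ℓ') k' → i + ℓ' < ℓ := by
    intro i ℓ' k' h1 h0 h2
    have h3 := hch.noncrossing h2
    by_contra hc
    have h4 : i + 2 + ℓ' = 2 + ℓ := by omega
    have := hch.eq_of_end h2 (by omega)
    omega
  refine ⟨hd2, hsum, fun i hi hne => ?_, ?_⟩
  · apply word_eq_code
    · intro ℓ' k' h
      have hb := h.bounds
      rcases Nat.lt_or_ge ℓ i with h4 | h4
      · omega
      · rcases Nat.eq_zero_or_pos i with rfl | h0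
        · have := hch.unique h; omega
        · have := nest i ℓ' k' h4 h0 h; omega
    · intro ℓ' k' h2 h3
      rcases Nat.lt_or_ge i ℓ with h4 | h4
      · omega
      · obtain ⟨t, rfl⟩ := Nat.exists_eq_add_of_le h4
        have h5 : Arc π (t : ℕ) ℓ' k' := by
          rw [← arc_add_of_fixed hfix]
          push_cast at h3
          rwa [add_comm] at h3
        rw [arc_natCast (by omega)] at h5
        have := nest t ℓ' k' (by omega) (by omega) h5
        omega
  · by_contra hc
    obtain ⟨ℓ', hℓ'⟩ := (word_eq_iff (Nat.one_le_iff_ne_zero.2 hc)).1 rfl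
    have := nest ℓ ℓ' _ (le_refl _) hK hℓ'
    omega

lemma periodic_ite {c : ℤ → ℕ} (hc : ∀ x, c (x + K) = c x) (k : ℕ) (x : ℤ) :
    (fun x => if c x = k then 1 else 0 : ℤ → ℕ) (x + K) = (fun x => if c x = k then 1 else 0) x := by
  simp only [hc]

/-- The block sizes of a fixed point of the `K`-th power of the pseudo-rotation: each non-zero entry
of a period of the code occurs `d` times, and what is missing from the total `L + 2` is the size of
one further block. -/
theorem blockCount_of_fixed (hK : 1 ≤ K) (hd : 2 ≤ d) (hL : L = d * K) {π : NCPlus (L + 2)}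
    (hfix : (kap L ^ K) π = π) :
    d * ∑ i ∈ range K, code K π i ≤ L + 2 ∧
      ∀ k, 1 ≤ k → blockCount π k = d * (∑ i ∈ range K, if code K π i = k then 1 else 0) +
        if L + 2 - d * ∑ i ∈ range K, code K π i = k then 1 else 0 := by
  have hper := code_add_of_fixed hfix
  -- all the data are invariant under rotation
  have hrot : ∀ x : ℤ, (d * ∑ i ∈ range K, code K ((kap L ^ (-x)) π) i ≤ L + 2 ∧
      ∀ k, 1 ≤ k → blockCount ((kap L ^ (-x)) π) k =
        d * (∑ i ∈ range K, if code K ((kap L ^ (-x)) π) i = k then 1 else 0) +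
        if L + 2 - d * ∑ i ∈ range K, code K ((kap L ^ (-x)) π) i = k then 1 else 0) →
      (d * ∑ i ∈ range K, code K π i ≤ L + 2 ∧
      ∀ k, 1 ≤ k → blockCount π k = d * (∑ i ∈ range K, if code K π i = k then 1 else 0) +
        if L + 2 - d * ∑ i ∈ range K, code K π i = k then 1 else 0) := by
    intro x h
    have h1 : ∀ i : ℕ, code K ((kap L ^ (-x)) π) i = code K π (x + i) := by
      intro i
      rw [← code_kap_zpow K π (-x)]
      congr 1
      ring
    simp only [h1, blockCount_kap_zpow] at h
    rw [sum_period hper] at h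
    refine ⟨h.1, fun k hk => ?_⟩
    rw [h.2 k hk]
    have := sum_period (c := fun x => if code K π x = k then 1 else 0) (periodic_ite hper k) x
    rw [this]
  have hfix' : ∀ x : ℤ, (kap L ^ K) ((kap L ^ (-x)) π) = (kap L ^ (-x)) π := by
    intro x
    rw [← Equiv.Perm.mul_apply, ← zpow_natCast, ← zpow_add, add_comm (K : ℤ), zpow_add,
      Equiv.Perm.mul_apply, zpow_natCast, hfix]
  have hcode' : ∀ (x : ℤ) (i : ℤ), code K ((kap L ^ (-x)) π) i = code K π (x + i) := by
    intro x i
    rw [← code_kap_zpow K π (-x)]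
    congr 1
    ring
  rcases Nat.lt_or_ge K (∑ i ∈ range K, code K π i) with hS | hS
  · obtain ⟨x, _, hx⟩ := exists_rotation_prefix hper hK hS
    apply hrot x
    have hf := hfix' x
    have hs : ∀ j, 1 ≤ j → j ≤ K → j + 1 ≤ ∑ i ∈ range j, code K ((kap L ^ (-(x : ℤ))) π) i := by
      intro j h1 h2
      simp only [hcode']
      exact hx j h1 h2
    generalize (kap L ^ (-(x : ℤ))) π = σ at hf hs
    have hper := code_add_of_fixed hf
    obtain ⟨rfl, hsum, hw, hw0⟩ := word_eq_code_of_prefix hK hd hL hf hs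
    subst hL
    have hcK : code K σ K = code K σ 0 := by have := hper 0; rwa [zero_add] at this
    have htot := sum_word_eq σ
    have key : ∀ g : ℕ → ℕ,
        (∑ i ∈ range (2 * K), g (word (2 * K + 2) (lo σ.1) (i + 2))) + g (code K σ 0) =
        (∑ i ∈ range (2 * K), g (code K σ i)) + g 0 := by
      intro g
      have hmem : K ∈ range (2 * K) := by rw [mem_range]; omega
      rw [← Finset.add_sum_erase _ _ hmem,
        ← Finset.add_sum_erase _ (fun i : ℕ => g (code K σ i)) hmem, hw0, hcK,
        Finset.sum_congr rfl (g := fun i : ℕ => g (code K σ i))]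
      · ring
      · intro i hi
        simp only [mem_erase, mem_range] at hi
        rw [hw i hi.2 hi.1]
    have h1 := key id
    simp only [id] at h1
    rw [sum_range_mul_period hper, hsum] at h1
    have hw1 : word (2 * K + 2) (lo σ.1) 1 = code K σ 0 := by omega
    rw [hsum]
    refine ⟨by omega, fun k hk => ?_⟩
    rw [blockCount_eq σ hk, hw1]
    have h2 := key (fun t => if t = k then 1 else 0)
    have h3 := sum_range_mul_period (c := fun x => if code K σ x = k then 1 else 0)
      (periodic_ite hper k) 2
    beta_reduce at h2 h3
    rw [h3, if_neg (show ¬ 0 = k by omega)] at h2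
    rw [if_neg (show ¬ 2 * K + 2 - 2 * (K + 1) = k by omega)]
    omega
  · obtain ⟨x, hx⟩ := exists_rotation_suffix hper hK hS
    apply hrot x
    have hf := hfix' x
    have hs : ∀ j ≤ K, ∑ i ∈ range j, code K ((kap L ^ (-x)) π) ((K - j : ℕ) + i) ≤ j := by
      intro j h1
      simp only [hcode', ← add_assoc]
      exact hx j h1
    generalize (kap L ^ (-x)) π = σ at hf hs
    have hper := code_add_of_fixed hf
    have hw := fun i (hi : i < L) => word_eq_code_of_suffix hK hd hL hf hs hi
    have key : ∀ g : ℕ → ℕ, ∑ i ∈ range L, g (word (L + 2) (lo σ.1) (i + 2)) =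
        ∑ i ∈ range L, g (code K σ i) := by
      intro g
      apply Finset.sum_congr rfl
      intro i hi
      rw [mem_range] at hi
      rw [hw i hi]
    subst hL
    have htot := sum_word_eq σ
    have h1 := key id
    simp only [id] at h1
    rw [sum_range_mul_period hper] at h1
    refine ⟨by omega, fun k hk => ?_⟩
    rw [blockCount_eq σ hk]
    have h2 := key (fun t => if t = k then 1 else 0)
    have h3 := sum_range_mul_period (c := fun x => if code K σ x = k then 1 else 0)
      (periodic_ite hper k) d
    beta_reduce at h2 h3
    rw [h3] at h2
    rw [h2, show word (d * K + 2) (lo σ.1) 1 =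
      d * K + 2 - d * ∑ i ∈ range K, code K σ i by omega]
    ring

end

/-! ### Construction of fixed points with a given code -/

section
variable {L : ℕ}

/-- The word with first letter `p`, followed by the `L` letters of `v` and by a `0`. -/
def wordOf (L p : ℕ) (v : ℕ → ℕ) (a : ℕ) : ℕ :=
  if a = 1 then p else if a ≤ L + 1 then v (a - 2) else 0

lemma wordOf_add_two (p : ℕ) (v : ℕ → ℕ) {i : ℕ} (hi : i < L) : wordOf L p v (i + 2) = v i := by
  rw [wordOf, if_neg (by omega), if_pos (by omega)]
  rfl

lemma firstReturn_wordOf {p : ℕ} {v : ℕ → ℕ} (h1 : p + ∑ i ∈ range L, v i = L + 2)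
    (h2 : ∀ i ≤ L, i + 2 ≤ p + ∑ s ∈ range i, v s) : FirstReturn (wordOf L p v) 1 (L + 2) := by
  have key : ∀ i ≤ L, ∑ t ∈ Ico 1 (i + 2), wordOf L p v t = p + ∑ s ∈ range i, v s := by
    intro i hi
    rw [Finset.sum_eq_sum_Ico_succ_bot (by omega)]
    have := sum_Ico_add_two (wordOf L p v) 0 i
    simp only [zero_add] at this
    rw [add_comm i 2, this]
    congr 1
    apply Finset.sum_congr rfl
    intro s hs
    rw [mem_range] at hs
    exact wordOf_add_two p v (by omega)
  refine ⟨by omega, fun j h3 h4 => ?_, ?_⟩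
  · obtain ⟨i, rfl⟩ := Nat.exists_eq_add_of_le' (show 2 ≤ j by omega)
    rw [key i (by omega)]
    have := h2 i (by omega)
    omega
  · rw [Finset.sum_Ico_succ_top (by omega), key L (le_refl L), h1]
    have : wordOf L p v (L + 2) = 0 := by
      rw [wordOf, if_neg (by omega), if_neg (by omega)]
    omega

/-- The partial sums of `v - 1` that start at `i` return to `0` for the first time at `i + ℓ`. -/
def Returns (v : ℕ → ℕ) (i ℓ : ℕ) : Prop :=
  (∀ j, 1 ≤ j → j ≤ ℓ → j + 1 ≤ ∑ s ∈ range j, v (i + s)) ∧ ∑ s ∈ range (ℓ + 1), v (i + s) = ℓ + 1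

lemma Returns.shift {v u : ℕ → ℕ} {i j ℓ : ℕ} (h : Returns v i ℓ)
    (huv : ∀ s ≤ ℓ, v (i + s) = u (j + s)) : Returns u j ℓ := by
  have key : ∀ t ≤ ℓ + 1, ∑ s ∈ range t, v (i + s) = ∑ s ∈ range t, u (j + s) := by
    intro t ht
    apply Finset.sum_congr rfl
    intro s hs
    rw [mem_range] at hs
    exact huv s (by omega)
  refine ⟨fun t h1 h2 => ?_, ?_⟩
  · rw [← key t (by omega)]; exact h.1 t h1 h2
  · rw [← key _ (le_refl _)]; exact h.2

/-- The chords of a partition that is given by its word. -/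
lemma hasChord_ofWord {p : ℕ} {v : ℕ → ℕ} (hw : FirstReturn (wordOf L p v) 1 (L + 2)) {i ℓ k : ℕ}
    (h : i + ℓ < L) :
    HasChord (ofWord (wordOf L p v) hw) (i + 2) (i + 2 + ℓ) k ↔
      1 ≤ k ∧ v i = k ∧ Returns v i ℓ := by
  rw [hasChord_iff, (isLo_lo _).isChord_iff, word_ofWord hw (by omega) (by omega),
    wordOf_add_two p v (show i < L by omega)]
  have hcongr : ∀ t, i + 2 ≤ t → t ≤ i + 2 + ℓ →
      word (L + 2) (lo (ofWord (wordOf L p v) hw).1) t = v (t - 2) := by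
    intro t h1 h2
    rw [word_ofWord hw (by omega) (by omega)]
    obtain ⟨s, rfl⟩ := Nat.exists_eq_add_of_le' (show 2 ≤ t by omega)
    exact wordOf_add_two p v (by omega)
  have hret : FirstReturn (word (L + 2) (lo (ofWord (wordOf L p v) hw).1)) (i + 2) (i + 2 + ℓ) ↔
      Returns v i ℓ := by
    have h1 : FirstReturn (word (L + 2) (lo (ofWord (wordOf L p v) hw).1)) (i + 2) (i + 2 + ℓ) ↔
        FirstReturn (fun t => v (t - 2)) (i + 2) (i + 2 + ℓ) :=
      ⟨fun h => h.congr hcongr, fun h => h.congr fun t a b => (hcongr t a b).symm⟩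
    rw [h1]
    have h2 : ∀ j, ∑ t ∈ Ico (i + 2) (i + 2 + j), v (t - 2) = ∑ s ∈ range j, v (i + s) :=
      fun j => sum_Ico_add_two (fun t => v (t - 2)) i j
    constructor
    · rintro ⟨_, g1, g2⟩
      refine ⟨fun j h3 h4 => ?_, ?_⟩
      · have := g1 (i + 2 + j) (by omega) (by omega)
        rw [h2] at this
        omega
      · rw [add_assoc (i + 2), h2] at g2
        omega
    · rintro ⟨g1, g2⟩
      refine ⟨by omega, fun j h3 h4 => ?_, ?_⟩
      · obtain ⟨t, rfl⟩ := Nat.exists_eq_add_of_le (show i + 2 ≤ j by omega)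
        rw [h2]
        have := g1 t (by omega) (by omega)
        omega
      · rw [add_assoc (i + 2), h2]
        omega
  rw [hret]
  constructor
  · rintro ⟨_, ⟨h1, h2⟩, h3⟩; exact ⟨by omega, h3, h2⟩
  · rintro ⟨h1, h2, h3⟩; exact ⟨by omega, ⟨by omega, h3⟩, h2⟩

variable {K d : ℕ}

/-- If the rotation by `K` steps maps chords to chords, the partition is fixed. -/
lemma fixed_of_chords (hd : 1 ≤ d) (hL : L = d * K) (hL1 : 1 ≤ L) {π : NCPlus (L + 2)}
    (h : ∀ i ℓ k, HasChord π (i + 2) (i + 2 + ℓ) k → Link π (i + K) (i + ℓ + K)) :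
    (kap L ^ K) π = π := by
  have one : ∀ x y : ℤ, (∃ k, HasChord π (pt L x) (pt L y) k) → Link π (x + K) (y + K) := by
    rintro x y ⟨k, hk⟩
    have hb := hk.bounds
    have hx := Int.emod_nonneg x (show (L : ℤ) ≠ 0 by omega)
    have hy := Int.emod_nonneg y (show (L : ℤ) ≠ 0 by omega)
    have ex := Int.emod_add_mul_ediv x L
    have ey := Int.emod_add_mul_ediv y L
    unfold pt at hk hb
    have h1 := h (x % L).toNat ((y % L).toNat - (x % L).toNat) k (by
      convert hk using 1; omega)
    unfold Link at h1 ⊢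
    have e1 : x + K = ((x % L).toNat : ℤ) + K + L * (x / L) := by
      rw [Int.toNat_of_nonneg hx]; linear_combination -ex
    have e2 : y + K = ((x % L).toNat : ℤ) + (((y % L).toNat - (x % L).toNat : ℕ) : ℤ) + K
        + L * (y / L) := by
      have : ((x % L).toNat : ℤ) + (((y % L).toNat - (x % L).toNat : ℕ) : ℤ) = y % L := by omega
      rw [this]; linear_combination -ey
    rwa [e1, e2, pt_add_mul, pt_add_mul]
  have fwd : ∀ x y : ℤ, Link π x y → Link π (x + K) (y + K) := by
    rintro x y (h1 | h1)
    · exact one x y h1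
    · exact (one y x h1).symm
  have iter : ∀ (n : ℕ) (x y : ℤ), Link π x y → Link π (x + K * n) (y + K * n) := by
    intro n
    induction n with
    | zero => simp
    | succ n ih =>
      intro x y h1
      have := fwd _ _ (ih x y h1)
      push_cast
      convert this using 1 <;> ring
  apply NCPlus.ext_link
  intro x y
  have h1 := link_kap_pow hL1 π K (x - K) (y - K)
  rw [sub_add_cancel, sub_add_cancel] at h1
  rw [h1]
  constructor
  · intro h2
    have := fwd _ _ h2
    rwa [sub_add_cancel, sub_add_cancel] at this
  · intro h2
    obtain ⟨e, rfl⟩ := Nat.exists_eq_add_of_le' hd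
    have h3 := iter e x y h2
    have e1 : ∀ x : ℤ, x + K * e = x - K + L * 1 := by
      intro x; rw [hL]; push_cast; ring
    unfold Link at h3 ⊢
    rwa [e1, e1, pt_add_mul, pt_add_mul] at h3

lemma link_of_hasChord {π : NCPlus (L + 2)} {i ℓ k : ℕ} (h : HasChord π (i + 2) (i + 2 + ℓ) k) :
    Link π i (i + ℓ) := by
  have hb := h.bounds
  unfold Link
  have e : (i : ℤ) + ℓ = ((i + ℓ : ℕ) : ℤ) := by push_cast; rfl
  rw [e, pt_natCast (show i < L by omega), pt_natCast (show i + ℓ < L by omega)]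
  left
  refine ⟨k, ?_⟩
  convert h using 1
  omega

lemma code_of_word (hKL : 2 * K ≤ L) {π : NCPlus (L + 2)} {i : ℕ} (hi : i < K)
    (h : ∀ ℓ k, HasChord π (i + 2) (i + 2 + ℓ) k → ℓ ≤ K) :
    code K π i = word (L + 2) (lo π.1) (i + 2) :=
  (word_eq_code h fun ℓ k h1 _ => by omega).symm

section
variable {c : ℤ → ℕ}

/-- The partition whose word repeats a period of the code, for codes of sum at most `K`: by the
condition on suffixes no chord leaves its period, so that the chord diagram is periodic. -/
lemma exists_fixed_suffix (hc : ∀ x, c (x + K) = c x) (hK : 1 ≤ K) (hd : 2 ≤ d) (hL : L = d * K)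
    (hS : ∑ i ∈ range K, c i ≤ K)
    (hs : ∀ j ≤ K, ∑ i ∈ range j, c ((K - j : ℕ) + i) ≤ j) :
    ∃ π : NCPlus (L + 2), (kap L ^ K) π = π ∧ ∀ i < K, code K π (i : ℕ) = c i := by
  have hKL : 2 * K ≤ L := by rw [hL]; exact Nat.mul_le_mul_right K hd
  have htot : ∑ i ∈ range L, c i = d * ∑ i ∈ range K, c i := by
    rw [hL]; exact sum_range_mul_period hc d
  have hdS : d * ∑ i ∈ range K, c i ≤ L := by
    rw [hL]; exact Nat.mul_le_mul_left d hS
  have hres : ∀ i : ℕ, c i = c ((i % K : ℕ) : ℤ) := by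
    intro i
    have := periodic_mul hc ((i % K : ℕ) : ℤ) ((i / K : ℕ) : ℤ)
    rw [← this]
    congr 1
    exact_mod_cast (Nat.mod_add_div i K).symm
  have suffix : ∀ i, i < L → ∑ s ∈ range (K - i % K), c ((i : ℤ) + s) ≤ K - i % K := by
    intro i hi
    have hr := Nat.mod_lt i (show 0 < K by omega)
    have h1 := hs (K - i % K) (by omega)
    refine le_trans (le_of_eq (Finset.sum_congr rfl fun s _ => ?_)) h1
    have : (i : ℤ) + s = ((K - (K - i % K) : ℕ) + s) + K * ((i / K : ℕ) : ℤ) := by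
      rw [show K - (K - i % K) = i % K by omega]
      have h2 := Nat.mod_add_div i K
      have : (i : ℤ) = ((i % K + K * (i / K) : ℕ) : ℤ) := by rw [h2]
      conv_lhs => rw [this]
      push_cast
      ring
    rw [this, periodic_mul hc]
  have hblock : ∀ i, i < L → i + (K - i % K) ≤ L := by
    intro i hi
    have hr := Nat.mod_lt i (show 0 < K by omega)
    have hdiv := Nat.mod_add_div i K
    have h3 : i / K < d := by
      rw [Nat.div_lt_iff_lt_mul (by omega), ← hL]; exact hi
    have h4 : K * (i / K + 1) ≤ K * d := Nat.mul_le_mul_left K h3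
    rw [Nat.mul_add, mul_comm K d, ← hL] at h4
    omega
  have tail : ∀ t i, i ≤ L → L - i = t → ∑ s ∈ range (L - i), c ((i : ℤ) + s) ≤ L - i := by
    intro t
    induction t using Nat.strong_induction_on with
    | _ t ih =>
      intro i hi ht
      rcases Nat.lt_or_ge i L with h | h
      · have hr := Nat.mod_lt i (show 0 < K by omega)
        have h1 := suffix i h
        have h2 := hblock i h
        have h3 := ih (L - (i + (K - i % K))) (by omega) (i + (K - i % K)) h2 rfl
        have h4 := Finset.sum_range_add (fun s : ℕ => c ((i : ℤ) + s)) (K - i % K)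
          (L - (i + (K - i % K)))
        rw [show K - i % K + (L - (i + (K - i % K))) = L - i by omega] at h4
        have h5 : ∀ s : ℕ, (i : ℤ) + ((K - i % K + s : ℕ) : ℤ) = ((i + (K - i % K) : ℕ) : ℤ) + s := by
          intro s; push_cast; ring
        simp only [h5] at h4
        omega
      · rw [show L - i = 0 by omega]; simp
  -- the word consists of `d` copies of a period of `c`, between the two points of the first block
  have hw : FirstReturn (wordOf L (L + 2 - d * ∑ i ∈ range K, c i) fun i => c i) 1 (L + 2) := by
    apply firstReturn_wordOf
    · rw [htot]; omega
    · intro i hi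
      have h1 := tail _ i hi rfl
      have h2 := sum_shift_eq c i (L - i)
      rw [show i + (L - i) = L by omega, htot] at h2
      omega
  set π := ofWord _ hw
  have hshort : ∀ i ℓ k, HasChord π (i + 2) (i + 2 + ℓ) k → ℓ < K - i % K := by
    intro i ℓ k h
    have hb := h.bounds
    have h1 := ((hasChord_ofWord hw (by omega)).1 h).2.2.1
    have hr := Nat.mod_lt i (show 0 < K by omega)
    by_contra hcon
    have h2 := h1 (K - i % K) (by omega) (by omega)
    have h3 := suffix i (by omega)
    push_cast at h2
    omega
  refine ⟨π, ?_, ?_⟩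
  · apply fixed_of_chords (d := d) (by omega) hL (by omega)
    intro i ℓ k h
    have hb := h.bounds
    have h1 := (hasChord_ofWord hw (by omega)).1 h
    have h2 := hshort i ℓ k h
    obtain ⟨i', t, hi', e⟩ : ∃ (i' : ℕ) (t : ℤ), i' < L ∧ (i : ℤ) + K = i' + L * t := by
      rcases Nat.lt_or_ge (i + K) L with h3 | h3
      · exact ⟨i + K, 0, h3, by push_cast; ring⟩
      · exact ⟨i + K - L, 1, by omega, by push_cast [h3]; ring⟩
    have e' : (i' : ℤ) = i + K * (1 - d * t) := by
      rw [hL] at e; push_cast at e; linear_combination -e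
    have hmod : i' % K = i % K := by
      have : ((i' : ℤ)) % K = i % K := by rw [e', Int.add_mul_emod_self_left]
      exact_mod_cast this
    have h3 := hblock i' hi'
    rw [hmod] at h3
    have h4 : HasChord π (i' + 2) (i' + 2 + ℓ) k := by
      rw [hasChord_ofWord hw (by omega)]
      have hv : ∀ s : ℕ, c ((i + s : ℕ) : ℤ) = c ((i' + s : ℕ) : ℤ) := by
        intro s
        push_cast
        have : (i' : ℤ) + s = i + s + K * (1 - d * t) := by rw [e']; ring
        rw [this, periodic_mul hc]
      refine ⟨h1.1, ?_, h1.2.2.shift fun s _ => hv s⟩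
      rw [← h1.2.1]
      have := hv 0
      simpa using this.symm
    have h5 := link_of_hasChord h4
    unfold Link at h5 ⊢
    have e2 : (i : ℤ) + ℓ + K = i' + ℓ + L * t := by linear_combination e
    rwa [e, e2, pt_add_mul, pt_add_mul]
  · intro i hi
    rw [code_of_word hKL hi, word_ofWord hw (by omega) (by omega), wordOf_add_two _ _ (by omega)]
    intro ℓ k h
    have := hshort i ℓ k h
    omega

/-- The partition with a diameter as one of its chords. It belongs to a code of sum `K + 1`, which
occurs for `d = 2` only. -/
lemma exists_fixed_prefix (hc : ∀ x, c (x + K) = c x) (hK : 1 ≤ K) (hL : L = 2 * K)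
    (hS : ∑ i ∈ range K, c i = K + 1)
    (hs : ∀ j, 1 ≤ j → j ≤ K → j + 1 ≤ ∑ i ∈ range j, c i) :
    ∃ π : NCPlus (L + 2), (kap L ^ K) π = π ∧ ∀ i < K, code K π (i : ℕ) = c i := by
  have hc0 : 2 ≤ c 0 := by
    have := hs 1 (le_refl 1) hK
    simpa using this
  set v : ℕ → ℕ := fun i => if i = K then 0 else c i with hv
  have hvK : v K = 0 := by simp [hv]
  have hvlt : ∀ i, i < K → v i = c i := fun i hi => by simp only [hv]; rw [if_neg (by omega)]
  have hvgt : ∀ s, 0 < s → s < K → v (K + s) = c s := by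
    intro s h1 h2
    simp only [hv]
    rw [if_neg (by omega), ← hc s]
    congr 1
    push_cast; ring
  have hsum1 : ∀ i ≤ K, ∑ s ∈ range i, v s = ∑ s ∈ range i, c s := by
    intro i hi
    apply Finset.sum_congr rfl
    intro s hs
    rw [mem_range] at hs
    exact hvlt s (by omega)
  have hsum2 : ∀ i, 1 ≤ i → i ≤ K →
      c 0 + ∑ s ∈ range (K + i), v s = K + 1 + ∑ s ∈ range i, c s := by
    intro i h1 h2
    rw [Finset.sum_range_add, hsum1 K (le_refl K), hS]
    obtain ⟨t, rfl⟩ := Nat.exists_eq_add_of_le' h1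
    rw [Finset.sum_range_succ', Finset.sum_range_succ' (fun s : ℕ => c s)]
    have : ∑ s ∈ range t, v (K + (s + 1)) = ∑ s ∈ range t, c ((s + 1 : ℕ) : ℤ) := by
      apply Finset.sum_congr rfl
      intro s hs
      rw [mem_range] at hs
      exact hvgt (s + 1) (by omega) (by omega)
    rw [this, add_zero, hvK]
    simp only [Nat.cast_zero]
    ring
  -- the opposite points `2` and `K + 2` are joined by a chord; the first letter of the word is
  -- the size of the block on the other side of this chord
  have hw : FirstReturn (wordOf L (c 0) v) 1 (L + 2) := by
    apply firstReturn_wordOf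
    · rw [hL, show 2 * K = K + K by ring, hsum2 K hK (le_refl K), hS]
      ring
    · intro i hi
      rcases Nat.lt_or_ge K i with h | h
      · obtain ⟨j, rfl⟩ := Nat.exists_eq_add_of_le h.le
        rw [hsum2 j (by omega) (by omega)]
        have := hs j (by omega) (by omega)
        omega
      · rw [hsum1 i h]
        rcases Nat.eq_zero_or_pos i with rfl | h0
        · simp; exact hc0
        · have := hs i h0 h
          omega
  set π := ofWord _ hw
  have hch : HasChord π (0 + 2) (0 + 2 + K) (c 0) := by
    rw [hasChord_ofWord hw (by omega)]
    refine ⟨by omega, hvlt 0 (by omega), fun j h1 h2 => ?_, ?_⟩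
    · simp only [zero_add]
      rw [hsum1 j h2]
      exact hs j h1 h2
    · simp only [zero_add]
      rw [Finset.sum_range_succ, hsum1 K (le_refl K), hvK, hS]
  have nest : ∀ i ℓ k, i ≤ K → 0 < i → HasChord π (i + 2) (i + 2 + ℓ) k → i + ℓ < K := by
    intro i ℓ' k' h1 h0 h2
    have h3 := hch.noncrossing h2
    by_contra hc
    have h4 : i + 2 + ℓ' = 0 + 2 + K := by omega
    have := hch.eq_of_end h2 (by omega)
    omega
  refine ⟨π, ?_, ?_⟩
  · apply fixed_of_chords (d := 2) (by omega) hL (by omega)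
    intro i ℓ k h
    have hb := h.bounds
    rcases Nat.eq_zero_or_pos i with rfl | h0
    · have h1 := (hch.unique h).1
      have h2 : ℓ = K := by omega
      subst h2
      have h3 := (link_of_hasChord hch)
      have e : (0 : ℕ) + (ℓ : ℤ) + ℓ = (0 : ℕ) + L * 1 := by rw [hL]; push_cast; ring
      unfold Link at h3 ⊢
      rw [e, pt_add_mul]
      exact Joined.symm h3
    · have h1 := (hasChord_ofWord hw (by omega)).1 h
      rcases Nat.lt_or_ge K i with h2 | h2
      · obtain ⟨s, rfl⟩ := Nat.exists_eq_add_of_le h2.le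
        have h3 : HasChord π (s + 2) (s + 2 + ℓ) k := by
          rw [hasChord_ofWord hw (by omega)]
          have hv' : ∀ t ≤ ℓ, v (K + s + t) = v (s + t) := by
            intro t ht
            rw [add_assoc, hvgt _ (by omega) (by omega), hvlt _ (by omega)]
          refine ⟨h1.1, ?_, h1.2.2.shift hv'⟩
          rw [← h1.2.1]
          exact (hv' 0 (by omega)).symm
        have h4 := link_of_hasChord h3
        have e1 : ((K + s : ℕ) : ℤ) + K = s + L * 1 := by rw [hL]; push_cast; ring
        have e2 : ((K + s : ℕ) : ℤ) + ℓ + K = s + ℓ + L * 1 := by rw [hL]; push_cast; ring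
        unfold Link at h4 ⊢
        rwa [e1, e2, pt_add_mul, pt_add_mul]
      · have hn := nest i ℓ k h2 h0 h
        have h3 : HasChord π (K + i + 2) (K + i + 2 + ℓ) k := by
          rw [hasChord_ofWord hw (by omega)]
          have hv' : ∀ t ≤ ℓ, v (i + t) = v (K + i + t) := by
            intro t ht
            rw [add_assoc K, hvgt _ (by omega) (by omega), hvlt _ (by omega)]
          refine ⟨h1.1, ?_, h1.2.2.shift hv'⟩
          rw [← h1.2.1]
          exact (hv' 0 (by omega)).symm
        have h4 := link_of_hasChord h3
        push_cast at h4
        have e1 : (i : ℤ) + K = K + i := by ring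
        have e2 : (i : ℤ) + ℓ + K = K + i + ℓ := by ring
        rwa [e1, e2]
  · intro i hi
    rw [code_of_word (by omega) hi, word_ofWord hw (by omega) (by omega),
      wordOf_add_two _ _ (by omega), hvlt i hi]
    intro ℓ k h
    rcases Nat.eq_zero_or_pos i with rfl | h0
    · have h1 := (hch.unique h).1; omega
    · have := nest i ℓ k hi.le h0 h; omega

/-- Every periodic sequence whose sum over a period is not too large is the code of a fixed point:
after a rotation of the sequence, given by the cycle lemma, the partition is written down by its
word. -/
theorem exists_fixed_of_code (hc : ∀ x, c (x + K) = c x) (hK : 1 ≤ K) (hd : 2 ≤ d)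
    (hL : L = d * K) (hS : d * ∑ i ∈ range K, c i ≤ L + 2) :
    ∃ π : NCPlus (L + 2), (kap L ^ K) π = π ∧ ∀ x, code K π x = c x := by
  have hmain : ∃ x : ℤ, ∃ π : NCPlus (L + 2), (kap L ^ K) π = π ∧
      ∀ i < K, code K π (i : ℕ) = c (x + i) := by
    rcases Nat.lt_or_ge K (∑ i ∈ range K, c i) with h | h
    · have h1 : d * (K + 1) ≤ d * K + 2 :=
        le_trans (Nat.mul_le_mul_left d h) (by rw [← hL]; exact hS)
      rw [Nat.mul_add] at h1
      have hd2 : d = 2 := by omega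
      subst hd2
      obtain ⟨x, _, hx⟩ := exists_rotation_prefix hc hK h
      refine ⟨x, exists_fixed_prefix (c := fun i => c (x + i)) (fun y => ?_) hK hL ?_ ?_⟩
      · rw [← add_assoc, hc]
      · rw [sum_period hc]; omega
      · exact hx
    · obtain ⟨x, hx⟩ := exists_rotation_suffix hc hK h
      refine ⟨x, exists_fixed_suffix (c := fun i => c (x + i)) (fun y => ?_) hK hd hL ?_ ?_⟩
      · rw [← add_assoc, hc]
      · rw [sum_period hc]; exact h
      · intro j hj
        have := hx j hj
        simpa only [add_assoc] using this
  obtain ⟨x, π, hfix, hcode⟩ := hmain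
  refine ⟨(kap L ^ x) π, ?_, ?_⟩
  · rw [← Equiv.Perm.mul_apply, ← zpow_natCast, ← zpow_add, add_comm (K : ℤ), zpow_add,
      Equiv.Perm.mul_apply, zpow_natCast, hfix]
  · intro y
    have hper := code_add_of_fixed hfix
    have h1 := code_kap_zpow K π x (y - x)
    rw [sub_add_cancel] at h1
    rw [h1]
    have h2 := Int.emod_nonneg (y - x) (show (K : ℤ) ≠ 0 by omega)
    have h3 := Int.emod_lt_of_pos (y - x) (show (0 : ℤ) < K by omega)
    have h4 := Int.emod_add_mul_ediv (y - x) K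
    obtain ⟨i, hi⟩ := Int.eq_ofNat_of_zero_le h2
    rw [hi] at h3 h4
    have h5 := hcode i (by omega)
    have h6 := periodic_mul hper i ((y - x) / K)
    have h7 := periodic_mul hc (x + i) ((y - x) / K)
    rw [h4] at h6
    rw [h6, h5, ← h7]
    congr 1
    linear_combination h4

end

/-- The numbers of blocks of each size that belong to the code `c`, for a partition of an
`N`-element set that is fixed by a rotation of order `d`. -/
def codeCount (d N K : ℕ) (c : Fin K → ℕ) (k : ℕ) : ℕ :=
  if k = 0 then 0 else d * (univ.filter fun i => c i = k).card +
    if N - d * ∑ i, c i = k then 1 else 0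

lemma blockCount_zero {N : ℕ} (π : NCPlus N) : blockCount π 0 = 0 := by
  rw [blockCount, Finset.card_eq_zero, Finset.filter_eq_empty_iff]
  intro B hB h
  exact π.1.ne_empty hB (Finset.card_eq_zero.1 h)

/-- The fixed points of the `K`-th power of the pseudo-rotation with given numbers of blocks
correspond to the codes of length `K`. The code is injective by `eq_of_code_eq`, surjective by
`exists_fixed_of_code`, and it gives the block sizes by `blockCount_of_fixed`. -/
theorem ncard_fixed (hK : 1 ≤ K) (hd : 2 ≤ d) (hL : L = d * K) (Q : (ℕ → ℕ) → Prop) :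
    {π : NCPlus (L + 2) | Q (blockCount π) ∧ (kap L ^ K) π = π}.ncard =
      {c : Fin K → ℕ | d * ∑ i, c i ≤ L + 2 ∧ Q (codeCount d (L + 2) K c)}.ncard := by
  have hKL : 2 * K ≤ L := by rw [hL]; exact Nat.mul_le_mul_right K hd
  have hsum : ∀ π : NCPlus (L + 2), ∑ i : Fin K, code K π ((i : ℕ) : ℤ) =
      ∑ i ∈ range K, code K π i := fun π => Fin.sum_univ_eq_sum_range (fun i => code K π i) K
  have hcount : ∀ π : NCPlus (L + 2), (kap L ^ K) π = π →
      blockCount π = codeCount d (L + 2) K fun i => code K π ((i : ℕ) : ℤ) := by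
    intro π hπ
    ext k
    rcases Nat.eq_zero_or_pos k with rfl | hk
    · rw [blockCount_zero, codeCount, if_pos rfl]
    · rw [(blockCount_of_fixed hK hd hL hπ).2 k hk, codeCount,
        if_neg (show ¬ k = 0 by omega), hsum,
        Finset.card_filter,
        Fin.sum_univ_eq_sum_range (fun i => if code K π i = k then 1 else 0) K]
  apply Set.ncard_congr (fun π _ (i : Fin K) => code K π ((i : ℕ) : ℤ))
  · rintro π ⟨h1, h2⟩
    refine ⟨?_, ?_⟩
    · rw [hsum]; exact (blockCount_of_fixed hK hd hL h2).1
    · rwa [← hcount π h2]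
  · rintro π σ ⟨_, h1⟩ ⟨_, h2⟩ h
    apply eq_of_code_eq hK hKL h1 h2
    intro x
    have g2 := Int.emod_nonneg x (show (K : ℤ) ≠ 0 by omega)
    have g3 := Int.emod_lt_of_pos x (show (0 : ℤ) < K by omega)
    have g4 := Int.emod_add_mul_ediv x K
    obtain ⟨i, hi⟩ := Int.eq_ofNat_of_zero_le g2
    rw [hi] at g3 g4
    rw [← g4, periodic_mul (code_add_of_fixed h1), periodic_mul (code_add_of_fixed h2)]
    exact congrFun h ⟨i, by omega⟩
  · rintro c ⟨h1, h2⟩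
    have hpos : ∀ x : ℤ, (x % K).toNat < K := by
      intro x
      have g2 := Int.emod_nonneg x (show (K : ℤ) ≠ 0 by omega)
      have g3 := Int.emod_lt_of_pos x (show (0 : ℤ) < K by omega)
      omega
    set C : ℤ → ℕ := fun x => c ⟨(x % K).toNat, hpos x⟩ with hC
    have hCi : ∀ i : Fin K, C ((i : ℕ) : ℤ) = c i := by
      intro i
      simp only [hC]
      congr 1
      apply Fin.ext
      simp only
      rw [Int.emod_eq_of_lt (by omega) (by omega)]
      omega
    have hCs : ∑ i ∈ range K, C i = ∑ i, c i := by
      rw [← Fin.sum_univ_eq_sum_range (fun i => C i) K]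
      exact Finset.sum_congr rfl fun i _ => hCi i
    obtain ⟨π, hfix, hcode⟩ := exists_fixed_of_code (c := C)
      (fun x => by simp only [hC, Int.add_emod_right]) hK hd hL (by rw [hCs]; exact h1)
    have hc : (fun i : Fin K => code K π ((i : ℕ) : ℤ)) = c := by
      ext i; rw [hcode, hCi]
    refine ⟨π, ⟨?_, hfix⟩, hc⟩
    rw [hcount π hfix, hc]
    exact h2

end

/-! ### The cycle lemma and the number of partitions with given block sizes -/

section
variable {L : ℕ}

lemma sum_word_prefix (π : NCPlus (L + 2)) {j : ℕ} (h1 : 1 ≤ j) (h2 : j ≤ L + 1) :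
    j + 1 ≤ ∑ i ∈ range j, word (L + 2) (lo π.1) (i + 1) := by
  have h := ((isLo_lo π).isChord_iff.1 ((isLo_lo π).isChord_one (by omega))).2.2.1 (j + 1)
    (by omega) (by omega)
  rw [Finset.sum_Ico_eq_sum_range] at h
  simp only [Nat.add_sub_cancel, add_comm 1] at h
  omega

lemma sum_word_range (π : NCPlus (L + 2)) :
    ∑ i ∈ range (L + 1), word (L + 2) (lo π.1) (i + 1) = L + 2 := by
  have h := sum_word_eq π
  rw [Finset.sum_range_succ']
  simp only [zero_add]
  simp only [add_assoc, show 1 + 1 = 2 from rfl]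
  omega

lemma sum_zmod_range (f : ZMod (L + 1) → ℕ) : ∑ z, f z = ∑ i ∈ range (L + 1), f i := by
  have h := Fin.sum_univ_eq_sum_range (fun i : ℕ => f (i : ZMod (L + 1))) (L + 1)
  rw [← h]
  apply Fintype.sum_congr
  intro z
  exact congrArg f (ZMod.natCast_zmod_val (n := L + 1) z).symm

/-- The first `L + 1` letters of the word of `π`, written around a circle starting at `r`. -/
def circleWord (r : ZMod (L + 1)) (π : NCPlus (L + 2)) (z : ZMod (L + 1)) : ℕ :=
  word (L + 2) (lo π.1) ((z - r).val + 1)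

lemma circleWord_add (r : ZMod (L + 1)) (π : NCPlus (L + 2)) {i : ℕ} (hi : i < L + 1) :
    circleWord r π (r + i) = word (L + 2) (lo π.1) (i + 1) := by
  rw [circleWord, add_sub_cancel_left, ZMod.val_natCast_of_lt hi]

lemma sum_comp_add (f : ℕ → ℕ) (c : ZMod (L + 1) → ℕ) (r : ZMod (L + 1)) :
    ∑ z, f (c z) = ∑ i ∈ range (L + 1), f (c (r + i)) := by
  rw [← sum_zmod_range (fun z => f (c (r + z)))]
  exact (Equiv.sum_comp (Equiv.addLeft r) fun z => f (c z)).symm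

lemma sum_circleWord (f : ℕ → ℕ) (r : ZMod (L + 1)) (π : NCPlus (L + 2)) :
    ∑ z, f (circleWord r π z) = ∑ i ∈ range (L + 1), f (word (L + 2) (lo π.1) (i + 1)) := by
  rw [sum_comp_add f _ r]
  apply Finset.sum_congr rfl
  intro i hi
  rw [circleWord_add r π (mem_range.1 hi)]

/-- The positions of a circular word with total sum one more than its length from which all
prefixes have sum more than their length are unique. -/
lemma rotation_unique {c : ZMod (L + 1) → ℕ} (hc : ∑ z, c z = L + 2) {r s : ZMod (L + 1)}
    (hr : ∀ j : ℕ, 1 ≤ j → j ≤ L + 1 → j + 1 ≤ ∑ i ∈ range j, c (r + i))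
    (hs : ∀ j : ℕ, 1 ≤ j → j ≤ L + 1 → j + 1 ≤ ∑ i ∈ range j, c (s + i)) : r = s := by
  by_contra hne
  set y := (s - r).val with hy
  have hy0 : y ≠ 0 := by
    intro h
    rw [hy, ZMod.val_eq_zero, sub_eq_zero] at h
    exact hne h.symm
  have hyL : y < L + 1 := ZMod.val_lt _
  have h1 := hr y (by omega) (by omega)
  have h2 := hs (L + 1 - y) (by omega) (by omega)
  have h3 : ∑ i ∈ range (y + (L + 1 - y)), c (r + i) = L + 2 := by
    rw [show y + (L + 1 - y) = L + 1 by omega, ← sum_comp_add (fun t => t) c r, hc]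
  have h4 : ((y : ℕ) : ZMod (L + 1)) = s - r := by rw [hy, ZMod.natCast_zmod_val]
  rw [Finset.sum_range_add] at h3
  simp only [Nat.cast_add, h4, ← add_assoc, add_sub_cancel] at h3
  omega

lemma exists_circleWord {c : ZMod (L + 1) → ℕ} (hc : ∑ z, c z = L + 2) :
    ∃ r π, circleWord r π = c := by
  obtain ⟨x, -, hx⟩ := exists_rotation_prefix (c := fun t : ℤ => c (t : ZMod (L + 1))) (K := L + 1)
    (fun t => by push_cast; congr 1; have := ZMod.natCast_self (L + 1); push_cast at this
                 rw [this, add_zero])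
    (by omega) (by
      simp only [Int.cast_natCast]
      rw [← sum_zmod_range, hc])
  simp only [Int.cast_add, Int.cast_natCast] at hx
  set r : ZMod (L + 1) := (x : ZMod (L + 1))
  set w : ℕ → ℕ := fun a => if a = L + 2 then 0 else c (r + (a - 1 : ℕ)) with hw
  have hsum : ∀ j ≤ L + 1, ∑ t ∈ Ico 1 (j + 1), w t = ∑ i ∈ range j, c (r + i) := by
    intro j hj
    rw [Finset.sum_Ico_eq_sum_range]
    apply Finset.sum_congr (by simp)
    intro i hi
    have := mem_range.1 hi
    rw [hw]
    simp only
    rw [if_neg (by omega), Nat.add_sub_cancel_left]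
  have htot : ∑ i ∈ range (L + 1), c (r + i) = L + 2 := by
    rw [← sum_comp_add (fun t => t) c r, hc]
  have hF : FirstReturn w 1 (L + 2) := by
    refine ⟨by omega, fun j h1 h2 => ?_, ?_⟩
    · obtain ⟨j, rfl⟩ : ∃ i, j = i + 1 := ⟨j - 1, by omega⟩
      rw [hsum j (by omega)]
      have := hx j (by omega) (by omega)
      omega
    · rw [Finset.sum_Ico_succ_top (by omega), hsum (L + 1) le_rfl, htot, hw]
      simp
      omega
  refine ⟨r, ofWord w hF, ?_⟩
  ext z
  have hz := ZMod.val_lt (z - r)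
  rw [circleWord, word_ofWord hF (by omega) (by omega), hw]
  simp only
  rw [if_neg (by omega), Nat.add_sub_cancel, ZMod.natCast_zmod_val, add_sub_cancel]

lemma circleWord_injective {r s : ZMod (L + 1)} {π σ : NCPlus (L + 2)}
    (h : circleWord r π = circleWord s σ) : r = s ∧ π = σ := by
  have hpre : ∀ (r : ZMod (L + 1)) (π : NCPlus (L + 2)), ∀ j : ℕ, 1 ≤ j → j ≤ L + 1 →
      j + 1 ≤ ∑ i ∈ range j, circleWord r π (r + i) := by
    intro r π j h1 h2
    refine (sum_word_prefix π h1 h2).trans_eq ?_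
    apply Finset.sum_congr rfl
    intro i hi
    rw [circleWord_add r π (by have := mem_range.1 hi; omega)]
  have hrs : r = s := by
    apply rotation_unique (c := circleWord r π) _ (hpre r π) (by rw [h]; exact hpre s σ)
    exact (sum_circleWord (fun t => t) r π).trans (sum_word_range π)
  subst hrs
  refine ⟨rfl, NCPlus.ext_word fun a h1 h2 => ?_⟩
  rcases eq_or_lt_of_le h2 with rfl | h3
  · rw [word_last, word_last]
  · have := congr_fun h (r + (a - 1 : ℕ))
    rw [circleWord_add _ _ (by omega), circleWord_add _ _ (by omega)] at this
    rwa [show a - 1 + 1 = a by omega] at this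

/-- The numbers of the positive entries of `c` with a given value. -/
def valueCount {ι : Type*} [Fintype ι] (c : ι → ℕ) (k : ℕ) : ℕ :=
  if k = 0 then 0 else (univ.filter fun i => c i = k).card

lemma valueCount_circleWord (r : ZMod (L + 1)) (π : NCPlus (L + 2)) :
    valueCount (circleWord r π) = blockCount π := by
  ext k
  rcases Nat.eq_zero_or_pos k with rfl | hk
  · rw [blockCount_zero, valueCount, if_pos rfl]
  · rw [valueCount, if_neg (show ¬ k = 0 by omega), blockCount, card_filter_parts _ hk,
      Finset.card_filter, Finset.card_filter, sum_Icc_split, word_last,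
      if_neg (show ¬ 0 = k by omega), sum_circleWord (fun t => if t = k then 1 else 0),
      Finset.sum_range_succ']
    simp only [zero_add, add_assoc, add_zero, show 1 + 1 = 2 from rfl]
    rw [add_comm]

/-- The cycle lemma for positive non-crossing partitions: rotating the words of the partitions
gives each circular word of sum `L + 2` and length `L + 1` exactly once. -/
theorem ncard_mul (Q : (ℕ → ℕ) → Prop) :
    (L + 1) * {π : NCPlus (L + 2) | Q (blockCount π)}.ncard =
      {c : ZMod (L + 1) → ℕ | ∑ i, c i = L + 2 ∧ Q (valueCount c)}.ncard := by
  have h1 : (L + 1) = (Set.univ : Set (ZMod (L + 1))).ncard := by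
    rw [Set.ncard_univ, Nat.card_zmod]
  conv_lhs => rw [h1]
  rw [← Set.ncard_prod]
  apply Set.ncard_congr (fun p _ => circleWord p.1 p.2)
  · rintro ⟨r, π⟩ ⟨-, h⟩
    exact ⟨(sum_circleWord (fun t => t) r π).trans (sum_word_range π), by
      rw [valueCount_circleWord]; exact h⟩
  · rintro ⟨r, π⟩ ⟨s, σ⟩ _ _ h
    obtain ⟨rfl, rfl⟩ := circleWord_injective h
    rfl
  · rintro c ⟨h2, h3⟩
    obtain ⟨r, π, rfl⟩ := exists_circleWord h2
    refine ⟨(r, π), ⟨Set.mem_univ _, ?_⟩, rfl⟩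
    rwa [valueCount_circleWord] at h3

end

/-! ### Counting functions with prescribed sum, support and multiplicities -/

section
variable {ι : Type*}

lemma card_piAntidiag [DecidableEq ι] (s : Finset ι) (n : ℕ) : (piAntidiag s n).card = s.card.multichoose n := by
  rw [← card_finsuppAntidiag_nat_eq_multichoose]
  simp [finsuppAntidiag]

variable [Fintype ι]

lemma card_support_le_sum (c : ι → ℕ) : (univ.filter fun i => c i ≠ 0).card ≤ ∑ i, c i := by
  rw [Finset.card_filter]
  apply Finset.sum_le_sum
  intro i _
  split_ifs <;> omega

variable [DecidableEq ι]

lemma ncard_sum_eq (n : ℕ) :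
    {c : ι → ℕ | ∑ i, c i = n}.ncard = (Fintype.card ι).multichoose n := by
  rw [← Finset.card_univ, ← card_piAntidiag, ← Set.ncard_coe_finset]
  congr 1
  ext c
  simp

lemma ncard_sum_le_eq_sum (R : (ι → ℕ) → Prop) (A : ℕ) :
    {c : ι → ℕ | ∑ i, c i ≤ A ∧ R c}.ncard =
      ∑ n ∈ range (A + 1), {c : ι → ℕ | ∑ i, c i = n ∧ R c}.ncard := by
  classical
  have hfin : ∀ n, {c : ι → ℕ | ∑ i, c i = n ∧ R c} = ((piAntidiag univ n).filter R : Finset _) := by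
    intro n
    ext c
    simp
  simp only [hfin, Set.ncard_coe_finset]
  rw [← Finset.card_biUnion, ← Set.ncard_coe_finset]
  · congr 1
    ext c
    simp
  · intro x _ y _ hxy
    rw [Function.onFun, Finset.disjoint_left]
    intro c hc hc'
    simp only [mem_filter, mem_piAntidiag] at hc hc'
    exact hxy (hc.1.1.symm.trans hc'.1.1)

lemma ncard_sum_le (A : ℕ) :
    {c : ι → ℕ | ∑ i, c i ≤ A}.ncard = (A + Fintype.card ι).choose (Fintype.card ι) := by
  have h := ncard_sum_le_eq_sum (ι := ι) (fun _ => True) A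
  simp only [and_true, ncard_sum_eq] at h
  rw [h, Nat.sum_range_multichoose]

/-- The functions with sum `n + k` and with a support of size `k`. -/
lemma ncard_sum_eq_support (n k : ℕ) :
    {c : ι → ℕ | ∑ i, c i = n + k ∧ (univ.filter fun i => c i ≠ 0).card = k}.ncard =
      (Fintype.card ι).choose k * k.multichoose n := by
  have h1 : {c : ι → ℕ | ∑ i, c i = n + k ∧ (univ.filter fun i => c i ≠ 0).card = k} =
      ((piAntidiag univ (n + k)).filter fun c => (univ.filter fun i => c i ≠ 0).card = k :
        Finset (ι → ℕ)) := by
    ext c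
    simp
  have h2 : ((powersetCard k (univ : Finset ι)).sigma fun S => piAntidiag S n).card =
      (Fintype.card ι).choose k * k.multichoose n := by
    rw [card_sigma, Finset.sum_congr rfl (g := fun _ => k.multichoose n), sum_const,
      card_powersetCard, card_univ, smul_eq_mul]
    intro S hS
    rw [card_piAntidiag, (mem_powersetCard.1 hS).2]
  rw [h1, Set.ncard_coe_finset, ← h2]
  symm
  have hsupp : ∀ (S : Finset ι) (c : ι → ℕ), (∀ i, c i ≠ 0 → i ∈ S) →
      (univ.filter fun i => c i + (if i ∈ S then 1 else 0) ≠ 0) = S := by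
    intro S c hc
    ext i
    simp only [mem_filter, mem_univ, true_and]
    by_cases hi : i ∈ S
    · simp [hi]
    · simp only [hi, if_false, add_zero, iff_false, not_not]
      by_contra h
      exact hi (hc i h)
  apply Finset.card_bij (fun p _ i => p.2 i + if i ∈ p.1 then 1 else 0)
  · rintro ⟨S, c⟩ h
    simp only [mem_sigma, mem_powersetCard, mem_piAntidiag] at h
    simp only [mem_filter, mem_piAntidiag, mem_univ, implies_true, and_true]
    rw [hsupp S c h.2.2]
    refine ⟨?_, h.1.2⟩
    rw [Finset.sum_add_distrib, ← h.2.1, ← Finset.sum_subset (Finset.subset_univ S)]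
    · congr 1
      simp [h.1.2]
    · intro i _ hi
      by_contra h3
      exact hi (h.2.2 i h3)
  · rintro ⟨S, c⟩ h ⟨T, e⟩ h' heq
    simp only [mem_sigma, mem_powersetCard, mem_piAntidiag] at h h'
    have hST : S = T := by
      rw [← hsupp S c h.2.2, ← hsupp T e h'.2.2]
      ext i
      have := congr_fun heq i
      simp only at this
      rw [mem_filter, mem_filter, this]
    subst hST
    simp only [Sigma.mk.injEq, heq_eq_eq, true_and]
    ext i
    have := congr_fun heq i
    simp only at this
    omega
  · intro c hc
    simp only [mem_filter, mem_piAntidiag, mem_univ, implies_true, and_true] at hc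
    set S := univ.filter fun i => c i ≠ 0 with hS
    have hmem : ∀ i, i ∈ S ↔ c i ≠ 0 := by intro i; simp [hS]
    have hc1 : (fun i => (c i - 1) + if i ∈ S then 1 else 0) = c := by
      ext i
      by_cases hi : i ∈ S
      · have := (hmem i).1 hi
        simp only [hi, if_true]; omega
      · have := (not_congr (hmem i)).1 hi
        simp only [hi, if_false]; omega
    refine ⟨⟨S, fun i => c i - 1⟩, ?_, hc1⟩
    simp only [mem_sigma, mem_powersetCard, mem_piAntidiag, subset_univ, true_and]
    refine ⟨hc.2, ?_, fun i hi => (hmem i).2 (by omega)⟩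
    have h3 := hc.1
    rw [← hc1, Finset.sum_add_distrib,
      ← Finset.sum_subset (Finset.subset_univ S) (f := fun i => c i - 1)] at h3
    · simp [hc.2] at h3
      exact h3
    · intro i _ hi
      have := (not_congr (hmem i)).1 hi
      omega

lemma ncard_sum_le_support (A k : ℕ) :
    {c : ι → ℕ | ∑ i, c i ≤ A ∧ (univ.filter fun i => c i ≠ 0).card = k}.ncard =
      (Fintype.card ι).choose k * A.choose k := by
  rcases Nat.lt_or_ge A k with h | h
  · rw [Nat.choose_eq_zero_of_lt h, mul_zero]
    refine (congrArg Set.ncard ?_).trans (Set.ncard_empty _)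
    ext c
    simp only [Set.mem_ofPred_eq, Set.mem_empty_iff_false, iff_false, not_and]
    have := card_support_le_sum c
    omega
  · obtain ⟨B, rfl⟩ := Nat.exists_eq_add_of_le' h
    rw [ncard_sum_le_eq_sum, show B + k + 1 = k + (B + 1) by ring, Finset.sum_range_add,
      Finset.sum_eq_zero, zero_add]
    · simp only [add_comm k, ncard_sum_eq_support]
      rw [← Finset.mul_sum, Nat.sum_range_multichoose]
    · intro x hx
      refine (congrArg Set.ncard ?_).trans (Set.ncard_empty _)
      ext c
      simp only [Set.mem_ofPred_eq, Set.mem_empty_iff_false, iff_false, not_and]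
      have := card_support_le_sum c
      have := mem_range.1 hx
      omega

/-- The functions with sum `n` and with a support of size `k`. -/
lemma ncard_sum_eq_support' {n k : ℕ} (hk : 1 ≤ k) (hn : 1 ≤ n) :
    {c : ι → ℕ | ∑ i, c i = n ∧ (univ.filter fun i => c i ≠ 0).card = k}.ncard =
      (Fintype.card ι).choose k * (n - 1).choose (k - 1) := by
  rcases Nat.lt_or_ge n k with h | h
  · rw [Nat.choose_eq_zero_of_lt (show n - 1 < k - 1 by omega), mul_zero]
    refine (congrArg Set.ncard ?_).trans (Set.ncard_empty _)
    ext c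
    simp only [Set.mem_ofPred_eq, Set.mem_empty_iff_false, iff_false, not_and]
    have := card_support_le_sum c
    omega
  · obtain ⟨B, rfl⟩ := Nat.exists_eq_add_of_le' h
    rw [ncard_sum_eq_support, Nat.multichoose_eq]
    congr 1
    rw [show k + B - 1 = B + k - 1 by omega]
    exact Nat.choose_symm_of_eq_add (by omega)

end

/-- The multinomial coefficient with lower entries `b 1, …, b n`, as a product of binomial
coefficients. -/
def multi (b : ℕ → ℕ) (n : ℕ) : ℕ :=
  ∏ i ∈ range n, (∑ j ∈ Icc 1 (i + 1), b j).choose (b (i + 1))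

lemma multi_succ (b : ℕ → ℕ) (n : ℕ) :
    multi b (n + 1) = multi b n * (∑ j ∈ Icc 1 (n + 1), b j).choose (b (n + 1)) :=
  Finset.prod_range_succ _ n

/-- The number of functions on a given set with values at most `n`, and with prescribed
multiplicities of the positive values. -/
lemma card_multiplicities {ι : Type*} [DecidableEq ι] (b : ℕ → ℕ) (n : ℕ) : ∀ S : Finset ι,
    {c : ι → ℕ | (∀ i, i ∉ S → c i = 0) ∧ (∀ i, c i ≤ n) ∧
      ∀ k ∈ Icc 1 n, (S.filter fun i => c i = k).card = b k}.ncard =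
      S.card.choose (∑ k ∈ Icc 1 n, b k) * multi b n := by
  induction n with
  | zero =>
    intro S
    simp only [multi, Finset.range_zero, Finset.prod_empty, mul_one]
    rw [show Icc 1 0 = (∅ : Finset ℕ) from rfl, Finset.sum_empty, Nat.choose_zero_right,
      Set.ncard_eq_one]
    refine ⟨0, ?_⟩
    ext c
    simp only [Nat.le_zero, notMem_empty, false_imp_iff, implies_true, and_true,
      Set.mem_ofPred_eq, Set.mem_singleton_iff]
    exact ⟨fun h => funext h.2, fun h => by subst h; simp⟩
  | succ n ih =>
    intro S
    have hfin : ∀ T : Finset ι, {c : ι → ℕ | (∀ i, i ∉ T → c i = 0) ∧ (∀ i, c i ≤ n) ∧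
        ∀ k ∈ Icc 1 n, (T.filter fun i => c i = k).card = b k}.Finite := by
      intro T
      apply Set.Finite.subset (s := ((fun f : T → Fin (n + 1) => fun i : ι =>
        if h : i ∈ T then ((f ⟨i, h⟩ : Fin (n + 1)) : ℕ) else 0) '' Set.univ))
        (Set.toFinite _)
      rintro c ⟨h1, h2, -⟩
      refine ⟨fun i => ⟨c i, Nat.lt_succ_of_le (h2 i)⟩, Set.mem_univ _, ?_⟩
      ext i
      by_cases hi : i ∈ T
      · simp [hi]
      · simp [hi, h1 i hi]
    -- the set where the value is `n + 1`, and the function outside of this set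
    have key : {c : ι → ℕ | (∀ i, i ∉ S → c i = 0) ∧ (∀ i, c i ≤ n + 1) ∧
        ∀ k ∈ Icc 1 (n + 1), (S.filter fun i => c i = k).card = b k}.ncard =
        ((powersetCard (b (n + 1)) S).sigma fun T => (hfin (S \ T)).toFinset).card := by
      rw [← Set.ncard_coe_finset]
      symm
      apply Set.ncard_congr (fun p _ i => if i ∈ p.1 then n + 1 else p.2 i)
      · rintro ⟨T, c⟩ h
        simp only [mem_coe, mem_sigma, mem_powersetCard, Set.Finite.mem_toFinset,
          Set.mem_ofPred_eq] at h
        obtain ⟨⟨h1, h2⟩, h3, h4, h5⟩ := h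
        refine ⟨fun i hi => ?_, fun i => ?_, fun k hk => ?_⟩
        · simp only
          rw [if_neg fun h => hi (h1 h)]
          exact h3 i fun h => hi (mem_sdiff.1 h).1
        · simp only
          split_ifs
          · exact le_rfl
          · exact (h4 i).trans (Nat.le_succ n)
        · rw [mem_Icc] at hk
          rcases eq_or_lt_of_le hk.2 with rfl | hk2
          · rw [← h2]
            congr 1
            ext i
            simp only [mem_filter]
            constructor
            · rintro ⟨-, h⟩
              by_contra hi
              rw [if_neg hi] at h
              have := h4 i
              omega
            · exact fun h => ⟨h1 h, if_pos h⟩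
          · rw [← h5 k (by rw [mem_Icc]; omega)]
            congr 1
            ext i
            simp only [mem_filter, mem_sdiff]
            by_cases hi : i ∈ T
            · simp only [hi, if_true]
              constructor
              · rintro ⟨_, h⟩; omega
              · rintro ⟨h, _⟩; exact absurd trivial h.2
            · simp [hi]
      · rintro ⟨T, c⟩ ⟨U, e⟩ h h' heq
        simp only [mem_coe, mem_sigma, mem_powersetCard, Set.Finite.mem_toFinset,
          Set.mem_ofPred_eq] at h h'
        have hTU : T = U := by
          ext i
          have h1 := congr_fun heq i
          have h2 := h.2.2.1 i
          have h3 := h'.2.2.1 i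
          simp only at h1
          by_cases hT : i ∈ T <;> by_cases hU : i ∈ U <;> simp [hT, hU] at h1 ⊢ <;> omega
        subst hTU
        simp only [Sigma.mk.injEq, heq_eq_eq, true_and]
        ext i
        have h1 := congr_fun heq i
        simp only at h1
        by_cases hT : i ∈ T
        · rw [h.2.1 i (by simp [hT]), h'.2.1 i (by simp [hT])]
        · rwa [if_neg hT, if_neg hT] at h1
      · rintro c ⟨h1, h2, h3⟩
        have hc : (fun i => if i ∈ S.filter (fun i => c i = n + 1) then n + 1 else
            (if c i = n + 1 then 0 else c i)) = c := by
          ext i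
          by_cases h : c i = n + 1
          · have : i ∈ S := by
              by_contra hi
              have := h1 i hi
              omega
            simp [h, this]
          · simp [h]
        refine ⟨⟨S.filter fun i => c i = n + 1, fun i => if c i = n + 1 then 0 else c i⟩, ?_, hc⟩
        simp only [mem_coe, mem_sigma, mem_powersetCard, Set.Finite.mem_toFinset,
          Set.mem_ofPred_eq, filter_subset, true_and]
        refine ⟨h3 _ (by rw [mem_Icc]; omega), fun i hi => ?_, fun i => ?_, fun k hk => ?_⟩
        · split_ifs with h
          · rfl
          · apply h1
            intro hS
            exact hi (by simp [hS, h])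
        · have := h2 i
          split_ifs <;> omega
        · rw [mem_Icc] at hk
          rw [← h3 k (by rw [mem_Icc]; omega)]
          congr 1
          ext i
          simp only [mem_filter, mem_sdiff]
          by_cases h : c i = n + 1
          · simp only [h, if_true]
            constructor
            · rintro ⟨_, h⟩; omega
            · rintro ⟨_, h⟩; omega
          · simp [h]
    rw [key, card_sigma, Finset.sum_congr rfl (g := fun _ => (S.card - b (n + 1)).choose
      (∑ k ∈ Icc 1 n, b k) * multi b n), sum_const, card_powersetCard, smul_eq_mul, multi_succ]
    · have hsum : ∑ j ∈ Icc 1 (n + 1), b j = ∑ j ∈ Icc 1 n, b j + b (n + 1) :=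
        Finset.sum_Icc_succ_top (by omega) _
      rw [hsum]
      have := Nat.choose_mul (n := S.card) (Nat.le_add_left (b (n + 1)) (∑ j ∈ Icc 1 n, b j))
      rw [Nat.add_sub_cancel] at this
      rw [← mul_assoc, ← this]
      ring
    · intro T hT
      rw [mem_powersetCard] at hT
      rw [← Set.ncard_coe_finset, Set.Finite.coe_toFinset, ih, card_sdiff_of_subset hT.1, hT.2]

/-! ### Counting the codes of the fixed points -/

/-- All the sizes that occur with positive multiplicity are divisible by `m`. -/
def DivSizes (m : ℕ) (β : ℕ → ℕ) : Prop := ∀ k, β k ≠ 0 → m ∣ k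

section
variable {d n K m : ℕ}

/-- Sets of functions that correspond under multiplication by `m` have the same size. -/
lemma ncard_image_mul {ι : Type*} (hm : 1 ≤ m) (S T : Set (ι → ℕ))
    (h1 : ∀ c ∈ S, ∀ i, m ∣ c i) (h2 : ∀ c, (fun i => m * c i) ∈ S ↔ c ∈ T) :
    S.ncard = T.ncard := by
  rw [← Set.ncard_image_of_injective T (f := fun c i => m * c i)]
  · congr 1
    ext c
    constructor
    · intro hc
      choose e he using h1 c hc
      have : c = fun i => m * e i := funext he
      subst this
      exact ⟨e, (h2 e).1 hc, rfl⟩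
    · rintro ⟨e, he, rfl⟩
      exact (h2 e).2 he
  · intro c e h
    ext i
    exact Nat.eq_of_mul_eq_mul_left hm (congr_fun h i)

lemma codeCount_mul (hm : 1 ≤ m) (c : Fin K → ℕ) (i : ℕ) :
    codeCount d (m * n) K (fun j => m * c j) (m * i) = codeCount d n K c i := by
  have h1 : ∀ j, m * c j = m * i ↔ c j = i := fun j => Nat.mul_right_inj (by omega)
  have h2 : m * n - d * ∑ j, m * c j = m * (n - d * ∑ j, c j) := by
    rw [← Finset.mul_sum, Nat.mul_sub]
    congr 1
    ring
  simp only [codeCount, h1, h2, Nat.mul_right_inj (show m ≠ 0 by omega), mul_eq_zero,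
    show m ≠ 0 by omega, false_or]

lemma valueCount_mul {ι : Type*} [Fintype ι] (hm : 1 ≤ m) (c : ι → ℕ) (i : ℕ) :
    valueCount (fun j => m * c j) (m * i) = valueCount c i := by
  have h1 : ∀ j, m * c j = m * i ↔ c j = i := fun j => Nat.mul_right_inj (by omega)
  simp only [valueCount, h1, mul_eq_zero, show m ≠ 0 by omega, false_or]

/-- Dividing all entries of the codes by `m`. -/
lemma ncard_codes (hm : 1 ≤ m) (hd : 1 ≤ d) (R : (ℕ → ℕ) → Prop) :
    {c : Fin K → ℕ | d * ∑ i, c i ≤ m * n ∧ DivSizes m (codeCount d (m * n) K c) ∧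
      R fun i => codeCount d (m * n) K c (m * i)}.ncard =
    {c : Fin K → ℕ | d * ∑ i, c i ≤ n ∧ R (codeCount d n K c)}.ncard := by
  apply ncard_image_mul hm
  · rintro c ⟨-, h, -⟩ i
    by_cases h0 : c i = 0
    · rw [h0]; exact dvd_zero m
    · apply h
      rw [codeCount, if_neg h0]
      have : 0 < (univ.filter fun j => c j = c i).card :=
        Finset.card_pos.2 ⟨i, by simp⟩
      have := Nat.mul_pos hd this
      omega
  · intro c
    simp only [Set.mem_ofPred_eq, codeCount_mul hm]
    have h1 : d * ∑ i, m * c i ≤ m * n ↔ d * ∑ i, c i ≤ n := by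
      rw [← Finset.mul_sum, mul_left_comm]
      exact Nat.mul_le_mul_left_iff hm
    rw [h1]
    refine and_congr_right fun h2 => ?_
    refine and_iff_right ?_
    intro k hk
    rw [codeCount] at hk
    split_ifs at hk with h3 h4
    · exact absurd rfl hk
    · rw [← h4, ← Finset.mul_sum, mul_left_comm, ← Nat.mul_sub]
      exact dvd_mul_right _ _
    · have h5 : (univ.filter fun i => m * c i = k).card ≠ 0 := by
        intro h; rw [h] at hk; simp at hk
      obtain ⟨i, hi⟩ := Finset.card_pos.1 (Nat.pos_of_ne_zero h5)
      rw [mem_filter] at hi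
      exact ⟨_, hi.2.symm⟩

/-- Dividing all values of the functions by `m`. -/
lemma ncard_values {ι : Type*} [Fintype ι] (hm : 1 ≤ m) (R : (ℕ → ℕ) → Prop) :
    {c : ι → ℕ | ∑ i, c i = m * n ∧ DivSizes m (valueCount c) ∧
      R fun i => valueCount c (m * i)}.ncard =
    {c : ι → ℕ | ∑ i, c i = n ∧ R (valueCount c)}.ncard := by
  apply ncard_image_mul hm
  · rintro c ⟨-, h, -⟩ i
    by_cases h0 : c i = 0
    · rw [h0]; exact dvd_zero m
    · apply h
      rw [valueCount, if_neg h0, ← Nat.pos_iff_ne_zero]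
      exact Finset.card_pos.2 ⟨i, by simp⟩
  · intro c
    simp only [Set.mem_ofPred_eq, valueCount_mul hm]
    have h1 : ∑ i, m * c i = m * n ↔ ∑ i, c i = n := by
      rw [← Finset.mul_sum]
      exact Nat.mul_right_inj (by omega)
    rw [h1]
    refine and_congr_right fun h2 => ?_
    refine and_iff_right ?_
    intro k hk
    rw [valueCount] at hk
    split_ifs at hk with h3
    · exact absurd rfl hk
    · obtain ⟨i, hi⟩ := Finset.card_pos.1 (Nat.pos_of_ne_zero hk)
      rw [mem_filter] at hi
      exact ⟨_, hi.2.symm⟩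

lemma sum_valueCount {ι : Type*} [Fintype ι] (c : ι → ℕ) (hc : ∀ i, c i ≤ n) :
    ∑ k ∈ Icc 1 n, valueCount c k = (univ.filter fun i => c i ≠ 0).card := by
  rw [Finset.card_eq_sum_card_fiberwise (f := c) (t := Icc 1 n)]
  · apply Finset.sum_congr rfl
    intro k hk
    rw [mem_Icc] at hk
    rw [valueCount, if_neg (by omega), filter_filter]
    congr 1
    ext i
    simp only [mem_filter, mem_univ, true_and]
    omega
  · intro i hi
    have : c i ≠ 0 := by simpa using hi
    have := hc i
    simp only [coe_Icc, Set.mem_Icc]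
    omega

lemma codeCount_eq (c : Fin K → ℕ) {k : ℕ} (hk : k ≠ 0) :
    codeCount d n K c k = d * valueCount c k + if n - d * ∑ i, c i = k then 1 else 0 := by
  rw [codeCount, valueCount, if_neg hk, if_neg hk]

lemma sum_codeCount (hd : 1 ≤ d) (c : Fin K → ℕ) (hc : d * ∑ i, c i ≤ n) :
    ∑ k ∈ Icc 1 n, codeCount d n K c k =
      d * (univ.filter fun i => c i ≠ 0).card + if d * ∑ i, c i = n then 0 else 1 := by
  rw [Finset.sum_congr rfl fun k hk => codeCount_eq c (by rw [mem_Icc] at hk; omega),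
    Finset.sum_add_distrib, ← Finset.mul_sum, sum_valueCount]
  · congr 1
    rw [Finset.sum_ite_eq]
    simp only [mem_Icc]
    split_ifs <;> omega
  · intro i
    have h1 := Finset.single_le_sum (f := c) (fun _ _ => Nat.zero_le _) (mem_univ i)
    have h2 := Nat.le_mul_of_pos_left (∑ i, c i) hd
    omega

lemma ncard_codes_all (hd : 1 ≤ d) :
    {c : Fin K → ℕ | d * ∑ i, c i ≤ n}.ncard = (n / d + K).choose K := by
  have h : ∀ c : Fin K → ℕ, d * ∑ i, c i ≤ n ↔ ∑ i, c i ≤ n / d := fun c => by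
    rw [Nat.le_div_iff_mul_le hd, mul_comm]
  simp only [h]
  rw [ncard_sum_le, Fintype.card_fin]

/-- Codes with a number of blocks congruent to `1`: there is one block besides the orbits of `d` blocks. -/
lemma ncard_codes_blocks_one (hd : 2 ≤ d) (hn : 1 ≤ n) (k : ℕ) :
    {c : Fin K → ℕ | d * ∑ i, c i ≤ n ∧ ∑ j ∈ Icc 1 n, codeCount d n K c j = d * k + 1}.ncard =
      K.choose k * ((n - 1) / d).choose k := by
  have h := ncard_sum_le_support (ι := Fin K) ((n - 1) / d) k
  rw [Fintype.card_fin] at h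
  rw [← h]
  congr 1
  ext c
  simp only [Set.mem_ofPred_eq]
  rw [Nat.le_div_iff_mul_le (by omega), mul_comm]
  constructor
  · rintro ⟨h1, h2⟩
    rw [sum_codeCount (by omega) c (by rwa [mul_comm])] at h2
    rw [mul_comm] at h1
    split_ifs at h2 with h3
    · exfalso
      have := congrArg (· % d) h2
      simp only [add_zero, Nat.mul_mod_right, Nat.mul_add_mod, Nat.mod_eq_of_lt
        (show 1 < d by omega)] at this
      omega
    · refine ⟨by rw [mul_comm] at h3; rw [mul_comm] at h1; omega, ?_⟩
      exact Nat.eq_of_mul_eq_mul_left (show 0 < d by omega) (by omega)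
  · rintro ⟨h1, h2⟩
    refine ⟨by omega, ?_⟩
    rw [sum_codeCount (by omega) c (by rw [mul_comm]; omega), h2, if_neg]
    rw [mul_comm]; omega

/-- Codes with a number of blocks divisible by `d`: there is no block besides the orbits of `d` blocks,
so that the entries of the code have sum `n / d`. -/
lemma ncard_codes_blocks_zero (hd : 2 ≤ d) (hn : 1 ≤ n) {k : ℕ} (hk : 1 ≤ k) :
    {c : Fin K → ℕ | d * ∑ i, c i ≤ n ∧ ∑ j ∈ Icc 1 n, codeCount d n K c j = d * k}.ncard =
      if d ∣ n then K.choose k * (n / d - 1).choose (k - 1) else 0 := by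
  have key : {c : Fin K → ℕ | d * ∑ i, c i ≤ n ∧ ∑ j ∈ Icc 1 n, codeCount d n K c j = d * k} =
      {c : Fin K → ℕ | d * ∑ i, c i = n ∧ (univ.filter fun i => c i ≠ 0).card = k} := by
    ext c
    simp only [Set.mem_ofPred_eq]
    constructor
    · rintro ⟨h1, h2⟩
      rw [sum_codeCount (by omega) c h1] at h2
      split_ifs at h2 with h3
      · exact ⟨h3, Nat.eq_of_mul_eq_mul_left (show 0 < d by omega) (by omega)⟩
      · exfalso
        have := congrArg (· % d) h2
        simp only [Nat.mul_mod_right, Nat.mul_add_mod, Nat.mod_eq_of_lt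
          (show 1 < d by omega)] at this
        omega
    · rintro ⟨h1, h2⟩
      refine ⟨h1.le, ?_⟩
      rw [sum_codeCount (by omega) c h1.le, h2, if_pos h1, add_zero]
  rw [key]
  split_ifs with h
  · obtain ⟨a, rfl⟩ := h
    have ha : 1 ≤ a := by
      rcases Nat.eq_zero_or_pos a with rfl | h
      · omega
      · exact h
    have h := ncard_sum_eq_support' (ι := Fin K) hk ha
    rw [Fintype.card_fin] at h
    rw [Nat.mul_div_cancel_left _ (by omega), ← h]
    congr 1
    ext c
    simp only [Set.mem_ofPred_eq, Nat.mul_right_inj (show d ≠ 0 by omega)]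
  · refine (congrArg Set.ncard ?_).trans (Set.ncard_empty _)
    ext c
    simp only [Set.mem_ofPred_eq, Set.mem_empty_iff_false, iff_false, not_and]
    intro h1
    exact absurd ⟨_, h1.symm⟩ h

lemma ncard_codes_blocks_other (hd : 2 ≤ d) {B : ℕ} (hB : 2 ≤ B % d) :
    {c : Fin K → ℕ | d * ∑ i, c i ≤ n ∧ ∑ j ∈ Icc 1 n, codeCount d n K c j = B}.ncard = 0 := by
  refine (congrArg Set.ncard ?_).trans (Set.ncard_empty _)
  ext c
  simp only [Set.mem_ofPred_eq, Set.mem_empty_iff_false, iff_false, not_and]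
  rintro h1 rfl
  rw [sum_codeCount (by omega) c h1, Nat.mul_add_mod] at hB
  split_ifs at hB
  · simp at hB
  · have := Nat.mod_le 1 d
    omega

lemma ncard_multiplicities {ι : Type*} [Fintype ι] [DecidableEq ι] (b : ℕ → ℕ) (n : ℕ) :
    {c : ι → ℕ | (∀ i, c i ≤ n) ∧ ∀ k ∈ Icc 1 n, valueCount c k = b k}.ncard =
      (Fintype.card ι).choose (∑ k ∈ Icc 1 n, b k) * multi b n := by
  rw [← Finset.card_univ, ← card_multiplicities b n univ]
  congr 1
  ext c
  simp only [Set.mem_ofPred_eq, mem_univ, not_true_eq_false, false_imp_iff, implies_true,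
    true_and]
  refine and_congr_right fun _ => forall₂_congr fun k hk => ?_
  rw [valueCount, if_neg]
  rw [mem_Icc] at hk
  omega

lemma sum_eq_sum_valueCount {ι : Type*} [Fintype ι] (c : ι → ℕ) (hc : ∀ i, c i ≤ n) :
    ∑ i, c i = ∑ k ∈ Icc 1 n, k * valueCount c k := by
  have h1 : ∑ i, c i = ∑ i ∈ univ.filter (fun i => c i ≠ 0), c i := by
    rw [Finset.sum_filter_ne_zero]
  rw [h1, ← Finset.sum_fiberwise_of_maps_to (s := univ.filter fun i => c i ≠ 0) (g := c)
    (t := Icc 1 n)]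
  · apply Finset.sum_congr rfl
    intro k hk
    rw [mem_Icc] at hk
    rw [Finset.sum_congr rfl (g := fun _ => k), sum_const, smul_eq_mul, mul_comm, valueCount,
      if_neg (by omega), filter_filter]
    · congr 2
      ext i
      simp only [mem_filter, mem_univ, true_and]
      omega
    · intro i hi
      exact (mem_filter.1 hi).2
  · intro i hi
    have h2 := (mem_filter.1 hi).2
    have := hc i
    rw [mem_Icc]
    omega

lemma ncard_values_type {ι : Type*} [Fintype ι] [DecidableEq ι] {b : ℕ → ℕ}
    (hb : ∑ i ∈ Icc 1 n, i * b i = n) :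
    {c : ι → ℕ | ∑ i, c i = n ∧ ∀ k ∈ Icc 1 n, valueCount c k = b k}.ncard =
      (Fintype.card ι).choose (∑ k ∈ Icc 1 n, b k) * multi b n := by
  rw [← ncard_multiplicities]
  congr 1
  ext c
  simp only [Set.mem_ofPred_eq]
  refine and_congr_left fun h => ⟨fun h1 i => ?_, fun h1 => ?_⟩
  · rw [← h1]
    exact Finset.single_le_sum (f := c) (fun _ _ => Nat.zero_le _) (mem_univ i)
  · rw [sum_eq_sum_valueCount c h1]
    exact (Finset.sum_congr rfl fun k hk => by rw [h k hk]).trans hb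

/-- The number of codes of the fixed points with a given block type: all multiplicities are
divisible by `d`, except that one of them may have the remainder `1`. -/
lemma ncard_codes_type (hd : 2 ≤ d) {b : ℕ → ℕ} (hb : ∑ i ∈ Icc 1 n, i * b i = n) :
    {c : Fin K → ℕ | d * ∑ i, c i ≤ n ∧ ∀ i ∈ Icc 1 n, codeCount d n K c i = b i}.ncard =
      if ∑ i ∈ Icc 1 n, b i % d ≤ 1 then
        K.choose (∑ i ∈ Icc 1 n, b i / d) * multi (fun i => b i / d) n else 0 := by
  have hmod : ∀ (c : Fin K → ℕ), ∀ i ∈ Icc 1 n, codeCount d n K c i = b i →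
      b i % d = (if n - d * ∑ j, c j = i then 1 else 0) ∧ b i / d = valueCount c i := by
    intro c i hi h
    rw [codeCount_eq c (by rw [mem_Icc] at hi; omega)] at h
    rw [← h, Nat.mul_add_mod, Nat.mul_add_div (by omega)]
    split_ifs
    · rw [Nat.mod_eq_of_lt (by omega), Nat.div_eq_of_lt (by omega)]; simp
    · simp
  split_ifs with h
  · have h0 := ncard_multiplicities (ι := Fin K) (fun i => b i / d) n
    rw [Fintype.card_fin] at h0
    rw [← h0]
    congr 1
    ext c
    simp only [Set.mem_ofPred_eq]
    constructor
    · rintro ⟨h1, h2⟩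
      refine ⟨fun i => ?_, fun k hk => (hmod c k hk (h2 k hk)).2.symm⟩
      have h3 := Finset.single_le_sum (f := c) (fun _ _ => Nat.zero_le _) (mem_univ i)
      have h4 := Nat.le_mul_of_pos_left (∑ i, c i) (show 0 < d by omega)
      omega
    · rintro ⟨h1, h2⟩
      have h3 : d * ∑ i, c i + ∑ i ∈ Icc 1 n, i * (b i % d) = n := by
        rw [sum_eq_sum_valueCount c h1, Finset.mul_sum, ← Finset.sum_add_distrib]
        refine (Finset.sum_congr rfl fun k hk => ?_).trans hb
        rw [h2 k hk, mul_left_comm, ← mul_add, Nat.div_add_mod]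
      refine ⟨by omega, fun i hi => ?_⟩
      have hi' := mem_Icc.1 hi
      rw [codeCount_eq c (by omega), h2 i hi,
        show n - d * ∑ i, c i = ∑ i ∈ Icc 1 n, i * (b i % d) by omega]
      have h4 : (if ∑ i ∈ Icc 1 n, i * (b i % d) = i then 1 else 0) = b i % d := by
        by_cases h5 : ∃ j ∈ Icc 1 n, b j % d ≠ 0
        · obtain ⟨j, hj, hj0⟩ := h5
          have h6 := Finset.add_sum_erase (Icc 1 n) (fun i => b i % d) hj
          have h7 : ∀ k ∈ (Icc 1 n).erase j, b k % d = 0 := by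
            rw [← Finset.sum_eq_zero_iff]; omega
          rw [← Finset.add_sum_erase _ _ hj, Finset.sum_eq_zero (s := (Icc 1 n).erase j)
            fun k hk => by rw [h7 k hk, mul_zero]]
          have h8 : b j % d = 1 := by omega
          by_cases hij : j = i
          · subst hij; rw [if_pos]; · exact h8.symm
            rw [h8]; ring
          · rw [if_neg, h7 i (mem_erase.2 ⟨Ne.symm hij, hi⟩)]
            rw [h8]; omega
        · push Not at h5
          rw [Finset.sum_eq_zero fun k hk => by rw [h5 k hk, mul_zero], h5 i hi, if_neg (by omega)]
      rw [h4, Nat.div_add_mod]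
  · refine (congrArg Set.ncard ?_).trans (Set.ncard_empty _)
    ext c
    simp only [Set.mem_ofPred_eq, Set.mem_empty_iff_false, iff_false, not_and]
    intro h1 h2
    apply h
    rw [Finset.sum_congr rfl fun i hi => (hmod c i hi (h2 i hi)).1, Finset.sum_ite_eq]
    split_ifs <;> omega

end

/-! ### The rank of an `m`-divisible non-crossing partition -/

section
variable {m n : ℕ}

/-- Each number up to the size of `B` is the size of an initial segment of `B`. -/
lemma exists_card_filter_le (B : Finset ℕ) {j : ℕ} (hj : j ≤ B.card) :
    ∃ t, (B.filter (· < t)).card = j := by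
  have key : ∀ T : ℕ, ∀ j ≤ (B.filter (· < T)).card, ∃ t, (B.filter (· < t)).card = j := by
    intro T
    induction T with
    | zero => intro j hj; exact ⟨0, by simp at hj ⊢; omega⟩
    | succ T ih =>
      intro j hj
      by_cases h : j ≤ (B.filter (· < T)).card
      · exact ih j h
      · refine ⟨T + 1, ?_⟩
        have : B.filter (· < T + 1) ⊆ insert T (B.filter (· < T)) := by
          intro x hx
          simp only [mem_filter, mem_insert] at hx ⊢
          rcases eq_or_ne x T with h | h
          · exact Or.inl h
          · exact Or.inr ⟨hx.1, by omega⟩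
        have h1 := card_le_card this
        have h2 := card_insert_le T (B.filter (· < T))
        omega
  apply key (B.sup id + 1)
  rwa [filter_true_of_mem]
  intro x hx
  exact Nat.lt_succ_of_le (Finset.le_sup (f := id) hx)

/-- The partition that arises from `π` by cutting the block `B` before `t`. -/
def cutBlock {s : Finset ℕ} (π : Finpartition s) (B : Finset ℕ) (t : ℕ)
    (h1 : B.filter (· < t) ≠ ∅) (h2 : B.filter (¬ · < t) ≠ ∅) : Finpartition s :=
  π.bind fun A hA =>
    if h : A = B then
      (Finpartition.indiscrete h1).extend h2 (disjoint_filter_filter_not B B _)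
        (by rw [h]; exact filter_union_filter_not_eq _ B)
    else Finpartition.indiscrete (π.ne_bot hA)

lemma mem_cutBlock {s : Finset ℕ} {π : Finpartition s} {B : Finset ℕ} {t : ℕ}
    {h1 : B.filter (· < t) ≠ ∅} {h2 : B.filter (¬ · < t) ≠ ∅} (hB : B ∈ π.parts) {A : Finset ℕ} :
    A ∈ (cutBlock π B t h1 h2).parts ↔
      (A ∈ π.parts ∧ A ≠ B) ∨ A = B.filter (· < t) ∨ A = B.filter (¬ · < t) := by
  rw [cutBlock, Finpartition.mem_bind]
  constructor
  · rintro ⟨C, hC, h⟩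
    split_ifs at h with hCB
    · rw [Finpartition.extend_parts, mem_insert, Finpartition.indiscrete_parts,
        mem_singleton] at h
      exact Or.inr h.symm
    · simp at h
      subst h
      exact Or.inl ⟨hC, hCB⟩
  · rintro (⟨hA, hAB⟩ | h)
    · exact ⟨A, hA, by rw [dif_neg hAB]; simp⟩
    · refine ⟨B, hB, ?_⟩
      rw [dif_pos rfl, Finpartition.extend_parts, mem_insert, Finpartition.indiscrete_parts,
        mem_singleton]
      exact h.symm

lemma card_cutBlock {s : Finset ℕ} {π : Finpartition s} {B : Finset ℕ} {t : ℕ}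
    {h1 : B.filter (· < t) ≠ ∅} {h2 : B.filter (¬ · < t) ≠ ∅} (hB : B ∈ π.parts) :
    (cutBlock π B t h1 h2).parts.card = π.parts.card + 1 := by
  have h : (cutBlock π B t h1 h2).parts =
      insert (B.filter (· < t)) (insert (B.filter (¬ · < t)) (π.parts.erase B)) := by
    ext A
    rw [mem_cutBlock hB]
    simp only [mem_insert, mem_erase]
    tauto
  have hne1 : B.filter (· < t) ∉ π.parts.erase B := by
    intro h
    rw [mem_erase] at h
    obtain ⟨x, hx⟩ := Finset.nonempty_iff_ne_empty.2 h1
    exact h.1 (π.eq_of_mem_parts h.2 hB hx (mem_filter.1 hx).1)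
  have hne2 : B.filter (¬ · < t) ∉ π.parts.erase B := by
    intro h
    rw [mem_erase] at h
    obtain ⟨x, hx⟩ := Finset.nonempty_iff_ne_empty.2 h2
    exact h.1 (π.eq_of_mem_parts h.2 hB hx (mem_filter.1 hx).1)
  rw [h, card_insert_of_notMem, card_insert_of_notMem hne2, card_erase_of_mem hB]
  · have := card_pos.2 ⟨B, hB⟩
    omega
  · rw [mem_insert, not_or]
    refine ⟨fun h => ?_, hne1⟩
    obtain ⟨x, hx⟩ := Finset.nonempty_iff_ne_empty.2 h1
    have h3 := mem_filter.1 hx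
    rw [h] at hx
    exact (mem_filter.1 hx).2 h3.2

lemma isNonCrossing_cutBlock {N : ℕ} {π : Finpartition (Icc 1 N)} (hπ : IsNonCrossing π)
    {B : Finset ℕ} {t : ℕ} {h1 : B.filter (· < t) ≠ ∅} {h2 : B.filter (¬ · < t) ≠ ∅}
    (hB : B ∈ π.parts) : IsNonCrossing (cutBlock π B t h1 h2) := by
  intro A hA A' hA' hne a ha b hb c hc d hd hlt
  rw [mem_cutBlock hB] at hA hA'
  rcases hA with ⟨hA, hAB⟩ | hA
  · rcases hA' with ⟨hA', hAB'⟩ | hA'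
    · exact hπ A hA A' hA' hne a ha b hb c hc d hd hlt
    · have hsub : A' ⊆ B := by rcases hA' with rfl | rfl <;> exact filter_subset _ _
      exact hπ A hA B hB hAB a ha b (hsub hb) c hc d (hsub hd) hlt
  · have hsub : A ⊆ B := by rcases hA with rfl | rfl <;> exact filter_subset _ _
    rcases hA' with ⟨hA', hAB'⟩ | hA'
    · exact hπ B hB A' hA' (Ne.symm hAB') a (hsub ha) b hb c (hsub hc) d hd hlt
    · rcases hA with rfl | rfl <;> rcases hA' with rfl | rfl <;>
        simp only [mem_filter] at ha hb hc hd
      · exact hne rfl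
      · omega
      · omega
      · exact hne rfl

/-- A proper refinement has more blocks. -/
lemma card_lt_of_lt {s : Finset ℕ} {π σ : Finpartition s} (h : σ < π) :
    π.parts.card < σ.parts.card := by
  refine lt_of_le_of_ne (Finpartition.card_mono h.le) fun hcard => ?_
  -- a surjection between sets of equal size is injective, so each block of `π` is a block of `σ`
  have hle : ∀ C ∈ σ.parts, ∃ A, A ∈ π.parts ∧ C ⊆ A := fun C hC => h.le hC
  choose! f hf using hle
  have hsurj : Set.SurjOn f σ.parts π.parts := by
    intro A hA
    obtain ⟨C, hC, hCA⟩ := Finpartition.exists_le_of_le h.le hA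
    refine ⟨C, hC, ?_⟩
    obtain ⟨x, hx⟩ := σ.nonempty_of_mem_parts hC
    exact π.eq_of_mem_parts (hf C hC).1 hA ((hf C hC).2 hx) (hCA hx)
  have hinj : Set.InjOn f σ.parts :=
    Finset.injOn_of_surjOn_of_card_le f (fun C hC => (hf C hC).1) hsurj hcard.ge
  apply h.not_ge
  intro A hA
  obtain ⟨C, hC, rfl⟩ := hsurj hA
  refine ⟨C, hC, fun x hx => ?_⟩
  obtain ⟨D, hD, hxD⟩ := σ.exists_mem ((π.le hA) hx)
  have hDC : f D = f C := π.eq_of_mem_parts (hf D hD).1 hA ((hf D hD).2 hxD) hx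
  rwa [← hinj hD hC hDC]

lemma mul_card_parts_le {π : Finpartition (Icc 1 (m * n))} (hπ : IsDivisible m π) :
    m * π.parts.card ≤ m * n := by
  have h := π.sum_card_parts
  rw [Nat.card_Icc, Nat.add_sub_cancel] at h
  refine le_trans ?_ h.le
  rw [mul_comm, ← smul_eq_mul]
  apply Finset.card_nsmul_le_sum
  intro B hB
  exact Nat.le_of_dvd (Finset.card_pos.2 (π.nonempty_of_mem_parts hB)) (hπ B hB)

lemma card_parts_le (hm : 1 ≤ m) {π : Finpartition (Icc 1 (m * n))} (hπ : IsDivisible m π) :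
    π.parts.card ≤ n :=
  Nat.le_of_mul_le_mul_left (mul_card_parts_le hπ) hm

lemma card_parts_eq_iff (hm : 1 ≤ m) {π : Finpartition (Icc 1 (m * n))} (hπ : IsDivisible m π) :
    π.parts.card = n ↔ ∀ B ∈ π.parts, B.card = m := by
  have h := π.sum_card_parts
  rw [Nat.card_Icc, Nat.add_sub_cancel] at h
  have hle : ∀ B ∈ π.parts, m ≤ B.card := fun B hB =>
    Nat.le_of_dvd (Finset.card_pos.2 (π.nonempty_of_mem_parts hB)) (hπ B hB)
  constructor
  · intro hc B hB
    have h2 := (Finset.sum_eq_sum_iff_of_le hle).1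
    rw [h, sum_const, smul_eq_mul, hc, mul_comm] at h2
    exact (h2 rfl B hB).symm
  · intro hc
    rw [Finset.sum_congr rfl hc, sum_const, smul_eq_mul, mul_comm] at h
    exact Nat.eq_of_mul_eq_mul_left hm h

/-- A partition that has a block larger than `m` is covered from below: cut off the first `m` points of
this block. -/
lemma exists_lt_of_card_lt (hm : 1 ≤ m) (π : DivNC m n) (h : π.1.parts.card < n) :
    ∃ σ : DivNC m n, σ < π ∧ σ.1.parts.card = π.1.parts.card + 1 := by
  obtain ⟨B, hB, hBm⟩ : ∃ B ∈ π.1.parts, B.card ≠ m := by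
    by_contra! hall
    exact h.ne ((card_parts_eq_iff hm π.2.2).2 hall)
  have hdiv := π.2.2 B hB
  have hle : m ≤ B.card := Nat.le_of_dvd (card_pos.2 (π.1.nonempty_of_mem_parts hB)) hdiv
  obtain ⟨t, ht⟩ := exists_card_filter_le B hle
  have hsum := Finset.card_filter_add_card_filter_not (s := B) (· < t)
  have h1 : B.filter (· < t) ≠ ∅ := by
    intro h; rw [h, card_empty] at ht; omega
  have h2 : B.filter (¬ · < t) ≠ ∅ := by
    intro h; rw [h, card_empty] at hsum; omega
  refine ⟨⟨cutBlock π.1 B t h1 h2, isNonCrossing_cutBlock π.2.1 hB, ?_⟩, ?_, card_cutBlock hB⟩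
  · intro A hA
    rcases (mem_cutBlock hB).1 hA with ⟨hA, -⟩ | rfl | rfl
    · exact π.2.2 A hA
    · rw [ht]
    · rw [← ht] at hdiv ⊢
      rw [← hsum] at hdiv
      exact (Nat.dvd_add_right dvd_rfl).1 hdiv
  · have hle : cutBlock π.1 B t h1 h2 ≤ π.1 := by
      intro A hA
      rcases (mem_cutBlock hB).1 hA with ⟨hA, -⟩ | rfl | rfl
      · exact ⟨A, hA, le_rfl⟩
      · exact ⟨B, hB, filter_subset _ _⟩
      · exact ⟨B, hB, filter_subset _ _⟩
    refine lt_of_le_of_ne hle fun heq => ?_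
    have h3 := card_cutBlock (h1 := h1) (h2 := h2) hB
    have h4 := congrArg (fun σ : DivNC m n => σ.1.parts.card) heq
    simp only at h4
    omega

/-- The poset of `m`-divisible non-crossing partitions is graded by `n` minus the number of
blocks. -/
theorem height_eq (hm : 1 ≤ m) (π : DivNC m n) :
    Order.height π = ((n - π.1.parts.card : ℕ) : ℕ∞) := by
  obtain ⟨j, hj⟩ : ∃ j, j = n - π.1.parts.card := ⟨_, rfl⟩
  rw [← hj]
  induction j generalizing π with
  | zero =>
    rw [Nat.cast_zero, Order.height_eq_zero]
    intro σ hσ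
    by_contra hns
    have h1 : σ.1 < π.1 := lt_of_le_not_ge hσ hns
    have h2 := card_lt_of_lt h1
    have h3 := card_parts_le hm σ.2.2
    omega
  | succ j ih =>
    apply le_antisymm
    · have key : ∀ i, ∀ σ : DivNC m n, n - σ.1.parts.card = i → Order.height σ ≤ (i : ℕ∞) := by
        intro i
        induction i using Nat.strong_induction_on with
        | _ i ih =>
          intro σ hσ
          rw [Order.height_le_coe_iff]
          intro τ hτ
          have h2 := card_lt_of_lt (show τ.1 < σ.1 from hτ)
          have h3 := card_parts_le hm τ.2.2
          refine (ih _ (by omega) τ rfl).trans_lt ?_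
          rw [Nat.cast_lt]
          omega
      exact key _ π hj.symm
    · obtain ⟨σ, hσ, hc⟩ := exists_lt_of_card_lt hm π (by omega)
      have h1 := Order.height_add_one_le hσ
      rw [ih σ (by omega)] at h1
      exact_mod_cast h1

lemma mem_divNCPlusRank (hm : 1 ≤ m) {s : ℕ} (hs : s ≤ n) (π : NCPlus (m * n)) :
    π ∈ divNCPlusRank m n s ↔ IsDivisible m π.1 ∧ π.1.parts.card = n - s := by
  constructor
  · rintro ⟨h, h1⟩
    rw [height_eq hm] at h1
    have h2 := card_parts_le hm h
    have h3 : n - π.1.parts.card = s := by exact_mod_cast h1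
    exact ⟨h, by omega⟩
  · rintro ⟨h, h1⟩
    refine ⟨h, ?_⟩
    rw [height_eq hm]
    simp only
    congr 1
    omega

end

/-! ### Gaussian polynomials -/

/-- The polynomial `[a]_q = 1 + q + ⋯ + q ^ (a - 1)`. -/
def qNum (a : ℕ) : ℤ[X] := ∑ i ∈ range a, X ^ i

/-- The polynomial `[a]_q!`. -/
def qFactorial (a : ℕ) : ℤ[X] := ∏ i ∈ range a, qNum (i + 1)

/-- The Gaussian polynomials, by Pascal's rule. -/
def gauss : ℕ → ℕ → ℤ[X]
  | _, 0 => 1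
  | 0, _ + 1 => 0
  | M + 1, k + 1 => gauss M k + X ^ (k + 1) * gauss M (k + 1)

@[simp] lemma gauss_zero (M : ℕ) : gauss M 0 = 1 := by cases M <;> rfl

lemma gauss_succ (M k : ℕ) :
    gauss (M + 1) (k + 1) = gauss M k + X ^ (k + 1) * gauss M (k + 1) := rfl

lemma gauss_eq_zero {M : ℕ} : ∀ {k : ℕ}, M < k → gauss M k = 0 := by
  induction M with
  | zero =>
    intro k hk
    obtain ⟨j, rfl⟩ : ∃ j, k = j + 1 := ⟨k - 1, by omega⟩
    rfl
  | succ M ih =>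
    intro k hk
    obtain ⟨j, rfl⟩ : ∃ j, k = j + 1 := ⟨k - 1, by omega⟩
    rw [gauss_succ, ih (by omega), ih (by omega), mul_zero, add_zero]

lemma qNum_succ (a : ℕ) : qNum (a + 1) = qNum a + X ^ a := Finset.sum_range_succ _ a

lemma qNum_add (a b : ℕ) : qNum (a + b) = qNum a + X ^ a * qNum b := by
  rw [qNum, Finset.sum_range_add, qNum, qNum, Finset.mul_sum]
  simp only [pow_add]

@[simp] lemma qNum_zero : qNum 0 = 0 := rfl

@[simp] lemma qNum_one : qNum 1 = 1 := by simp [qNum]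

lemma qNum_mul (a : ℕ) : qNum a * (1 - X) = 1 - X ^ a := geom_sum_mul_neg X a

lemma eval_one_qNum (a : ℕ) : (qNum a).eval 1 = a := by
  simp [qNum, Polynomial.eval_finsetSum]

lemma qNum_ne_zero {a : ℕ} (ha : 1 ≤ a) : qNum a ≠ 0 := by
  intro h
  have := eval_one_qNum a
  rw [h, Polynomial.eval_zero] at this
  exact absurd this.symm (by positivity)

lemma qFactorial_succ (a : ℕ) : qFactorial (a + 1) = qFactorial a * qNum (a + 1) :=
  Finset.prod_range_succ _ a

@[simp] lemma qFactorial_zero : qFactorial 0 = 1 := rfl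

lemma qFactorial_ne_zero (a : ℕ) : qFactorial a ≠ 0 :=
  Finset.prod_ne_zero_iff.2 fun i _ => qNum_ne_zero (by omega)

lemma gauss_self (M : ℕ) : gauss M M = 1 := by
  induction M with
  | zero => rfl
  | succ M ih => rw [gauss_succ, ih, gauss_eq_zero (by omega), mul_zero, add_zero]

lemma gauss_mul_qFactorial (j : ℕ) : ∀ k : ℕ,
    gauss (k + j) k * (qFactorial k * qFactorial j) = qFactorial (k + j) := by
  induction j with
  | zero => intro k; rw [add_zero, gauss_self, qFactorial_zero, mul_one, one_mul]
  | succ j ih =>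
    intro k
    induction k with
    | zero => simp
    | succ k ihk =>
      rw [show k + 1 + (j + 1) = (k + (j + 1)) + 1 by ring, gauss_succ, qFactorial_succ (k + _),
        ← ihk, show k + (j + 1) + 1 = (k + 1) + (j + 1) by ring, qNum_add (k + 1)]
      have := ih (k + 1)
      rw [show k + 1 + j = k + (j + 1) by ring, ← ihk] at this
      rw [qFactorial_succ j, qFactorial_succ k] at *
      linear_combination X ^ (k + 1) * qNum (j + 1) * this

lemma gauss_symm (k j : ℕ) : gauss (k + j) k = gauss (k + j) j := by
  have h1 := gauss_mul_qFactorial j k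
  have h2 := gauss_mul_qFactorial k j
  rw [add_comm j k, ← h1, mul_comm (qFactorial j)] at h2
  exact (mul_right_cancel₀ (mul_ne_zero (qFactorial_ne_zero k) (qFactorial_ne_zero j)) h2).symm

/-- The absorption identity. -/
lemma gauss_absorb (M k : ℕ) : gauss (M + 1) (k + 1) * qNum (k + 1) = qNum (M + 1) * gauss M k := by
  rcases Nat.lt_or_ge M k with h | h
  · rw [gauss_eq_zero h, gauss_eq_zero (by omega), mul_zero, zero_mul]
  · obtain ⟨j, rfl⟩ := Nat.exists_eq_add_of_le h
    have h1 := gauss_mul_qFactorial j (k + 1)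
    have h2 := gauss_mul_qFactorial j k
    rw [show k + 1 + j = k + j + 1 by ring, qFactorial_succ (k + j), ← h2, qFactorial_succ k] at h1
    apply mul_right_cancel₀ (mul_ne_zero (qFactorial_ne_zero k) (qFactorial_ne_zero j))
    linear_combination h1

/-- If an ideal contains two `q`-numbers, it contains the one of their greatest common divisor. -/
lemma qNum_gcd_mem {I : Ideal ℤ[X]} (a b : ℕ) (ha : qNum a ∈ I) (hb : qNum b ∈ I) :
    qNum (Nat.gcd a b) ∈ I := by
  induction a, b using Nat.gcd.induction with
  | H0 b => rwa [Nat.gcd_zero_left]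
  | H1 a b hpos ih =>
    rw [Nat.gcd_rec]
    refine ih ?_ ha
    have hmul : ∀ t, qNum (a * t) ∈ I := by
      intro t
      induction t with
      | zero => simp
      | succ t iht =>
        rw [Nat.mul_succ, qNum_add]
        exact I.add_mem iht (I.mul_mem_left _ ha)
    have h := qNum_add (b % a) (a * (b / a))
    rw [Nat.mod_add_div] at h
    rw [eq_sub_of_add_eq h.symm]
    exact I.sub_mem hb (I.mul_mem_left _ (hmul _))

/-! ### Values at roots of unity -/

section
variable {ω : ℂ} {d : ℕ}

lemma aeval_qNum (a : ℕ) : aeval ω (qNum a) = ∑ i ∈ range a, ω ^ i := by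
  simp [qNum]

lemma aeval_qNum_add (hω : ω ^ d = 1) (h0 : aeval ω (qNum d) = 0) (a t : ℕ) :
    aeval ω (qNum (d * t + a)) = aeval ω (qNum a) := by
  induction t with
  | zero => rw [mul_zero, zero_add]
  | succ t ih =>
    rw [show d * (t + 1) + a = d + (d * t + a) by ring, qNum_add, map_add, map_mul, map_pow,
      aeval_X, h0, hω, ih, one_mul, zero_add]

lemma aeval_qNum_order (hd : 2 ≤ d) (hω : IsPrimitiveRoot ω d) : aeval ω (qNum d) = 0 := by
  rw [aeval_qNum]
  exact hω.geom_sum_eq_zero (by omega)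

lemma aeval_qNum_ne_zero (hω : IsPrimitiveRoot ω d) {a : ℕ} (h1 : 1 ≤ a)
    (h2 : a < d) : aeval ω (qNum a) ≠ 0 := by
  intro h
  have h3 := congrArg (aeval ω) (qNum_mul a)
  rw [map_mul, h, zero_mul, map_sub, map_pow, map_one, aeval_X] at h3
  exact hω.pow_ne_one_of_pos_of_lt (by omega) h2 (sub_eq_zero.1 h3.symm).symm

lemma aeval_gauss_order (hd : 2 ≤ d) (hω : IsPrimitiveRoot ω d) {k : ℕ} (h1 : 1 ≤ k)
    (h2 : k < d) : aeval ω (gauss d k) = 0 := by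
  obtain ⟨M, rfl⟩ : ∃ M, d = M + 1 := ⟨d - 1, by omega⟩
  obtain ⟨j, rfl⟩ : ∃ j, k = j + 1 := ⟨k - 1, by omega⟩
  have h := congrArg (aeval ω) (gauss_absorb M j)
  rw [map_mul, map_mul, aeval_qNum_order hd hω, zero_mul] at h
  exact (mul_eq_zero.1 h).resolve_right (aeval_qNum_ne_zero hω h1 h2)

lemma aeval_gauss_add (hd : 2 ≤ d) (hω : IsPrimitiveRoot ω d) (M : ℕ) : ∀ k : ℕ,
    aeval ω (gauss (M + d) k) =
      aeval ω (gauss M k) + if d ≤ k then aeval ω (gauss M (k - d)) else 0 := by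
  induction M with
  | zero =>
    intro k
    rw [zero_add]
    rcases Nat.eq_zero_or_pos k with rfl | hk
    · simp; omega
    · rw [gauss_eq_zero hk, map_zero, zero_add]
      rcases lt_trichotomy k d with h | rfl | h
      · rw [aeval_gauss_order hd hω hk h, if_neg (by omega)]
      · simp [gauss_self]
      · rw [gauss_eq_zero h, map_zero, if_pos h.le, gauss_eq_zero (by omega), map_zero]
  | succ M ih =>
    intro k
    rcases Nat.eq_zero_or_pos k with rfl | hk
    · simp; omega
    · obtain ⟨j, rfl⟩ : ∃ j, k = j + 1 := ⟨k - 1, by omega⟩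
      rw [show M + 1 + d = M + d + 1 by ring, gauss_succ, gauss_succ, map_add, map_mul, ih, ih,
        map_add, map_mul, map_pow, aeval_X]
      rcases lt_trichotomy (j + 1) d with h | h | h
      · simp only [if_neg (show ¬ d ≤ j + 1 by omega), if_neg (show ¬ d ≤ j by omega)]
        ring
      · simp only [if_neg (show ¬ d ≤ j by omega), h,
          hω.pow_eq_one, Nat.sub_self, gauss_zero, map_one]
        ring
      · have hp : ω ^ (j + 1) = ω ^ (j - d + 1) := by
          rw [show j + 1 = d + (j - d + 1) by omega, pow_add, hω.pow_eq_one, one_mul]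
        simp only [if_pos (show d ≤ j by omega), if_pos (show d ≤ j + 1 by omega),
          show j + 1 - d = j - d + 1 by omega, gauss_succ, map_add, map_mul, map_pow, aeval_X, hp]
        ring

/-- The `q`-Lucas theorem. -/
theorem aeval_gauss_lucas (hd : 2 ≤ d) (hω : IsPrimitiveRoot ω d) (a : ℕ) {r t : ℕ} (hr : r < d)
    (ht : t < d) : ∀ k : ℕ, aeval ω (gauss (d * a + r) (d * k + t)) =
      (a.choose k : ℂ) * aeval ω (gauss r t) := by
  induction a with
  | zero =>
    intro k
    rcases Nat.eq_zero_or_pos k with rfl | hk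
    · simp
    · have : d ≤ d * k := Nat.le_mul_of_pos_right d hk
      rw [Nat.choose_eq_zero_of_lt hk, gauss_eq_zero (by omega)]
      simp
  | succ a ih =>
    intro k
    rw [show d * (a + 1) + r = d * a + r + d by ring, aeval_gauss_add hd hω, ih]
    rcases Nat.eq_zero_or_pos k with rfl | hk
    · rw [if_neg (by omega)]
      simp
    · obtain ⟨j, rfl⟩ : ∃ j, k = j + 1 := ⟨k - 1, by omega⟩
      have h1 : d * (j + 1) = d * j + d := by ring
      rw [if_pos (by omega), show d * (j + 1) + t - d = d * j + t by omega, ih,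
        Nat.choose_succ_succ]
      push_cast
      ring

lemma aeval_gauss_div (hd : 2 ≤ d) (hω : IsPrimitiveRoot ω d) (a k : ℕ) :
    aeval ω (gauss a k) = ((a / d).choose (k / d) : ℂ) * aeval ω (gauss (a % d) (k % d)) := by
  rw [← aeval_gauss_lucas hd hω _ (Nat.mod_lt _ (by omega)) (Nat.mod_lt _ (by omega)),
    Nat.div_add_mod, Nat.div_add_mod]

lemma eval_one_gauss (M : ℕ) : ∀ k, (gauss M k).eval 1 = M.choose k := by
  induction M with
  | zero =>
    intro k
    cases k with
    | zero => simp
    | succ k => simp [gauss]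
  | succ M ih =>
    intro k
    cases k with
    | zero => simp
    | succ k => rw [gauss_succ, Nat.choose_succ_succ]; simp [ih]

end

/-! ### Symmetric unimodal polynomials -/

/-- The polynomials that are symmetric about `q ^ (D / 2)` and unimodal, with non-negative
coefficients, as the cone that is generated by the symmetric intervals
`q ^ i + q ^ (i + 1) + ⋯ + q ^ (D - i)`. -/
def symCone (D : ℕ) : AddSubmonoid ℤ[X] :=
  AddSubmonoid.closure {f | ∃ i p, 2 * i + p = D ∧ f = X ^ i * qNum (p + 1)}

lemma interval_mem {i p D : ℕ} (h : 2 * i + p = D) : X ^ i * qNum (p + 1) ∈ symCone D :=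
  AddSubmonoid.subset_closure ⟨i, p, h, rfl⟩

lemma shift_mem {D : ℕ} {f : ℤ[X]} (hf : f ∈ symCone D) (j : ℕ) :
    X ^ j * f ∈ symCone (2 * j + D) := by
  induction hf using AddSubmonoid.closure_induction with
  | mem f hf =>
    obtain ⟨i, p, h, rfl⟩ := hf
    rw [← mul_assoc, ← pow_add]
    exact interval_mem (by omega)
  | zero => rw [mul_zero]; exact zero_mem _
  | add f g _ _ hf hg => rw [mul_add]; exact add_mem hf hg

/-- The Clebsch–Gordan rule. -/
lemma qNum_mul_qNum_mem (a : ℕ) : ∀ b : ℕ, qNum (a + 1) * qNum (b + 1) ∈ symCone (a + b) := by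
  induction a with
  | zero =>
    intro b
    have := interval_mem (i := 0) (p := b) (D := 0 + b) (by omega)
    simpa using this
  | succ a ih =>
    intro b
    cases b with
    | zero =>
      have := interval_mem (i := 0) (p := a + 1) (D := a + 1 + 0) (by omega)
      simpa using this
    | succ b =>
      have h1 : qNum (a + 1 + 1) * qNum (b + 1 + 1) =
          qNum (a + b + 2 + 1) + X * (qNum (a + 1) * qNum (b + 1)) := by
        have e1 : qNum (a + 1 + 1) = 1 + X * qNum (a + 1) := by
          rw [add_comm (a + 1), qNum_add, qNum_one, pow_one]
        have e2 : qNum (b + 1 + 1) = qNum (b + 1) + X ^ (b + 1) := qNum_succ _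
        have e3 : qNum (a + b + 2 + 1) =
            qNum (b + 1) + X ^ (b + 1) + X ^ (b + 2) * qNum (a + 1) := by
          rw [show a + b + 2 + 1 = b + 1 + 1 + (a + 1) by ring, qNum_add, qNum_succ (b + 1)]
        rw [e1, e2, e3]
        ring
      rw [h1]
      refine add_mem ?_ ?_
      · have := interval_mem (i := 0) (p := a + b + 2) (D := a + 1 + (b + 1)) (by omega)
        simpa using this
      · have := shift_mem (ih b) 1
        rw [pow_one] at this
        rwa [show a + 1 + (b + 1) = 2 * 1 + (a + b) by ring]

lemma mul_mem_symCone {D E : ℕ} {f g : ℤ[X]} (hf : f ∈ symCone D) (hg : g ∈ symCone E) :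
    f * g ∈ symCone (D + E) := by
  induction hf using AddSubmonoid.closure_induction with
  | zero => rw [zero_mul]; exact zero_mem _
  | add f f' _ _ hf hf' => rw [add_mul]; exact add_mem hf hf'
  | mem f hf =>
    obtain ⟨i, p, h, rfl⟩ := hf
    induction hg using AddSubmonoid.closure_induction with
    | zero => rw [mul_zero]; exact zero_mem _
    | add g g' _ _ hg hg' => rw [mul_add]; exact add_mem hg hg'
    | mem g hg =>
      obtain ⟨j, r, h', rfl⟩ := hg
      have := shift_mem (qNum_mul_qNum_mem p r) (i + j)
      rw [show 2 * (i + j) + (p + r) = D + E by omega] at this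
      rw [show X ^ i * qNum (p + 1) * (X ^ j * qNum (r + 1)) =
        X ^ (i + j) * (qNum (p + 1) * qNum (r + 1)) by ring]
      exact this

lemma coeff_qNum (a t : ℕ) : (qNum a).coeff t = if t < a then 1 else 0 := by
  rw [qNum, Polynomial.finsetSum_coeff]
  simp only [coeff_X_pow]
  rw [Finset.sum_ite_eq]
  simp

lemma coeff_interval (i p t : ℕ) :
    (X ^ i * qNum (p + 1)).coeff t = if i ≤ t ∧ t ≤ i + p then 1 else 0 := by
  rw [coeff_X_pow_mul', coeff_qNum]
  split_ifs <;> first | rfl | omega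

lemma coeff_eq_zero_of_mem {D : ℕ} {f : ℤ[X]} (hf : f ∈ symCone D) {t : ℕ} (ht : D < t) :
    f.coeff t = 0 := by
  induction hf using AddSubmonoid.closure_induction with
  | zero => simp
  | add f f' _ _ hf hf' => rw [coeff_add, hf, hf', add_zero]
  | mem f hf =>
    obtain ⟨i, p, h, rfl⟩ := hf
    rw [coeff_interval, if_neg (by omega)]

lemma natDegree_le_of_mem {D : ℕ} {f : ℤ[X]} (hf : f ∈ symCone D) : f.natDegree ≤ D :=
  Polynomial.natDegree_le_iff_coeff_eq_zero.2 fun _ ht => coeff_eq_zero_of_mem hf ht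

lemma coeff_symm_of_mem {D : ℕ} {f : ℤ[X]} (hf : f ∈ symCone D) {t : ℕ} (ht : t ≤ D) :
    f.coeff (D - t) = f.coeff t := by
  induction hf using AddSubmonoid.closure_induction with
  | zero => simp
  | add f f' _ _ hf hf' => rw [coeff_add, coeff_add, hf, hf']
  | mem f hf =>
    obtain ⟨i, p, h, rfl⟩ := hf
    rw [coeff_interval, coeff_interval]
    congr 1
    rw [eq_iff_iff]
    omega

lemma coeff_one_sub_mul_nonneg {D : ℕ} {f : ℤ[X]} (hf : f ∈ symCone D) {t : ℕ}
    (ht : 2 * t ≤ D) : 0 ≤ ((1 - X) * f).coeff t := by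
  induction hf using AddSubmonoid.closure_induction with
  | zero => simp
  | add f f' _ _ hf hf' => rw [mul_add, coeff_add]; exact add_nonneg hf hf'
  | mem f hf =>
    obtain ⟨i, p, h, rfl⟩ := hf
    rw [show (1 - X) * (X ^ i * qNum (p + 1)) = X ^ i - X ^ (i + p + 1) by
      rw [show (1 - X) * (X ^ i * qNum (p + 1)) = X ^ i * (qNum (p + 1) * (1 - X)) by ring,
        qNum_mul]
      ring]
    rw [coeff_sub, coeff_X_pow, coeff_X_pow, if_neg (show ¬ t = i + p + 1 by omega)]
    split_ifs <;> simp

/-- A polynomial with symmetric coefficients that increase up to the middle is in the cone. -/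
lemma mem_symCone (D : ℕ) : ∀ f : ℤ[X], (∀ t, D < t → f.coeff t = 0) →
    (∀ t ≤ D, f.coeff (D - t) = f.coeff t) → 0 ≤ f.coeff 0 →
    (∀ t, 2 * t < D → f.coeff t ≤ f.coeff (t + 1)) → f ∈ symCone D := by
  induction D using Nat.strong_induction_on with
  | _ D ih =>
    intro f h1 h2 h3 h4
    obtain ⟨a, ha⟩ := Int.eq_ofNat_of_zero_le h3
    -- subtract the widest interval as often as the constant coefficient tells
    have hmem : a • qNum (D + 1) ∈ symCone D := by
      have := interval_mem (i := 0) (p := D) (D := D) (by omega)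
      rw [pow_zero, one_mul] at this
      exact nsmul_mem this a
    set g := f - a • qNum (D + 1) with hg
    have hgc : ∀ t, g.coeff t = f.coeff t - if t ≤ D then (a : ℤ) else 0 := by
      intro t
      rw [hg, coeff_sub, coeff_smul, coeff_qNum]
      congr 1
      by_cases h : t ≤ D
      · rw [if_pos (by omega), if_pos h]; simp
      · rw [if_neg (by omega), if_neg h]; simp
    have hf : f = g + a • qNum (D + 1) := by rw [hg]; ring
    rw [hf]
    refine add_mem ?_ hmem
    have hg0 : g.coeff 0 = 0 := by rw [hgc, ha]; simp
    have hgD : g.coeff D = 0 := by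
      rw [hgc, if_pos le_rfl, ← ha, ← h2 0 (by omega)]; simp
    rcases Nat.lt_or_ge D 2 with hD | hD
    · have : g = 0 := by
        ext t
        rw [coeff_zero]
        rcases Nat.lt_or_ge D t with h | h
        · rw [hgc, h1 t h, if_neg (by omega)]; rfl
        · rcases Nat.eq_zero_or_pos t with rfl | ht
          · exact hg0
          · rw [show t = D by omega]; exact hgD
      rw [this]
      exact zero_mem _
    · have hdiv : g = X ^ 1 * g.divX := by
        have := Polynomial.X_mul_divX_add g
        rw [hg0, C_0, add_zero] at this
        rw [pow_one, this]
      rw [hdiv, show D = 2 * 1 + (D - 2) by omega]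
      apply shift_mem
      apply ih _ (by omega)
      · intro t ht
        rw [coeff_divX]
        rcases Nat.lt_or_ge D (t + 1) with h | h
        · rw [hgc, h1 _ h, if_neg (by omega)]; rfl
        · rw [show t + 1 = D by omega]; exact hgD
      · intro t ht
        rw [coeff_divX, coeff_divX, hgc, hgc, if_pos (by omega), if_pos (by omega),
          ← h2 (t + 1) (by omega)]
        congr 2
        omega
      · rw [coeff_divX, hgc, if_pos (by omega), ← ha]
        have := h4 0 (by omega)
        rw [zero_add] at *
        omega
      · intro t ht
        rw [coeff_divX, coeff_divX, hgc, hgc, if_pos (by omega), if_pos (by omega)]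
        have := h4 (t + 1) (by omega)
        omega

/-- A quotient of a symmetric unimodal polynomial by a `q`-number has non-negative coefficients. -/
lemma coeff_nonneg_of_mul_qNum {D c : ℕ} (hc : 1 ≤ c) {P : ℤ[X]} (h : P * qNum c ∈ symCone D)
    (t : ℕ) : 0 ≤ P.coeff t := by
  rcases eq_or_ne P 0 with rfl | hP
  · simp
  have hdeg : (qNum c).natDegree = c - 1 := by
    apply Polynomial.natDegree_eq_of_le_of_coeff_ne_zero
    · rw [Polynomial.natDegree_le_iff_coeff_eq_zero]
      intro t ht
      rw [coeff_qNum, if_neg (by omega)]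
    · rw [coeff_qNum, if_pos (by omega)]; exact one_ne_zero
  have hdeg2 := natDegree_le_of_mem h
  rw [natDegree_mul hP (qNum_ne_zero hc), hdeg] at hdeg2
  obtain ⟨E, rfl⟩ : ∃ E, D = E + (c - 1) := ⟨D - (c - 1), by omega⟩
  have hPE : P.natDegree ≤ E := by omega
  -- the quotient is symmetric
  have hsymm : ∀ t ≤ E, P.coeff (E - t) = P.coeff t := by
    have h1 : reflect (E + (c - 1)) (P * qNum c) = P * qNum c := by
      ext t
      rw [coeff_reflect]
      rcases Nat.lt_or_ge (E + (c - 1)) t with ht | ht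
      · rw [revAt_eq_self_of_lt ht]
      · rw [revAt_le ht, coeff_symm_of_mem h ht]
    have h2 : reflect (c - 1) (qNum c) = qNum c := by
      ext t
      rw [coeff_reflect]
      rcases Nat.lt_or_ge (c - 1) t with ht | ht
      · rw [revAt_eq_self_of_lt ht]
      · rw [revAt_le ht, coeff_qNum, coeff_qNum, if_pos (by omega), if_pos (by omega)]
    rw [reflect_mul _ _ hPE hdeg.le, h2] at h1
    have h3 := mul_right_cancel₀ (qNum_ne_zero hc) h1
    intro t ht
    conv_rhs => rw [← h3]
    rw [coeff_reflect, revAt_le ht]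
  have hlow : ∀ t, 2 * t ≤ E + (c - 1) → 0 ≤ P.coeff t := by
    intro t
    induction t using Nat.strong_induction_on with
    | _ t ih =>
      intro ht
      have h1 := coeff_one_sub_mul_nonneg h ht
      rw [show (1 - X) * (P * qNum c) = P - X ^ c * P by
        rw [show (1 - X) * (P * qNum c) = P * (qNum c * (1 - X)) by ring, qNum_mul]; ring,
        coeff_sub, coeff_X_pow_mul'] at h1
      split_ifs at h1 with h2
      · have := ih (t - c) (by omega) (by omega)
        omega
      · omega
  rcases Nat.lt_or_ge E t with ht | ht
  · rw [coeff_eq_zero_of_natDegree_lt (by omega)]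
  · rcases Nat.lt_or_ge (E + (c - 1)) (2 * t) with h1 | h1
    · rw [← hsymm t ht]
      exact hlow _ (by omega)
    · exact hlow t h1

/-! ### Unimodality of the Gaussian polynomials -/

section
variable {M : ℕ}

/-- The number of elements of the subset with indicator function `T`. -/
def size (T : Fin M → Bool) : ℕ := ∑ i, if T i then 1 else 0

/-- The sum of the elements of the subset with indicator function `T`. -/
def wt (T : Fin M → Bool) : ℕ := ∑ i, if T i then (i : ℕ) else 0

lemma size_cons (b : Bool) (T : Fin M → Bool) :
    size (Fin.cons b T : Fin (M + 1) → Bool) = (if b then 1 else 0) + size T := by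
  rw [size, Fin.sum_univ_succ]
  simp [size]

lemma wt_cons (b : Bool) (T : Fin M → Bool) :
    wt (Fin.cons b T : Fin (M + 1) → Bool) = wt T + size T := by
  rw [wt, Fin.sum_univ_succ, wt, size, ← Finset.sum_add_distrib]
  simp only [Fin.cons_zero, Fin.val_zero, ite_self, zero_add, Fin.cons_succ, Fin.val_succ]
  apply Finset.sum_congr rfl
  intro i _
  split_ifs <;> rfl

/-- The sum of `q ^ wt T` over the subsets `T` of size `k`. -/
def subsetGen (M k : ℕ) : ℤ[X] := ∑ T : Fin M → Bool, if size T = k then X ^ wt T else 0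

lemma subsetGen_succ (M k : ℕ) : subsetGen (M + 1) k =
    ∑ T : Fin M → Bool, (if 1 + size T = k then X ^ (wt T + size T) else 0) +
      ∑ T : Fin M → Bool, (if size T = k then X ^ (wt T + size T) else 0) := by
  rw [subsetGen, ← (Fin.consEquiv (fun _ : Fin (M + 1) => Bool)).sum_comp, Fintype.sum_prod_type,
    Fintype.sum_bool]
  simp [Fin.consEquiv, size_cons, wt_cons]

lemma subsetGen_eq (M : ℕ) : ∀ k, subsetGen M k = X ^ k.choose 2 * gauss M k := by
  induction M with
  | zero =>
    intro k
    rw [subsetGen, Fintype.sum_unique]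
    cases k with
    | zero => simp [size, wt]
    | succ k => simp [size, gauss]
  | succ M ih =>
    intro k
    rw [subsetGen_succ]
    cases k with
    | zero =>
      rw [Finset.sum_eq_zero fun T _ => if_neg (by omega), zero_add]
      have h := ih 0
      rw [gauss_zero, subsetGen] at h
      rw [gauss_zero, ← h]
      apply Finset.sum_congr rfl
      intro T _
      split_ifs with h
      · rw [h, add_zero]
      · rfl
    | succ k =>
      have h1 : ∑ T : Fin M → Bool, (if 1 + size T = k + 1 then (X : ℤ[X]) ^ (wt T + size T) else 0)
          = X ^ k * subsetGen M k := by
        rw [subsetGen, Finset.mul_sum]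
        apply Finset.sum_congr rfl
        intro T _
        simp only [add_comm 1, Nat.add_right_cancel_iff]
        split_ifs with h
        · rw [h]; ring
        · rw [mul_zero]
      have h2 : ∑ T : Fin M → Bool, (if size T = k + 1 then (X : ℤ[X]) ^ (wt T + size T) else 0)
          = X ^ (k + 1) * subsetGen M (k + 1) := by
        rw [subsetGen, Finset.mul_sum]
        apply Finset.sum_congr rfl
        intro T _
        split_ifs with h
        · rw [h]; ring
        · rw [mul_zero]
      rw [h1, h2, ih, ih, gauss_succ, Nat.choose_succ_succ' k 1, Nat.choose_one_right]
      ring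

/-- The subsets of size `k` and sum `s`. -/
def level (M k s : ℕ) : Finset (Fin M → Bool) := univ.filter fun T => size T = k ∧ wt T = s

lemma mem_level {k s : ℕ} {T : Fin M → Bool} : T ∈ level M k s ↔ size T = k ∧ wt T = s := by
  simp [level]

lemma coeff_subsetGen (M k s : ℕ) : (subsetGen M k).coeff s = (level M k s).card := by
  rw [subsetGen, Polynomial.finsetSum_coeff, level, Finset.card_filter, Nat.cast_sum]
  apply Finset.sum_congr rfl
  intro T _
  by_cases h : size T = k
  · rw [if_pos h, coeff_X_pow]
    simp only [h, true_and, eq_comm (a := s)]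
    split_ifs <;> rfl
  · rw [if_neg h, if_neg (fun h' => h h'.1)]
    simp

lemma coeff_gauss (M k t : ℕ) : (gauss M k).coeff t = (level M k (t + k.choose 2)).card := by
  rw [← coeff_subsetGen, subsetGen_eq, coeff_X_pow_mul]

lemma level_eq_empty {k s : ℕ} (h : s < k.choose 2) : level M k s = ∅ := by
  have := coeff_subsetGen M k s
  rw [subsetGen_eq, coeff_X_pow_mul', if_neg (by omega)] at this
  exact Finset.card_eq_zero.1 (by exact_mod_cast this.symm)

lemma size_comp (e : Equiv.Perm (Fin M)) (T : Fin M → Bool) : size (T ∘ e) = size T :=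
  Equiv.sum_comp e fun i => if T i then 1 else 0

lemma wt_comp_rev (T : Fin (M + 1) → Bool) : wt (T ∘ Fin.rev) + wt T = size T * M := by
  have h : wt (T ∘ Fin.rev) = ∑ i, if T i then M - (i : ℕ) else 0 := by
    rw [wt, ← Equiv.sum_comp Fin.revPerm]
    apply Finset.sum_congr rfl
    intro i _
    simp [Fin.val_rev]
  rw [h, wt, size, ← Finset.sum_add_distrib, Finset.sum_mul]
  apply Finset.sum_congr rfl
  intro i _
  have := i.isLt
  split_ifs <;> omega

lemma card_level_symm {k s r : ℕ} (h : s + r = k * M) :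
    (level (M + 1) k s).card = (level (M + 1) k r).card := by
  apply Finset.card_bij' (fun T _ => T ∘ Fin.rev) (fun T _ => T ∘ Fin.rev)
  · intro T hT
    rw [mem_level] at hT ⊢
    have h1 := wt_comp_rev T
    have h2 := size_comp Fin.revPerm T
    rw [hT.1] at h1 h2
    exact ⟨h2, by omega⟩
  · intro T hT
    rw [mem_level] at hT ⊢
    have h1 := wt_comp_rev T
    have h2 := size_comp Fin.revPerm T
    rw [hT.1] at h1 h2
    exact ⟨h2, by omega⟩
  · intro T _; ext i; simp
  · intro T _; ext i; simp

/-! The raising operator of the representation of `sl₂` on the functions of the subsets of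
`{0, …, M}`: it moves an element `i` to `i + 1`, with the coefficient
`√((i + 1) (M - i))`. -/

/-- Exchanging the elements `i` and `i + 1` in a subset. -/
def act (i : Fin M) : Equiv.Perm (Fin (M + 1) → Bool) :=
  Function.Involutive.toPerm (fun T => T ∘ Equiv.swap i.castSucc i.succ) fun T => by
    ext x; simp

lemma act_apply (i : Fin M) (T : Fin (M + 1) → Bool) (x : Fin (M + 1)) :
    act i T x = T (Equiv.swap i.castSucc i.succ x) := rfl

lemma castSucc_ne_succ (i : Fin M) : i.castSucc ≠ i.succ := by
  intro h
  have := congrArg Fin.val h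
  simp at this

lemma act_castSucc (i : Fin M) (T : Fin (M + 1) → Bool) : act i T i.castSucc = T i.succ := by
  rw [act_apply, Equiv.swap_apply_left]

lemma act_succ (i : Fin M) (T : Fin (M + 1) → Bool) : act i T i.succ = T i.castSucc := by
  rw [act_apply, Equiv.swap_apply_right]

lemma act_act (i : Fin M) (T : Fin (M + 1) → Bool) : act i (act i T) = T := by
  ext x; simp [act_apply]

/-- `f` at the subset from which `T` arises by moving `i` to `i + 1`. -/
def raiseAt (f : (Fin (M + 1) → Bool) → ℝ) (i : Fin M) (T : Fin (M + 1) → Bool) : ℝ :=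
  if T i.castSucc = false ∧ T i.succ = true then f (act i T) else 0

/-- `f` at the subset from which `T` arises by moving `i + 1` to `i`. -/
def lowerAt (f : (Fin (M + 1) → Bool) → ℝ) (i : Fin M) (T : Fin (M + 1) → Bool) : ℝ :=
  if T i.castSucc = true ∧ T i.succ = false then f (act i T) else 0

/-- Moves at different places commute. -/
lemma sum_raiseAt_mul (f : (Fin (M + 1) → Bool) → ℝ) {i j : Fin M} (hij : i ≠ j) :
    ∑ T, raiseAt f i T * raiseAt f j T = ∑ T, lowerAt f i T * lowerAt f j T := by
  by_cases h1 : i.succ = j.castSucc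
  · rw [Finset.sum_eq_zero, Finset.sum_eq_zero]
    · intro T _
      rw [lowerAt, lowerAt, h1]
      cases T j.castSucc <;> simp
    · intro T _
      rw [raiseAt, raiseAt, h1]
      cases T j.castSucc <;> simp
  by_cases h2 : j.succ = i.castSucc
  · rw [Finset.sum_eq_zero, Finset.sum_eq_zero]
    · intro T _
      rw [lowerAt, lowerAt, h2]
      cases T i.castSucc <;> simp
    · intro T _
      rw [raiseAt, raiseAt, h2]
      cases T i.castSucc <;> simp
  have h3 : i.castSucc ≠ j.castSucc := fun h => hij (Fin.castSucc_injective _ h)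
  have h4 : i.succ ≠ j.succ := fun h => hij (Fin.succ_injective _ h)
  have e1 : ∀ T, act j T i.castSucc = T i.castSucc := fun T => by
    rw [act_apply, Equiv.swap_apply_of_ne_of_ne h3 (Ne.symm h2)]
  have e2 : ∀ T, act j T i.succ = T i.succ := fun T => by
    rw [act_apply, Equiv.swap_apply_of_ne_of_ne h1 h4]
  have e3 : ∀ T, act i T j.castSucc = T j.castSucc := fun T => by
    rw [act_apply, Equiv.swap_apply_of_ne_of_ne h3.symm (Ne.symm h1)]
  have e4 : ∀ T, act i T j.succ = T j.succ := fun T => by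
    rw [act_apply, Equiv.swap_apply_of_ne_of_ne h2 h4.symm]
  have hcomm : ∀ T, act j (act i (act j T)) = act i T := by
    intro T
    have hdis : Equiv.swap i.castSucc i.succ * Equiv.swap j.castSucc j.succ =
        Equiv.swap j.castSucc j.succ * Equiv.swap i.castSucc i.succ := by
      apply Equiv.Perm.Disjoint.commute
      rw [Equiv.Perm.disjoint_iff_disjoint_support, Equiv.Perm.support_swap (castSucc_ne_succ i),
        Equiv.Perm.support_swap (castSucc_ne_succ j)]
      rw [Finset.disjoint_left]
      intro x hx hx'
      simp only [mem_insert, mem_singleton] at hx hx'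
      rcases hx with rfl | rfl <;> rcases hx' with h | h
      · exact h3 h
      · exact h2 h.symm
      · exact h1 h
      · exact h4 h
    ext x
    have h5 := congrArg (fun e : Equiv.Perm _ => e (Equiv.swap j.castSucc j.succ x)) hdis
    simp only [Equiv.Perm.mul_apply, Equiv.swap_apply_self] at h5
    simp only [act_apply]
    rw [← h5]
  rw [← Equiv.sum_comp (act i), ← Equiv.sum_comp (act j)]
  apply Finset.sum_congr rfl
  intro T _
  simp only [raiseAt, lowerAt, act_castSucc, act_succ, e1, e2, e3, e4, hcomm, act_act]
  rw [mul_comm]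
  by_cases p : T i.castSucc = true ∧ T i.succ = false
  · by_cases q : T j.castSucc = true ∧ T j.succ = false
    · rw [if_pos p, if_pos q, if_pos q.symm, if_pos p.symm]
    · rw [if_neg q, if_neg fun h => q h.symm, zero_mul, mul_zero]
  · rw [if_neg p, if_neg fun h : T i.succ = false ∧ T i.castSucc = true => p h.symm, zero_mul,
      mul_zero]

lemma sum_raiseAt_sq (f : (Fin (M + 1) → Bool) → ℝ) (i : Fin M) :
    ∑ T, raiseAt f i T ^ 2 - ∑ T, lowerAt f i T ^ 2 =
      ∑ T, f T ^ 2 * ((if T i.castSucc then 1 else 0) - if T i.succ then 1 else 0) := by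
  rw [← Equiv.sum_comp (act i), ← Equiv.sum_comp (act i) (fun T => lowerAt f i T ^ 2),
    ← Finset.sum_sub_distrib]
  apply Finset.sum_congr rfl
  intro T _
  rw [raiseAt, lowerAt, act_castSucc, act_succ, act_act]
  cases T i.castSucc <;> cases T i.succ <;> simp

lemma sum_weights (M : ℕ) (T : Fin (M + 1) → Bool) :
    ∑ i : Fin M, (((i : ℕ) + 1) * (M - (i : ℕ)) : ℝ) *
      ((if T i.castSucc then 1 else 0) - if T i.succ then 1 else 0) =
      size T * M - 2 * wt T := by
  have h1 : (size T * M - 2 * wt T : ℝ) = ∑ i : Fin (M + 1),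
      (((i : ℕ) + 1) * (M - (i : ℕ)) : ℝ) * (if T i then 1 else 0) -
      ∑ i : Fin (M + 1), (((i : ℕ) : ℝ) * (M + 1 - (i : ℕ)) : ℝ) * (if T i then 1 else 0) := by
    rw [size, wt, Nat.cast_sum, Nat.cast_sum, Finset.sum_mul, Finset.mul_sum,
      ← Finset.sum_sub_distrib, ← Finset.sum_sub_distrib]
    apply Finset.sum_congr rfl
    intro i _
    split_ifs
    · push_cast; ring
    · simp
  rw [h1, Fin.sum_univ_castSucc, Fin.sum_univ_succ (n := M)]
  simp only [Fin.val_castSucc, Fin.val_last, sub_self, mul_zero, zero_mul, add_zero, Fin.val_zero,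
    Nat.cast_zero, zero_add, Fin.val_succ]
  rw [← Finset.sum_sub_distrib]
  apply Finset.sum_congr rfl
  intro i _
  push_cast
  ring

/-- The raising operator. -/
def raise (f : (Fin (M + 1) → Bool) → ℝ) (T : Fin (M + 1) → Bool) : ℝ :=
  ∑ i : Fin M, √(((i : ℕ) + 1) * (M - (i : ℕ))) * raiseAt f i T

/-- The lowering operator, which is adjoint to the raising operator. -/
def lower (f : (Fin (M + 1) → Bool) → ℝ) (T : Fin (M + 1) → Bool) : ℝ :=
  ∑ i : Fin M, √(((i : ℕ) + 1) * (M - (i : ℕ))) * lowerAt f i T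

/-- The commutator of the lowering and the raising operator is multiplication by the weight. -/
lemma sum_raise_sq (f : (Fin (M + 1) → Bool) → ℝ) :
    ∑ T, raise f T ^ 2 - ∑ T, lower f T ^ 2 = ∑ T, f T ^ 2 * (size T * M - 2 * wt T) := by
  set c : Fin M → ℝ := fun i => √(((i : ℕ) + 1) * (M - (i : ℕ))) with hc
  have hc2 : ∀ i, c i * c i = ((i : ℕ) + 1) * (M - (i : ℕ)) := fun i => by
    rw [hc]
    apply Real.mul_self_sqrt
    have : ((i : ℕ) : ℝ) ≤ M := by exact_mod_cast i.isLt.le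
    apply mul_nonneg (by positivity)
    linarith
  have hexp : ∀ g : Fin M → (Fin (M + 1) → Bool) → ℝ, ∑ T, (∑ i, c i * g i T) ^ 2 =
      ∑ i, ∑ j, c i * c j * ∑ T, g i T * g j T := by
    intro g
    simp only [sq, Finset.sum_mul_sum]
    simp only [Finset.mul_sum]
    rw [Finset.sum_comm]
    apply Finset.sum_congr rfl
    intro i _
    rw [Finset.sum_comm]
    apply Finset.sum_congr rfl
    intro j _
    apply Finset.sum_congr rfl
    intro T _
    ring
  have h1 : ∑ T, raise f T ^ 2 - ∑ T, lower f T ^ 2 =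
      ∑ i, c i * c i * (∑ T, raiseAt f i T ^ 2 - ∑ T, lowerAt f i T ^ 2) := by
    have e1 := hexp (raiseAt f)
    have e2 := hexp (lowerAt f)
    simp only [raise, lower]
    rw [e1, e2, ← Finset.sum_sub_distrib]
    apply Finset.sum_congr rfl
    intro i _
    rw [← Finset.sum_sub_distrib, Finset.sum_eq_single i]
    · simp only [sq]; ring
    · intro j _ hj
      rw [sum_raiseAt_mul f hj.symm, sub_self]
    · intro h; exact absurd (mem_univ i) h
  rw [h1]
  simp only [sum_raiseAt_sq, Finset.mul_sum]
  rw [Finset.sum_comm]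
  apply Finset.sum_congr rfl
  intro T _
  rw [← sum_weights, Finset.mul_sum]
  apply Finset.sum_congr rfl
  intro i _
  rw [hc2]
  ring

lemma wt_act {i : Fin M} {T : Fin (M + 1) → Bool} (h1 : T i.castSucc = false)
    (h2 : T i.succ = true) : wt T = wt (act i T) + 1 := by
  have e : wt (act i T) = ∑ x, if T x then ((Equiv.swap i.castSucc i.succ x : Fin (M + 1)) : ℕ)
      else 0 := by
    rw [wt, ← Equiv.sum_comp (Equiv.swap i.castSucc i.succ)]
    simp only [act_apply, Equiv.swap_apply_self]
  have h : (wt T : ℤ) - wt (act i T) = 1 := by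
    rw [e, wt, Nat.cast_sum, Nat.cast_sum, ← Finset.sum_sub_distrib,
      Fintype.sum_eq_single i.succ]
    · rw [if_pos h2, if_pos h2, Equiv.swap_apply_right]
      simp
    · intro x hx
      by_cases hc : x = i.castSucc
      · rw [hc, h1]; simp
      · rw [Equiv.swap_apply_of_ne_of_ne hc hx, sub_self]
  omega

/-- Below the middle, the raising operator is injective. -/
lemma eq_zero_of_raise_eq_zero {k s : ℕ} (hs : 2 * s < k * M) {f : (Fin (M + 1) → Bool) → ℝ}
    (hf : ∀ T, T ∉ level (M + 1) k s → f T = 0) (h : ∀ T, raise f T = 0) : f = 0 := by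
  have h1 := sum_raise_sq f
  simp only [h] at h1
  have h2 : ∑ T, f T ^ 2 * (size T * M - 2 * wt T) = ∑ T, f T ^ 2 * ((k : ℝ) * M - 2 * s) := by
    apply Finset.sum_congr rfl
    intro T _
    by_cases hT : T ∈ level (M + 1) k s
    · rw [mem_level] at hT
      rw [hT.1, hT.2]
    · rw [hf T hT]; ring
  have hpos : (0 : ℝ) < k * M - 2 * s := by
    have : (2 * s : ℝ) < k * M := by exact_mod_cast hs
    linarith
  have h3 : 0 ≤ ∑ T, lower f T ^ 2 := Finset.sum_nonneg fun T _ => sq_nonneg _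
  have h4 : ∑ T, f T ^ 2 * ((k : ℝ) * M - 2 * s) ≤ 0 := by
    rw [← h2, ← h1]
    simp only [ne_eq, OfNat.ofNat_ne_zero, not_false_eq_true, zero_pow, Finset.sum_const_zero]
    linarith
  have h5 : ∀ T ∈ univ, 0 ≤ f T ^ 2 * ((k : ℝ) * M - 2 * s) := fun T _ =>
    mul_nonneg (sq_nonneg _) hpos.le
  ext T
  have h6 := (Finset.sum_eq_zero_iff_of_nonneg h5).1 (le_antisymm h4 (Finset.sum_nonneg h5)) T
    (mem_univ T)
  exact pow_eq_zero_iff (two_ne_zero) |>.1 ((mul_eq_zero.1 h6).resolve_right hpos.ne')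

/-- Below the middle, the numbers of subsets of a given size and sum increase with the sum. -/
lemma card_level_le {k s : ℕ} (hs : 2 * s < k * M) :
    (level (M + 1) k s).card ≤ (level (M + 1) k (s + 1)).card := by
  -- extension by zero
  set ext : (level (M + 1) k s → ℝ) → (Fin (M + 1) → Bool) → ℝ :=
    fun g T => if h : T ∈ level (M + 1) k s then g ⟨T, h⟩ else 0 with hext
  have hadd : ∀ g g', ext (g + g') = ext g + ext g' := by
    intro g g'
    ext T
    simp only [hext, Pi.add_apply]
    split_ifs <;> simp
  have hsmul : ∀ (a : ℝ) g, ext (a • g) = a • ext g := by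
    intro a g
    ext T
    simp only [hext, Pi.smul_apply]
    split_ifs <;> simp
  have radd : ∀ f f' : (Fin (M + 1) → Bool) → ℝ, raise (f + f') = raise f + raise f' := by
    intro f f'
    ext T
    simp only [raise, Pi.add_apply, ← Finset.sum_add_distrib]
    apply Finset.sum_congr rfl
    intro i _
    rw [← mul_add]
    congr 1
    simp only [raiseAt, Pi.add_apply]
    split_ifs <;> simp
  have rsmul : ∀ (a : ℝ) (f : (Fin (M + 1) → Bool) → ℝ), raise (a • f) = a • raise f := by
    intro a f
    ext T
    simp only [raise, Pi.smul_apply, smul_eq_mul, Finset.mul_sum]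
    apply Finset.sum_congr rfl
    intro i _
    rw [mul_left_comm]
    congr 1
    simp only [raiseAt, Pi.smul_apply, smul_eq_mul]
    split_ifs <;> simp
  let Φ : (level (M + 1) k s → ℝ) →ₗ[ℝ] (level (M + 1) k (s + 1) → ℝ) :=
    { toFun := fun g T => raise (ext g) T.1
      map_add' := fun g g' => by rw [hadd, radd]; rfl
      map_smul' := fun a g => by rw [hsmul, rsmul]; rfl }
  have hinj : Function.Injective Φ := by
    rw [injective_iff_map_eq_zero]
    intro g hg
    have h0 : ext g = 0 := by
      apply eq_zero_of_raise_eq_zero hs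
      · intro T hT
        simp only [hext, hT, dif_neg, not_false_eq_true]
      · intro T
        by_cases hT : T ∈ level (M + 1) k (s + 1)
        · exact congr_fun hg ⟨T, hT⟩
        · apply Finset.sum_eq_zero
          intro i _
          rw [raiseAt]
          split_ifs with hi
          · have : act i T ∉ level (M + 1) k s := by
              rw [mem_level] at hT ⊢
              intro h
              have h1 := wt_act hi.1 hi.2
              have h2 : size (act i T) = size T := size_comp _ T
              exact hT ⟨by omega, by omega⟩
            simp only [hext, this, dif_neg, not_false_eq_true, mul_zero]
          · rw [mul_zero]
    ext T
    have := congr_fun h0 T.1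
    simp only [hext, T.2, dif_pos] at this
    exact this
  have := LinearMap.finrank_le_finrank_of_injective hinj
  rwa [Module.finrank_fintype_fun_eq_card, Module.finrank_fintype_fun_eq_card, Fintype.card_coe,
    Fintype.card_coe] at this

lemma two_mul_choose_two (k : ℕ) : 2 * k.choose 2 + k = k * k := by
  induction k with
  | zero => rfl
  | succ k ih =>
    rw [Nat.choose_succ_succ' k 1, Nat.choose_one_right]
    linarith

/-- The Gaussian polynomials are symmetric and unimodal. -/
theorem gauss_mem_symCone (k j : ℕ) : gauss (k + j) k ∈ symCone (k * j) := by
  have h2 := two_mul_choose_two k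
  rcases Nat.eq_zero_or_pos (k + j) with h0 | h0
  · obtain ⟨rfl, rfl⟩ : k = 0 ∧ j = 0 := by omega
    have := interval_mem (i := 0) (p := 0) (D := 0) rfl
    simpa using this
  obtain ⟨M, hM⟩ : ∃ M, k + j = M + 1 := ⟨k + j - 1, by omega⟩
  have hkM : k * j + 2 * k.choose 2 = k * M := by
    have : k * (k + j) = k * (M + 1) := by rw [hM]
    linarith
  rw [hM]
  apply mem_symCone
  · intro t ht
    rw [coeff_gauss]
    rcases Nat.lt_or_ge (k * M) (t + k.choose 2) with h | h
    · rw [Nat.cast_eq_zero, Finset.card_eq_zero, Finset.eq_empty_iff_forall_notMem]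
      intro T hT
      rw [mem_level] at hT
      have h3 := wt_comp_rev T
      rw [hT.1, hT.2] at h3
      omega
    · rw [card_level_symm (r := k * M - (t + k.choose 2)) (by omega), level_eq_empty (by omega)]
      rfl
  · intro t ht
    rw [coeff_gauss, coeff_gauss, card_level_symm (r := t + k.choose 2) (by omega)]
  · rw [coeff_gauss]
    positivity
  · intro t ht
    rw [coeff_gauss, coeff_gauss, show t + 1 + k.choose 2 = t + k.choose 2 + 1 by ring]
    exact_mod_cast card_level_le (by omega)

end

/-! ### Gaussian multinomial coefficients and quotients by `q`-numbers -/

/-- The Gaussian multinomial coefficient with lower entries `b 1, …, b n`. -/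
def gaussMulti (b : ℕ → ℕ) (n : ℕ) : ℤ[X] :=
  ∏ i ∈ range n, gauss (∑ j ∈ Icc 1 (i + 1), b j) (b (i + 1))

lemma gaussMulti_succ (b : ℕ → ℕ) (n : ℕ) :
    gaussMulti b (n + 1) = gaussMulti b n * gauss (∑ j ∈ Icc 1 (n + 1), b j) (b (n + 1)) :=
  Finset.prod_range_succ _ n

lemma sum_Icc_succ (b : ℕ → ℕ) (n : ℕ) :
    ∑ j ∈ Icc 1 (n + 1), b j = ∑ j ∈ Icc 1 n, b j + b (n + 1) :=
  Finset.sum_Icc_succ_top (by omega) _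

lemma gaussMulti_mul_qFactorial (b : ℕ → ℕ) (n : ℕ) :
    gaussMulti b n * ∏ i ∈ Icc 1 n, qFactorial (b i) = qFactorial (∑ i ∈ Icc 1 n, b i) := by
  induction n with
  | zero => simp [gaussMulti]
  | succ n ih =>
    rw [gaussMulti_succ, Finset.prod_Icc_succ_top (by omega), sum_Icc_succ,
      add_comm (∑ i ∈ Icc 1 n, b i), ← gauss_mul_qFactorial, ← ih]
    ring

lemma gaussMulti_mem_symCone (b : ℕ → ℕ) (n : ℕ) : ∃ D, gaussMulti b n ∈ symCone D := by
  induction n with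
  | zero =>
    refine ⟨0, ?_⟩
    have := interval_mem (i := 0) (p := 0) (D := 0) rfl
    simpa [gaussMulti] using this
  | succ n ih =>
    obtain ⟨D, hD⟩ := ih
    rw [gaussMulti_succ, sum_Icc_succ, add_comm (∑ i ∈ Icc 1 n, b i)]
    exact ⟨_, mul_mem_symCone hD (gauss_mem_symCone _ _)⟩

lemma eval_one_gaussMulti (b : ℕ → ℕ) (n : ℕ) : (gaussMulti b n).eval 1 = multi b n := by
  rw [gaussMulti, Polynomial.eval_prod, multi, Nat.cast_prod]
  simp only [eval_one_gauss]

lemma dvd_gaussMulti_mul (b : ℕ → ℕ) {n i : ℕ} (hi : i ∈ Icc 1 n) :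
    qNum (∑ j ∈ Icc 1 n, b j) ∣ gaussMulti b n * qNum (b i) := by
  rcases Nat.eq_zero_or_pos (b i) with h0 | h0
  · rw [h0, qNum_zero, mul_zero]; exact dvd_zero _
  set b' := Function.update b i (b i - 1) with hb'
  have hne : ∀ j ∈ (Icc 1 n).erase i, b' j = b j := fun j hj => by
    rw [hb', Function.update_of_ne (mem_erase.1 hj).1]
  have hi' : b' i = b i - 1 := by rw [hb', Function.update_self]
  have hsum : ∑ j ∈ Icc 1 n, b j = ∑ j ∈ Icc 1 n, b' j + 1 := by
    have e1 := Finset.sum_congr rfl hne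
    have e2 := Finset.add_sum_erase _ b hi
    have e3 := Finset.add_sum_erase _ b' hi
    rw [← e2, ← e3, e1, hi']
    have e4 : (Finset.erase (Icc 1 n) i).sum b = ∑ x ∈ (Icc 1 n).erase i, b x := rfl
    omega
  have hprod : ∏ j ∈ Icc 1 n, qFactorial (b j) =
      qNum (b i) * ∏ j ∈ Icc 1 n, qFactorial (b' j) := by
    have e1 : ∏ j ∈ (Icc 1 n).erase i, qFactorial (b' j) =
        ∏ j ∈ (Icc 1 n).erase i, qFactorial (b j) :=
      Finset.prod_congr rfl fun j hj => by rw [hne j hj]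
    rw [← Finset.mul_prod_erase _ _ hi, ← Finset.mul_prod_erase _ (fun j => qFactorial (b' j)) hi,
      e1, hi']
    obtain ⟨k, hk⟩ : ∃ k, b i = k + 1 := ⟨b i - 1, by omega⟩
    rw [hk, qFactorial_succ, Nat.add_sub_cancel]
    ring
  refine ⟨gaussMulti b' n, ?_⟩
  have h1 := gaussMulti_mul_qFactorial b n
  have h2 := gaussMulti_mul_qFactorial b' n
  rw [hsum, qFactorial_succ, ← h2, hprod] at h1
  have h3 : ∏ j ∈ Icc 1 n, qFactorial (b' j) ≠ 0 :=
    Finset.prod_ne_zero_iff.2 fun j _ => qFactorial_ne_zero _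
  apply mul_right_cancel₀ h3
  rw [hsum]
  linear_combination h1

section
variable {d : ℕ}

lemma sum_div_mod {s : Finset ℕ} {b : ℕ → ℕ} (h : ∑ i ∈ s, b i % d < d) :
    (∑ i ∈ s, b i) / d = ∑ i ∈ s, b i / d ∧ (∑ i ∈ s, b i) % d = ∑ i ∈ s, b i % d := by
  have h1 : ∑ i ∈ s, b i = d * ∑ i ∈ s, b i / d + ∑ i ∈ s, b i % d := by
    rw [Finset.mul_sum, ← Finset.sum_add_distrib]
    exact Finset.sum_congr rfl fun i _ => (Nat.div_add_mod _ _).symm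
  constructor
  · rw [h1, Nat.mul_add_div (by omega), Nat.div_eq_of_lt h, add_zero]
  · rw [h1, Nat.mul_add_mod, Nat.mod_eq_of_lt h]

/-- The values of the Gaussian multinomial coefficients at roots of unity, if the upper entry has
the remainder `0` or `1`. -/
lemma aeval_gaussMulti (hd : 2 ≤ d) {ω : ℂ} (hω : IsPrimitiveRoot ω d) (b : ℕ → ℕ) (n : ℕ)
    (h : (∑ i ∈ Icc 1 n, b i) % d ≤ 1) : aeval ω (gaussMulti b n) =
      if ∑ i ∈ Icc 1 n, b i % d ≤ 1 then (multi (fun i => b i / d) n : ℂ) else 0 := by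
  induction n with
  | zero => simp [gaussMulti, multi]
  | succ n ih =>
    rw [gaussMulti_succ, map_mul, aeval_gauss_div hd hω, multi_succ]
    set S := ∑ i ∈ Icc 1 n, b i with hS
    have hS1 : ∑ i ∈ Icc 1 (n + 1), b i = S + b (n + 1) := sum_Icc_succ b n
    have hR1 : ∑ i ∈ Icc 1 (n + 1), b i % d = ∑ i ∈ Icc 1 n, b i % d + b (n + 1) % d :=
      sum_Icc_succ (fun i => b i % d) n
    rcases Nat.lt_or_ge ((∑ i ∈ Icc 1 (n + 1), b i) % d) (b (n + 1) % d) with hlt | hge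
    · rw [gauss_eq_zero hlt, if_neg]
      · simp
      · intro h1
        have := (sum_div_mod (d := d) (s := Icc 1 (n + 1)) (b := b) (by omega)).2
        omega
    · have hg : aeval ω (gauss ((∑ i ∈ Icc 1 (n + 1), b i) % d) (b (n + 1) % d)) = 1 := by
        rcases Nat.eq_zero_or_pos (b (n + 1) % d) with h0 | h0
        · rw [h0, gauss_zero, map_one]
        · rw [show (∑ i ∈ Icc 1 (n + 1), b i) % d = b (n + 1) % d by omega, gauss_self, map_one]
      have hSd : S % d + b (n + 1) % d = (∑ i ∈ Icc 1 (n + 1), b i) % d := by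
        rw [hS1, Nat.add_mod] at hge ⊢
        have h1 := Nat.mod_lt S (show 0 < d by omega)
        have h5 := Nat.mod_lt (b (n + 1)) (show 0 < d by omega)
        rcases Nat.lt_or_ge (S % d + b (n + 1) % d) d with h2 | h2
        · rw [Nat.mod_eq_of_lt h2]
        · have h4 := Nat.mod_eq_sub_mod h2
          rw [Nat.mod_eq_of_lt (show S % d + b (n + 1) % d - d < d by omega)] at h4
          omega
      rw [ih (by omega), hg, mul_one]
      by_cases hc : ∑ i ∈ Icc 1 n, b i % d ≤ 1
      · have h1 := (sum_div_mod (d := d) (s := Icc 1 n) (b := b) (by omega)).2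
        rw [← hS] at h1
        have h2 : ∑ i ∈ Icc 1 (n + 1), b i % d ≤ 1 := by omega
        have h3 := (sum_div_mod (d := d) (s := Icc 1 (n + 1)) (b := b) (by omega)).1
        rw [if_pos hc, if_pos h2, h3]
        push_cast
        rfl
      · rw [if_neg hc, if_neg (by omega), zero_mul]

end

/-- The ideal of the polynomials `p` with `[c]_q ∣ p * B`. -/
def quotientIdeal (c : ℕ) (B : ℤ[X]) : Ideal ℤ[X] :=
  Submodule.comap (LinearMap.mulRight ℤ[X] B) (Ideal.span {qNum c})

lemma mem_quotientIdeal {c : ℕ} {B p : ℤ[X]} : p ∈ quotientIdeal c B ↔ qNum c ∣ p * B := by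
  rw [quotientIdeal, Submodule.mem_comap, LinearMap.mulRight_apply]
  exact Ideal.mem_span_singleton

/-- If `A * [c]_q = B * [e]_q` with `c` and `e` coprime, then `[c]_q` divides `B`: the ideal of the
polynomials `p` with `[c]_q ∣ p * B` contains `[c]_q` and `[e]_q`, and so `[1]_q = 1`. -/
lemma qNum_dvd_of_coprime {c e : ℕ} {A B : ℤ[X]} (h : A * qNum c = B * qNum e)
    (hce : Nat.Coprime c e) : qNum c ∣ B := by
  have h1 : qNum c ∈ quotientIdeal c B := mem_quotientIdeal.2 (dvd_mul_right _ _)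
  have h2 : qNum e ∈ quotientIdeal c B :=
    mem_quotientIdeal.2 ⟨A, by rw [mul_comm, ← h, mul_comm]⟩
  have h3 := qNum_gcd_mem c e h1 h2
  rw [hce, qNum_one, mem_quotientIdeal, one_mul] at h3
  exact h3

lemma exists_nat_polynomial {P : ℤ[X]} (h : ∀ t, 0 ≤ P.coeff t) :
    ∃ Q : ℕ[X], Q.map (Nat.castRingHom ℤ) = P := by
  have : P ∈ Polynomial.lifts (Nat.castRingHom ℤ) := by
    rw [Polynomial.lifts_iff_coeff_lifts]
    intro t
    obtain ⟨a, ha⟩ := Int.eq_ofNat_of_zero_le (h t)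
    exact ⟨a, by rw [ha]; rfl⟩
  rw [Polynomial.mem_lifts] at this
  exact this

/-- The quotient of a symmetric unimodal polynomial by a `q`-number. -/
lemma exists_quotient {c e D : ℕ} (hc : 1 ≤ c) {A B : ℤ[X]} (hB : B ∈ symCone D)
    (hdvd : qNum c ∣ B) (h : A * qNum c = B * qNum e) :
    ∃ P : ℕ[X], P.map (Nat.castRingHom ℤ) * qNum c = B ∧
      P.map (Nat.castRingHom ℤ) * qNum e = A := by
  obtain ⟨P, rfl⟩ := hdvd
  rw [mul_comm] at hB
  obtain ⟨Q, rfl⟩ := exists_nat_polynomial (coeff_nonneg_of_mul_qNum hc hB)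
  refine ⟨Q, mul_comm _ _, ?_⟩
  apply mul_right_cancel₀ (qNum_ne_zero hc)
  rw [h]
  ring

section
variable {L n : ℕ}

/-- The polynomial for all partitions. Besides its definition as a quotient by `[n]_q`, it has a second
expression, whose denominator has the value `1` at the roots of unity of an order that divides both
`L` and `n`. -/
lemma exists_poly_all (hn : 1 ≤ n) (h : n ∣ L + 2) :
    ∃ P : ℕ[X], P.map (Nat.castRingHom ℤ) * qNum n = gauss (L + n) (n - 1) ∧
      P.map (Nat.castRingHom ℤ) * qNum (L + n + 1) = gauss (L + n + 1) n := by
  obtain ⟨k, rfl⟩ : ∃ k, n = k + 1 := ⟨n - 1, by omega⟩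
  have h1 := gauss_absorb (L + (k + 1)) k
  rw [mul_comm (qNum _)] at h1
  have hmem := gauss_mem_symCone k (L + 1)
  rw [show k + (L + 1) = L + (k + 1) by ring] at hmem
  refine exists_quotient hn hmem (qNum_dvd_of_coprime h1 ?_) h1
  -- `L + n + 1` is a multiple of `n` minus one
  rw [Nat.coprime_iff_gcd_eq_one, ← Nat.dvd_one]
  have h2 := Nat.gcd_dvd_left (k + 1) (L + (k + 1) + 1)
  have h3 := Nat.gcd_dvd_right (k + 1) (L + (k + 1) + 1)
  have h4 := (Nat.dvd_add_right (h2.trans h)).2 h2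
  rw [show L + 2 + (k + 1) = (L + (k + 1) + 1) + 1 by ring] at h4
  exact (Nat.dvd_add_right h3).1 h4

/-- The polynomial for partitions with `B` blocks. In its second expression, the denominator
`[L + 1]_q` has the value `1` at the roots of unity of an order that divides `L`. -/
lemma exists_poly_blocks {B : ℕ} (hB : 1 ≤ B) (hBn : B ≤ n) (h : n ∣ L + 2) :
    ∃ P : ℕ[X], P.map (Nat.castRingHom ℤ) * qNum n = gauss n B * gauss L (B - 1) ∧
      P.map (Nat.castRingHom ℤ) * qNum (L + 1) = gauss (n - 1) (B - 1) * gauss (L + 1) B := by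
  obtain ⟨k, rfl⟩ : ∃ k, n = k + 1 := ⟨n - 1, by omega⟩
  obtain ⟨j, rfl⟩ : ∃ j, B = j + 1 := ⟨B - 1, by omega⟩
  simp only [Nat.add_sub_cancel]
  have h1 := gauss_absorb k j
  have h2 := gauss_absorb L j
  have h3 : gauss k j * gauss (L + 1) (j + 1) * qNum (k + 1) =
      gauss (k + 1) (j + 1) * gauss L j * qNum (L + 1) := by
    apply mul_right_cancel₀ (qNum_ne_zero (show 1 ≤ j + 1 by omega))
    linear_combination gauss k j * qNum (k + 1) * h2 - gauss L j * qNum (L + 1) * h1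
  obtain ⟨D, hmem⟩ : ∃ D, gauss (k + 1) (j + 1) * gauss L j ∈ symCone D := by
    have e1 := gauss_mem_symCone (j + 1) (k - j)
    rw [show j + 1 + (k - j) = k + 1 by omega] at e1
    rcases Nat.lt_or_ge L j with hL | hL
    · rw [gauss_eq_zero hL, mul_zero]
      exact ⟨0, zero_mem _⟩
    · have e2 := gauss_mem_symCone j (L - j)
      rw [show j + (L - j) = L by omega] at e2
      exact ⟨_, mul_mem_symCone e1 e2⟩
  refine exists_quotient (by omega) hmem (qNum_dvd_of_coprime h3 ?_) h3
  rw [Nat.coprime_iff_gcd_eq_one, ← Nat.dvd_one]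
  have h2 := Nat.gcd_dvd_left (k + 1) (L + 1)
  have h3 := Nat.gcd_dvd_right (k + 1) (L + 1)
  exact (Nat.dvd_add_right h3).1 (h2.trans h)

/-- The polynomial for partitions with block type `b`, with two expressions as in
`exists_poly_blocks`. -/
lemma exists_poly_type (hn : 1 ≤ n) (h : n ∣ L + 2) {b : ℕ → ℕ}
    (hb : ∑ i ∈ Icc 1 n, i * b i = n) :
    ∃ P : ℕ[X], P.map (Nat.castRingHom ℤ) * qNum (∑ i ∈ Icc 1 n, b i) =
        gaussMulti b n * gauss L (∑ i ∈ Icc 1 n, b i - 1) ∧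
      P.map (Nat.castRingHom ℤ) * qNum (L + 1) =
        gaussMulti b n * gauss (L + 1) (∑ i ∈ Icc 1 n, b i) := by
  obtain ⟨j, hj⟩ : ∃ j, ∑ i ∈ Icc 1 n, b i = j + 1 := by
    refine ⟨∑ i ∈ Icc 1 n, b i - 1, ?_⟩
    have : ∑ i ∈ Icc 1 n, b i ≠ 0 := by
      intro h0
      rw [Finset.sum_eq_zero_iff] at h0
      rw [Finset.sum_eq_zero fun i hi => by rw [h0 i hi, mul_zero]] at hb
      omega
    omega
  rw [hj, Nat.add_sub_cancel]
  have h2 := gauss_absorb L j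
  have h3 : gaussMulti b n * gauss (L + 1) (j + 1) * qNum (j + 1) =
      gaussMulti b n * gauss L j * qNum (L + 1) := by
    linear_combination gaussMulti b n * h2
  obtain ⟨D, hmem⟩ : ∃ D, gaussMulti b n * gauss L j ∈ symCone D := by
    obtain ⟨D, e1⟩ := gaussMulti_mem_symCone b n
    rcases Nat.lt_or_ge L j with hL | hL
    · rw [gauss_eq_zero hL, mul_zero]
      exact ⟨0, zero_mem _⟩
    · have e2 := gauss_mem_symCone j (L - j)
      rw [show j + (L - j) = L by omega] at e2
      exact ⟨_, mul_mem_symCone e1 e2⟩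
  refine exists_quotient (by omega) hmem ?_ h3
  -- the ideal contains `[L + 1]_q` and all `[b i]_q`, and the greatest common divisor is `1`
  set I := quotientIdeal (j + 1) (gaussMulti b n * gauss L j) with hI
  have m1 : qNum (L + 1) ∈ I :=
    mem_quotientIdeal.2 ⟨gaussMulti b n * gauss (L + 1) (j + 1), by linear_combination -h3⟩
  have m2 : ∀ i ∈ Icc 1 n, qNum (b i) ∈ I := by
    intro i hi
    have := dvd_gaussMulti_mul b hi
    rw [hj] at this
    rw [mem_quotientIdeal, mul_comm, mul_right_comm]
    exact this.mul_right _
  have m3 : ∀ s ⊆ Icc 1 n, ∃ g, qNum g ∈ I ∧ g ∣ L + 1 ∧ ∀ i ∈ s, g ∣ b i := by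
    intro s
    induction s using Finset.induction_on with
    | empty => exact fun _ => ⟨L + 1, m1, dvd_rfl, by simp⟩
    | insert i s _ ih =>
      intro hs
      obtain ⟨g, g1, g2, g3⟩ := ih ((Finset.subset_insert i s).trans hs)
      refine ⟨Nat.gcd g (b i), qNum_gcd_mem _ _ g1 (m2 i (hs (mem_insert_self i s))),
        (Nat.gcd_dvd_left _ _).trans g2, ?_⟩
      intro k hk
      rcases mem_insert.1 hk with rfl | hk
      · exact Nat.gcd_dvd_right _ _
      · exact (Nat.gcd_dvd_left _ _).trans (g3 k hk)
  obtain ⟨g, g1, g2, g3⟩ := m3 _ (Finset.Subset.refl _)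
  have g4 : g ∣ n := by
    rw [← hb]
    exact Finset.dvd_sum fun i hi => (g3 i hi).mul_left i
  have g5 : g = 1 := Nat.dvd_one.1 ((Nat.dvd_add_right g2).1 (g4.trans h))
  rw [g5, qNum_one, hI, mem_quotientIdeal, one_mul] at g1
  exact g1

end

/-! ### From numbers of fixed points to cyclic sieving -/

lemma aeval_map_nat (ω : ℂ) (P : ℕ[X]) :
    aeval ω (P.map (Nat.castRingHom ℤ)) = aeval ω P :=
  Polynomial.aeval_map_algebraMap ℤ ω P

lemma eval_one_map_nat (P : ℕ[X]) :
    (P.map (Nat.castRingHom ℤ)).eval 1 = (P.eval 1 : ℕ) := by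
  have := Polynomial.eval_natCast_map (Nat.castRingHom ℤ) P 1
  rw [Nat.cast_one] at this
  exact this

lemma aeval_one_nat (P : ℕ[X]) : aeval (1 : ℂ) P = (P.eval 1 : ℕ) := by
  have := Polynomial.eval_natCast_map (Nat.castRingHom ℂ) P 1
  rw [Nat.cast_one, Polynomial.eval_map] at this
  exact this

/-- All the elements of a given order in a cyclic group of permutations have the same fixed
points. -/
lemma apply_eq_iff {X : Type*} {κ g : Equiv.Perm X} {ρ K : ℕ} (hρ : 1 ≤ ρ) (hK : 1 ≤ K)
    (hκ : orderOf κ = ρ * K) (hg : g ∈ Subgroup.zpowers κ) (hgo : orderOf g = ρ) (x : X) :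
    g x = x ↔ (κ ^ K) x = x := by
  obtain ⟨j, rfl⟩ := hg
  have h1 : (κ ^ j) ^ ρ = 1 := by rw [← hgo, pow_orderOf_eq_one]
  have h2 : (K : ℤ) ∣ j := by
    rw [← zpow_natCast, ← zpow_mul] at h1
    have h3 := orderOf_dvd_iff_zpow_eq_one.2 h1
    rw [hκ, Nat.cast_mul, mul_comm (ρ : ℤ)] at h3
    exact Int.dvd_of_mul_dvd_mul_right (by omega) h3
  have h3 : κ ^ j ∈ Subgroup.zpowers (κ ^ K) := by
    obtain ⟨i, rfl⟩ := h2
    exact ⟨i, by simp only [zpow_mul, zpow_natCast]⟩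
  have h4 : orderOf (κ ^ K) = ρ := by
    rw [orderOf_pow_of_dvd (by omega) (by rw [hκ]; exact dvd_mul_left _ _), hκ,
      Nat.mul_div_cancel _ (by omega)]
  have h5 : Subgroup.zpowers (κ ^ j) = Subgroup.zpowers (κ ^ K) := by
    have : Finite (Subgroup.zpowers (κ ^ K)) :=
      (finite_zpowers.2 (orderOf_pos_iff.1 (by omega))).to_subtype
    apply Subgroup.eq_of_le_of_card_ge
    · rw [Subgroup.zpowers_le]; exact h3
    · rw [Nat.card_zpowers, Nat.card_zpowers, h4]
      exact hgo.ge
  have h6 : κ ^ K ∈ Subgroup.zpowers (κ ^ j) := by rw [h5]; exact Subgroup.mem_zpowers _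
  obtain ⟨i, hi⟩ := h6
  obtain ⟨t, ht⟩ := h3
  constructor
  · intro h
    rw [← hi]
    exact Equiv.Perm.zpow_apply_eq_self_of_apply_eq_self h i
  · intro h
    change (κ ^ j) x = x
    rw [← ht]
    exact Equiv.Perm.zpow_apply_eq_self_of_apply_eq_self h t

/-- For `N ≤ 2`, the only positive partition is that with one block. -/
lemma subsingleton_of_le_two {N : ℕ} (hN : N ≤ 2) : Subsingleton (NCPlus N) := by
  refine ⟨fun π σ => Subtype.ext (finpartition_ext_lo fun x h1 h2 => ?_)⟩
  have key : ∀ τ : NCPlus N, lo τ.1 x = 1 := by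
    intro τ
    have h3 := (isLo_lo τ).last
    have h4 := (isLo_lo τ).le x h1 h2
    have h5 := (isLo_lo τ).pos x h1 h2
    rcases eq_or_lt_of_le h2 with h | h
    · rw [h, h3]
    · omega
  rw [key, key]

lemma sieving_of_subsingleton {X : Type*} [Subsingleton X] {M : Set X} {P : ℕ[X]}
    (h : M.ncard = P.eval 1) (κ : Equiv.Perm X) :
    ExhibitsCyclicSieving M P (Subgroup.zpowers κ) := by
  have hfin : Finite X := Finite.of_subsingleton
  refine ⟨Set.toFinite M, inferInstance, inferInstance, fun g _ x hx => ?_, ?_⟩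
  · rwa [Subsingleton.elim (g x) x]
  · rintro ρ - g - hg
    have h1 : g = 1 := Subsingleton.elim _ _
    rw [h1, orderOf_one] at hg
    subst hg
    rw [Nat.cast_one, div_one, Complex.exp_two_pi_mul_I, aeval_one_nat, ← h]
    congr 2
    ext x
    simp [Subsingleton.elim (g x) x]

/-- For `N = 1`, the definition of the pseudo-rotation gives the identity. -/
lemma isPseudoRotation_one (κ : Equiv.Perm (NCPlus 1)) : IsPseudoRotation κ := by
  intro π
  have := subsingleton_of_le_two (N := 1) (by omega)
  rw [Subsingleton.elim (κ π) π, kappaParts]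
  have hpt : ∀ x ∈ Icc 1 1, kappaPoint π.1 x = x := by
    intro x hx
    have hx1 : x = 1 := by rw [mem_Icc] at hx; omega
    have h0 : π.1.part (1 - 1) = ∅ := by
      rw [Finpartition.part_eq_empty]; simp
    have h1 : 1 - 1 ∉ π.1.part 1 := fun h => by
      have := π.1.part_subset 1 h
      simp at this
    rw [kappaPoint, if_neg h1, h0, if_neg (by simp)]
    subst hx1
    simp
  ext B
  rw [mem_image]
  have himg : ∀ C ∈ π.1.parts, C.image (kappaPoint π.1) = C := by
    intro C hC
    ext x
    rw [mem_image]
    constructor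
    · rintro ⟨y, hy, rfl⟩
      rwa [hpt y (π.1.le hC hy)]
    · intro hx
      exact ⟨x, hx, hpt x (π.1.le hC hx)⟩
  constructor
  · intro hB
    exact ⟨B, hB, himg B hB⟩
  · rintro ⟨C, hC, rfl⟩
    rwa [himg C hC]

/-- For `N = 1`, there is one block, of size `1`. -/
lemma blockCount_one (π : NCPlus 1) : blockCount π = fun k => if k = 1 then 1 else 0 := by
  have hsub := subsingleton_of_le_two (N := 1) (by omega)
  have hw : FirstReturn (fun _ => 1) 1 1 := ⟨le_rfl, fun j h1 h2 => by omega, by simp⟩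
  rw [Subsingleton.elim π (ofWord _ hw)]
  ext k
  rcases Nat.eq_zero_or_pos k with rfl | hk
  · rw [blockCount_zero]; rfl
  · rw [blockCount, card_filter_parts _ hk, card_filter,
      Finset.sum_eq_single_of_mem 1 (by simp) fun b hb hne => absurd (by simpa using hb) hne,
      word_ofWord hw le_rfl le_rfl]
    simp only [eq_comm (a := (1 : ℕ))]

lemma nonempty_one : Nonempty (NCPlus 1) :=
  ⟨ofWord (fun _ => 1) ⟨le_rfl, fun j h1 h2 => by omega, by simp⟩⟩

/-- The pseudo-rotation exhibits the cyclic sieving phenomenon on the set of the partitions whose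
block sizes satisfy `Q`, if the polynomial has the right values. The three conditions concern the
case `N = 1`, the number of all partitions, which is `1 / (L + 1)` times a number of circular words,
and the elements of order `d ≥ 2`, whose fixed points are counted by codes. -/
theorem exists_sieving {N : ℕ} (hN : 1 ≤ N) : ∃ κ : Equiv.Perm (NCPlus N), IsPseudoRotation κ ∧
    ∀ (Q : (ℕ → ℕ) → Prop) (P : ℕ[X]),
      (N = 1 → Q (fun k => if k = 1 then 1 else 0) ∧ P.eval 1 = 1) →
      (∀ L, N = L + 2 → (L + 1) * P.eval 1 =
        {c : Fin (L + 1) → ℕ | ∑ i, c i = N ∧ Q (valueCount c)}.ncard) →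
      (∀ (d K : ℕ) (ω : ℂ), 2 ≤ d → 1 ≤ K → N = d * K + 2 → IsPrimitiveRoot ω d →
        (({c : Fin K → ℕ | d * ∑ i, c i ≤ N ∧ Q (codeCount d N K c)}.ncard : ℕ) : ℂ) =
          aeval ω P) →
      ExhibitsCyclicSieving {π : NCPlus N | Q (blockCount π)} P (Subgroup.zpowers κ) := by
  rcases eq_or_lt_of_le hN with rfl | hN2
  · refine ⟨1, isPseudoRotation_one 1, fun Q P h0 _ _ => ?_⟩
    have hsub := subsingleton_of_le_two (N := 1) (by omega)
    apply sieving_of_subsingleton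
    rw [(h0 rfl).2, Set.ncard_eq_one]
    obtain ⟨π⟩ := nonempty_one
    refine ⟨π, ?_⟩
    ext σ
    rw [Set.mem_ofPred_eq, blockCount_one, Set.mem_singleton_iff]
    exact ⟨fun _ => Subsingleton.elim _ _, fun _ => (h0 rfl).1⟩
  obtain ⟨L, rfl⟩ : ∃ L, N = L + 2 := ⟨N - 2, by omega⟩
  refine ⟨kap L, isPseudoRotation_kappa _, fun Q P _ h1 h2 => ?_⟩
  have htot : {π : NCPlus (L + 2) | Q (blockCount π)}.ncard = P.eval 1 := by
    have h3 := ncard_mul (L := L) Q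
    have h4 := h1 L rfl
    exact Nat.eq_of_mul_eq_mul_left (show 0 < L + 1 by omega) (h3.trans h4.symm)
  rcases Nat.eq_zero_or_pos L with rfl | hL
  · have hsub := subsingleton_of_le_two (N := 0 + 2) (by omega)
    exact sieving_of_subsingleton htot _
  have hord : orderOf (kap L) = L := orderOf_kap hL
  refine ⟨Set.toFinite _, ?_, inferInstance, ?_, ?_⟩
  · exact (finite_zpowers.2 (orderOf_pos_iff.1 (by omega))).to_subtype
  · rintro g ⟨j, rfl⟩ π hπ
    have : blockCount ((kap L ^ j) π) = blockCount π := funext (blockCount_kap_zpow π j)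
    rw [Set.mem_ofPred_eq] at hπ ⊢
    rwa [this]
  · intro ρ hρ g hg hgo
    rw [Nat.card_zpowers, hord] at hρ
    obtain ⟨K, hK⟩ := hρ
    have hρ0 : ρ ≠ 0 := by rintro rfl; omega
    have hK0 : K ≠ 0 := by rintro rfl; omega
    have hset : {π ∈ {π : NCPlus (L + 2) | Q (blockCount π)} | g π = π} =
        {π : NCPlus (L + 2) | Q (blockCount π) ∧ (kap L ^ K) π = π} := by
      ext π
      simp only [Set.mem_ofPred_eq]
      rw [apply_eq_iff (by omega) (by omega) (hord.trans hK) hg hgo]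
    rcases Nat.lt_or_ge ρ 2 with hρ2 | hρ2
    · obtain rfl : ρ = 1 := by omega
      rw [orderOf_eq_one_iff] at hgo
      subst hgo
      rw [Nat.cast_one, div_one, Complex.exp_two_pi_mul_I, aeval_one_nat, ← htot]
      congr 2
      ext π
      simp
    · rw [hset, ncard_fixed (by omega) hρ2 hK Q]
      exact h2 ρ K _ hρ2 (by omega) (by rw [hK]) (Complex.isPrimitiveRoot_exp ρ hρ0)

section
variable {m n : ℕ}

lemma isDivisible_iff {N : ℕ} (π : NCPlus N) :
    IsDivisible m π.1 ↔ DivSizes m (blockCount π) := by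
  constructor
  · intro h k hk
    obtain ⟨B, hB⟩ := Finset.card_pos.1 (Nat.pos_of_ne_zero hk)
    rw [mem_filter] at hB
    rw [← hB.2]
    exact h B hB.1
  · intro h B hB
    have hpos : 0 < (π.1.parts.filter fun C => C.card = B.card).card :=
      Finset.card_pos.2 ⟨B, mem_filter.2 ⟨hB, rfl⟩⟩
    exact h _ hpos.ne'

lemma card_parts_eq_sum (hm : 1 ≤ m) {π : NCPlus (m * n)} (h : IsDivisible m π.1) :
    π.1.parts.card = ∑ i ∈ Icc 1 n, blockCount π (m * i) := by
  rw [Finset.card_eq_sum_card_fiberwise (f := fun B => B.card / m) (t := Icc 1 n)]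
  · apply Finset.sum_congr rfl
    intro i _
    rw [blockCount]
    congr 1
    apply Finset.filter_congr
    intro B hB
    obtain ⟨j, hj⟩ := h B hB
    rw [hj, Nat.mul_div_cancel_left _ hm, Nat.mul_right_inj (by omega)]
  · intro B hB
    obtain ⟨j, hj⟩ := h B hB
    have h1 := Finset.card_pos.2 (π.1.nonempty_of_mem_parts hB)
    have h2 := Finset.card_le_card (π.1.le hB)
    rw [Nat.card_Icc, Nat.add_sub_cancel, hj] at h2
    simp only [coe_Icc, Set.mem_Icc, hj, Nat.mul_div_cancel_left _ (show 0 < m by omega)]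
    refine ⟨?_, Nat.le_of_mul_le_mul_left h2 hm⟩
    rcases Nat.eq_zero_or_pos j with rfl | h
    · rw [hj] at h1; omega
    · exact h

/-- The reduction of cyclic sieving to the values of a polynomial, after division of all block
sizes by `m`. -/
theorem exists_sieving_div (hm : 1 ≤ m) (hn : 1 ≤ n) :
    ∃ κ : Equiv.Perm (NCPlus (m * n)), IsPseudoRotation κ ∧
    ∀ (R : (ℕ → ℕ) → Prop) (P : ℕ[X]),
      (m * n = 1 → R (fun k => if k = 1 then 1 else 0) ∧ P.eval 1 = 1) →
      (∀ L, m * n = L + 2 → (L + 1) * P.eval 1 =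
        {c : Fin (L + 1) → ℕ | ∑ i, c i = n ∧ R (valueCount c)}.ncard) →
      (∀ (d K : ℕ) (ω : ℂ), 2 ≤ d → 1 ≤ K → m * n = d * K + 2 → IsPrimitiveRoot ω d →
        (({c : Fin K → ℕ | d * ∑ i, c i ≤ n ∧ R (codeCount d n K c)}.ncard : ℕ) : ℂ) =
          aeval ω P) →
      ExhibitsCyclicSieving {π : NCPlus (m * n) | IsDivisible m π.1 ∧
        R fun i => blockCount π (m * i)} P (Subgroup.zpowers κ) := by
  obtain ⟨κ, h1, h2⟩ := exists_sieving (N := m * n) (Nat.mul_pos hm hn)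
  refine ⟨κ, h1, fun R P g0 g1 g2 => ?_⟩
  have h3 := h2 (fun β => DivSizes m β ∧ R fun i => β (m * i)) P ?_ ?_ ?_
  · simp only [isDivisible_iff]
    exact h3
  · intro h
    obtain rfl : m = 1 := Nat.dvd_one.1 ⟨n, h.symm⟩
    obtain rfl : n = 1 := by rwa [one_mul] at h
    refine ⟨⟨fun k _ => one_dvd k, ?_⟩, (g0 h).2⟩
    simp only [one_mul]
    exact (g0 h).1
  · intro L hL
    rw [g1 L hL, ncard_values hm R]
  · intro d K ω hd hK hN hω
    rw [ncard_codes hm (by omega) R]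
    exact g2 d K ω hd hK hN hω

end

/-! ### The expressions in the field of rational functions -/

/-- The embedding of the integer polynomials in the field of rational functions. -/
def toRat : ℤ[X] →+* RatFunc ℚ :=
  (algebraMap ℚ[X] (RatFunc ℚ)).comp (mapRingHom (Int.castRingHom ℚ))

lemma toRat_X : toRat X = RatFunc.X := by simp [toRat]

lemma toRat_map_nat (P : ℕ[X]) : toRat (P.map (Nat.castRingHom ℤ)) =
    algebraMap ℚ[X] (RatFunc ℚ) (P.map (Nat.castRingHom ℚ)) := by
  rw [toRat, RingHom.comp_apply, coe_mapRingHom, Polynomial.map_map]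
  congr 2

lemma toRat_injective : Function.Injective toRat :=
  (RatFunc.algebraMap_injective ℚ).comp (Polynomial.map_injective _ Int.cast_injective)

lemma toRat_qNum (a : ℕ) : toRat (qNum a) = qInt a := by
  have h := congrArg toRat (qNum_mul a)
  rw [map_mul, map_sub, map_sub, map_pow, map_one, toRat_X] at h
  have h1 : (1 - RatFunc.X : RatFunc ℚ) ≠ 0 := by
    rw [← toRat_X, ← map_one toRat, ← map_sub, map_ne_zero_iff _ toRat_injective]
    intro h0
    have := congrArg (eval 0) h0
    simp at this
  rw [qInt, eq_div_iff h1, h, zpow_natCast]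

lemma qInt_ne_zero {a : ℕ} (ha : 1 ≤ a) : qInt a ≠ 0 := by
  rw [← toRat_qNum, map_ne_zero_iff _ toRat_injective]
  exact qNum_ne_zero ha

lemma toRat_qFactorial (k : ℕ) : toRat (qFactorial k) = qFact k := by
  induction k with
  | zero => simp [qFact]
  | succ k ih =>
    rw [qFactorial_succ, map_mul, ih, toRat_qNum, qFact, qFact,
      Finset.prod_Icc_succ_top (by omega)]

lemma qFact_ne_zero (k : ℕ) : qFact k ≠ 0 := by
  rw [← toRat_qFactorial, map_ne_zero_iff _ toRat_injective]
  exact qFactorial_ne_zero k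

lemma qFalling_eq (k : ℕ) : ∀ M : ℕ,
    qFalling M k = toRat (gauss M k) * toRat (qFactorial k) := by
  induction k with
  | zero => intro M; simp [qFalling]
  | succ k ih =>
    intro M
    rw [qFalling, Finset.prod_range_succ']
    cases M with
    | zero =>
      rw [gauss_eq_zero (by omega), map_zero, zero_mul]
      simp [qInt]
    | succ M =>
      have h1 : ∏ i ∈ range k, qInt (((M + 1 : ℕ) : ℤ) - ((i + 1 : ℕ) : ℤ)) = qFalling M k := by
        rw [qFalling]
        apply Finset.prod_congr rfl
        intro i _
        congr 1
        push_cast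
        ring
      have h2 := congrArg toRat (gauss_absorb M k)
      rw [map_mul, map_mul, toRat_qNum (M + 1)] at h2
      rw [h1, ih, Nat.cast_zero, sub_zero, qFactorial_succ, map_mul]
      linear_combination -toRat (qFactorial k) * h2

lemma qBinom_eq (M k : ℕ) : qBinom M k = toRat (gauss M k) := by
  rw [qBinom, qFalling_eq, toRat_qFactorial, mul_div_cancel_right₀ _ (qFact_ne_zero k)]

lemma qMultinom_eq (b : ℕ → ℕ) (n : ℕ) :
    qMultinom (∑ i ∈ Icc 1 n, (b i : ℤ)) n b = toRat (gaussMulti b n) := by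
  have h0 : ∏ i ∈ Icc 1 n, qFact (b i) ≠ 0 :=
    Finset.prod_ne_zero_iff.2 fun i _ => qFact_ne_zero _
  have h1 := congrArg toRat (gaussMulti_mul_qFactorial b n)
  rw [map_mul, map_prod] at h1
  simp only [toRat_qFactorial] at h1
  rw [qMultinom, div_eq_iff h0, ← Nat.cast_sum, qFalling_eq, gauss_self, map_one, one_mul,
    toRat_qFactorial, h1]

lemma qBinom_zero (M : ℤ) : qBinom M 0 = 1 := by simp [qBinom, qFalling, qFact]

lemma qInt_one : qInt 1 = 1 := by
  have := toRat_qNum 1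
  rw [qNum_one, map_one] at this
  exact_mod_cast this.symm

/-! ### The values of the polynomials -/

section
variable {m n L : ℕ}

lemma gauss_one (M : ℕ) : gauss M 1 = qNum M := by
  cases M with
  | zero => rfl
  | succ M => simpa using gauss_absorb M 0

/-- At a root of unity of an order that divides `L`, the number `[L + 1]_q` is `1`. -/
lemma aeval_qNum_succ {d K : ℕ} {ω : ℂ} (hd : 2 ≤ d) (hω : IsPrimitiveRoot ω d) :
    aeval ω (qNum (d * K + 1)) = 1 := by
  rw [aeval_qNum_add hω.pow_eq_one (aeval_qNum_order hd hω), qNum_one, map_one]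

lemma aeval_gauss_mul_add_one {d K : ℕ} {ω : ℂ} (hd : 2 ≤ d) (hω : IsPrimitiveRoot ω d) (B : ℕ) :
    aeval ω (gauss (d * K + 1) B) = if B % d ≤ 1 then (K.choose (B / d) : ℂ) else 0 := by
  rw [aeval_gauss_div hd hω, Nat.mul_add_div (by omega), Nat.mul_add_mod,
    Nat.div_eq_of_lt (show 1 < d by omega), Nat.mod_eq_of_lt (show 1 < d by omega), add_zero]
  split_ifs with h
  · rcases Nat.eq_zero_or_pos (B % d) with h0 | h0
    · rw [h0, gauss_zero, map_one, mul_one]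
    · rw [show B % d = 1 by omega, gauss_self, map_one, mul_one]
  · rw [gauss_eq_zero (by omega), map_zero, mul_zero]

/-- The values of the polynomial for all partitions. At a root of unity of order `d`, the first
expression is used if `d` does not divide `n`, and the second one if it does. -/
lemma values_all (hn : 1 ≤ n) (P : ℕ[X])
    (h1 : P.map (Nat.castRingHom ℤ) * qNum n = gauss (L + n) (n - 1))
    (h2 : P.map (Nat.castRingHom ℤ) * qNum (L + n + 1) = gauss (L + n + 1) n) :
    (L + 1) * P.eval 1 = (L + n).choose n ∧
    ∀ (d K : ℕ) (ω : ℂ), 2 ≤ d → L = d * K → IsPrimitiveRoot ω d →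
      aeval ω P = ((n / d + K).choose K : ℂ) := by
  constructor
  · have h3 := congrArg (eval 1) h2
    rw [eval_mul, eval_one_map_nat, eval_one_qNum, eval_one_gauss] at h3
    have h4 : P.eval 1 * (L + n + 1) = (L + n + 1).choose n := by exact_mod_cast h3
    have h5 := Nat.choose_mul_succ_eq (L + n) n
    rw [show L + n + 1 - n = L + 1 by omega, ← h4] at h5
    apply Nat.eq_of_mul_eq_mul_right (show 0 < L + n + 1 by omega)
    rw [h5]
    ring
  · intro d K ω hd hL hω
    by_cases hdn : d ∣ n
    · obtain ⟨a, rfl⟩ := hdn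
      have h3 := congrArg (aeval ω) h2
      rw [map_mul, aeval_map_nat, hL, ← Nat.mul_add, aeval_qNum_succ hd hω, mul_one] at h3
      have h4 := aeval_gauss_lucas hd hω (K + a) (r := 1) (t := 0) (by omega) (by omega) a
      rw [add_zero, gauss_zero, map_one, mul_one] at h4
      rw [h3, h4, Nat.mul_div_cancel_left _ (by omega), add_comm a K, Nat.choose_symm_add]
    · obtain ⟨r, hr, hrn⟩ : ∃ r, r + 1 < d ∧ n = d * (n / d) + r + 1 := by
        have e1 := Nat.mod_lt n (show 0 < d by omega)
        have e2 := Nat.div_add_mod n d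
        have e3 : n % d ≠ 0 := fun h => hdn (Nat.dvd_of_mod_eq_zero h)
        exact ⟨n % d - 1, by omega, by omega⟩
      set a := n / d with ha
      have h3 := congrArg (aeval ω) h1
      have h4 := aeval_gauss_lucas hd hω (K + a) hr (show r < d by omega) a
      have h5 : gauss (r + 1) r = qNum (r + 1) := by rw [gauss_symm r 1, gauss_one]
      have e1 : aeval ω (qNum n) = aeval ω (qNum (r + 1)) := by
        conv_lhs => rw [hrn, add_assoc]
        exact aeval_qNum_add hω.pow_eq_one (aeval_qNum_order hd hω) _ _
      have e2 : d * (K + a) + (r + 1) = L + n := by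
        have : d * (K + a) = d * K + d * a := by ring
        omega
      rw [map_mul, aeval_map_nat, e1, ← e2, show n - 1 = d * a + r by omega, h4, h5] at h3
      rw [mul_right_cancel₀ (aeval_qNum_ne_zero hω (by omega) hr) h3, add_comm a K,
        Nat.choose_symm_add]

/-- The values of the polynomial for partitions with `B` blocks are the numbers of circular words and of
codes; by the `q`-Lucas theorem, only the remainders `0` and `1` of `B` modulo `d` contribute. -/
lemma values_blocks {B : ℕ} (hB : 1 ≤ B) (hn : 1 ≤ n) (P : ℕ[X])
    (h : P.map (Nat.castRingHom ℤ) * qNum (L + 1) =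
      gauss (n - 1) (B - 1) * gauss (L + 1) B) :
    (L + 1) * P.eval 1 =
      {c : Fin (L + 1) → ℕ | ∑ i, c i = n ∧ ∑ k ∈ Icc 1 n, valueCount c k = B}.ncard ∧
    ∀ (d K : ℕ) (ω : ℂ), 2 ≤ d → L = d * K → IsPrimitiveRoot ω d →
      (({c : Fin K → ℕ | d * ∑ i, c i ≤ n ∧
        ∑ k ∈ Icc 1 n, codeCount d n K c k = B}.ncard : ℕ) : ℂ) = aeval ω P := by
  constructor
  · have h3 := congrArg (eval 1) h
    rw [eval_mul, eval_mul, eval_one_map_nat, eval_one_qNum, eval_one_gauss,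
      eval_one_gauss] at h3
    have h4 : P.eval 1 * (L + 1) = (n - 1).choose (B - 1) * (L + 1).choose B := by
      exact_mod_cast h3
    have h5 := ncard_sum_eq_support' (ι := Fin (L + 1)) hB hn
    rw [Fintype.card_fin] at h5
    rw [mul_comm, h4, mul_comm, ← h5]
    congr 1
    ext c
    simp only [Set.mem_ofPred_eq]
    refine and_congr_right fun hc => ?_
    rw [sum_valueCount]
    intro i
    rw [← hc]
    exact Finset.single_le_sum (f := c) (fun _ _ => Nat.zero_le _) (mem_univ i)
  · intro d K ω hd hL hω
    have h3 := congrArg (aeval ω) h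
    rw [map_mul, map_mul, aeval_map_nat, hL, aeval_qNum_succ hd hω, mul_one,
      aeval_gauss_mul_add_one hd hω] at h3
    rw [h3]
    have e1 := Nat.div_add_mod B d
    split_ifs with hBd
    · rcases Nat.eq_zero_or_pos (B % d) with h0 | h0
      · obtain ⟨k, hk⟩ : ∃ k, B / d = k + 1 := by
          apply Nat.exists_eq_succ_of_ne_zero
          intro h
          rw [h] at e1
          omega
        rw [h0, add_zero, hk] at e1
        rw [hk, ← e1, ncard_codes_blocks_zero hd hn (by omega), Nat.add_sub_cancel,
          show d * (k + 1) - 1 = d * k + (d - 1) by rw [Nat.mul_succ]; omega,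
          aeval_gauss_div hd hω, Nat.mul_add_div (by omega), Nat.mul_add_mod,
          Nat.div_eq_of_lt (show d - 1 < d by omega), Nat.mod_eq_of_lt (show d - 1 < d by omega),
          add_zero]
        split_ifs with hdn
        · obtain ⟨a, rfl⟩ := hdn
          obtain ⟨j, rfl⟩ : ∃ j, a = j + 1 := by
            refine ⟨a - 1, ?_⟩
            have : a ≠ 0 := by rintro rfl; omega
            omega
          rw [Nat.mul_div_cancel_left _ (by omega),
            show d * (j + 1) - 1 = d * j + (d - 1) by rw [Nat.mul_succ]; omega,
            Nat.mul_add_div (by omega), Nat.mul_add_mod,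
            Nat.div_eq_of_lt (show d - 1 < d by omega),
            Nat.mod_eq_of_lt (show d - 1 < d by omega), gauss_self, map_one]
          push_cast
          rw [add_zero]
          ring
        · have hlt : (n - 1) % d < d - 1 := by
            have e2 := Nat.mod_lt (n - 1) (show 0 < d by omega)
            by_contra hc
            apply hdn
            have e3 := Nat.div_add_mod (n - 1) d
            exact ⟨(n - 1) / d + 1, by rw [Nat.mul_succ]; omega⟩
          rw [gauss_eq_zero hlt, map_zero]
          simp
      · have h1 : B % d = 1 := by omega
        rw [h1] at e1
        rw [← e1, ncard_codes_blocks_one hd hn, Nat.add_sub_cancel, aeval_gauss_div hd hω,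
          Nat.mul_div_cancel_left _ (by omega), Nat.mul_mod_right, gauss_zero, map_one, mul_one,
          Nat.mul_add_div (by omega), Nat.div_eq_of_lt (show 1 < d by omega), add_zero]
        push_cast
        ring
    · rw [ncard_codes_blocks_other hd (by omega), mul_zero, Nat.cast_zero]

/-- The values of the polynomial for partitions with block type `b` are the numbers of circular words
and of codes. -/
lemma values_type {b : ℕ → ℕ} (hb : ∑ i ∈ Icc 1 n, i * b i = n) (P : ℕ[X])
    (h : P.map (Nat.castRingHom ℤ) * qNum (L + 1) =
      gaussMulti b n * gauss (L + 1) (∑ i ∈ Icc 1 n, b i)) :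
    (L + 1) * P.eval 1 =
      {c : Fin (L + 1) → ℕ | ∑ i, c i = n ∧ ∀ k ∈ Icc 1 n, valueCount c k = b k}.ncard ∧
    ∀ (d K : ℕ) (ω : ℂ), 2 ≤ d → L = d * K → IsPrimitiveRoot ω d →
      (({c : Fin K → ℕ | d * ∑ i, c i ≤ n ∧
        ∀ k ∈ Icc 1 n, codeCount d n K c k = b k}.ncard : ℕ) : ℂ) = aeval ω P := by
  constructor
  · have h3 := congrArg (eval 1) h
    rw [eval_mul, eval_mul, eval_one_map_nat, eval_one_qNum, eval_one_gauss,
      eval_one_gaussMulti] at h3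
    have h4 : P.eval 1 * (L + 1) = multi b n * (L + 1).choose (∑ i ∈ Icc 1 n, b i) := by
      exact_mod_cast h3
    rw [ncard_values_type hb, Fintype.card_fin, mul_comm, h4, mul_comm]
  · intro d K ω hd hL hω
    have h3 := congrArg (aeval ω) h
    rw [map_mul, map_mul, aeval_map_nat, hL, aeval_qNum_succ hd hω, mul_one,
      aeval_gauss_mul_add_one hd hω] at h3
    rw [h3, ncard_codes_type hd hb]
    by_cases hc : ∑ i ∈ Icc 1 n, b i % d ≤ 1
    · have h4 := sum_div_mod (d := d) (s := Icc 1 n) (b := b) (by omega)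
      rw [if_pos hc, if_pos (by omega), aeval_gaussMulti hd hω b n (by omega), if_pos hc, h4.1]
      push_cast
      ring
    · rw [if_neg hc]
      split_ifs with h5
      · rw [aeval_gaussMulti hd hω b n h5, if_neg hc]; simp
      · simp

end

/-! ### The four families of partitions -/

section
variable {m n : ℕ}

lemma divNCPlus_eq : divNCPlus m n = {π : NCPlus (m * n) | IsDivisible m π.1 ∧ True} := by
  ext π
  simp [divNCPlus]

lemma divNCPlusRank_eq (hm : 1 ≤ m) {s : ℕ} (hs : s ≤ n) :
    divNCPlusRank m n s = {π : NCPlus (m * n) | IsDivisible m π.1 ∧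
      ∑ i ∈ Icc 1 n, blockCount π (m * i) = n - s} := by
  ext π
  rw [mem_divNCPlusRank hm hs, Set.mem_ofPred_eq]
  refine and_congr_right fun h => ?_
  rw [card_parts_eq_sum hm h]

lemma divNCPlusUniform_eq (hm : 1 ≤ m) : divNCPlusUniform m n = divNCPlusRank m n 0 := by
  ext π
  rw [mem_divNCPlusRank hm (Nat.zero_le n), Nat.sub_zero]
  constructor
  · intro h
    have hdiv : IsDivisible m π.1 := fun B hB => by rw [h B hB]
    exact ⟨hdiv, (card_parts_eq_iff hm hdiv).2 h⟩
  · rintro ⟨h1, h2⟩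
    exact (card_parts_eq_iff hm h1).1 h2

/-- For `m * n = 1`, there is a single partition, and the polynomials are `1`. -/
lemma exists_polynomial_one {F : RatFunc ℚ} (hF : F = 1) :
    ∃ P : ℕ[X], algebraMap ℚ[X] (RatFunc ℚ) (P.map (Nat.castRingHom ℚ)) = F ∧ P.eval 1 = 1 :=
  ⟨1, by rw [hF]; simp, by simp⟩

/-- A polynomial `P` with `P * [c]_q = G` is `G / [c]_q` in the field of rational functions. -/
lemma algebraMap_eq_of_mul {c : ℕ} (hc : 1 ≤ c) {P : ℕ[X]} {G : ℤ[X]}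
    (h : P.map (Nat.castRingHom ℤ) * qNum c = G) :
    algebraMap ℚ[X] (RatFunc ℚ) (P.map (Nat.castRingHom ℚ)) = 1 / qInt c * toRat G := by
  have h1 := congrArg toRat h
  rw [map_mul, toRat_map_nat, toRat_qNum] at h1
  rw [← h1, mul_comm, mul_assoc, mul_one_div, div_self (qInt_ne_zero hc), mul_one]

end

end PosNC

end

theorem mainTheorem2 (m n : ℕ) (hm : 1 ≤ m) (hn : 1 ≤ n) :
    ∃ κ : Equiv.Perm (PosNC.NCPlus (m * n)), PosNC.IsPseudoRotation κ ∧
      -- all positive `m`-divisible non-crossing partitions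
      PosNC.ExhibitsCyclicSievingFor (PosNC.divNCPlus m n)
        (1 / PosNC.qInt n * PosNC.qBinom ((m + 1) * n - 2) (n - 1))
        (Subgroup.zpowers κ) ∧
      -- all blocks of size `m`
      PosNC.ExhibitsCyclicSievingFor (PosNC.divNCPlusUniform m n)
        (1 / PosNC.qInt n * PosNC.qBinom (m * n - 2) (n - 1))
        (Subgroup.zpowers κ) ∧
      -- rank `s`, or, equivalently, `n - s` blocks
      (∀ s : ℕ, s ≤ n - 1 →
        (∀ π ∈ PosNC.divNCPlus m n,
          π ∈ PosNC.divNCPlusRank m n s ↔ π.1.parts.card = n - s) ∧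
        PosNC.ExhibitsCyclicSievingFor (PosNC.divNCPlusRank m n s)
          (1 / PosNC.qInt n * PosNC.qBinom n s * PosNC.qBinom (m * n - 2) (n - s - 1))
          (Subgroup.zpowers κ)) ∧
      -- block type `b`
      (∀ b : ℕ → ℕ, ∑ i ∈ Finset.Icc 1 n, i * b i = n →
        PosNC.ExhibitsCyclicSievingFor (PosNC.divNCPlusType m n b)
          (1 / PosNC.qInt (∑ i ∈ Finset.Icc 1 n, (b i : ℤ)) *
            PosNC.qMultinom (∑ i ∈ Finset.Icc 1 n, (b i : ℤ)) n b *
            PosNC.qBinom (m * n - 2) ((∑ i ∈ Finset.Icc 1 n, b i) - 1))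
          (Subgroup.zpowers κ)) := by
  obtain ⟨κ, hκ, hsieve⟩ := PosNC.exists_sieving_div hm hn
  have hmn : m * n = 1 ∨ ∃ L, m * n = L + 2 := by
    have := Nat.mul_pos hm hn
    rcases eq_or_lt_of_le (show 1 ≤ m * n from this) with h | h
    · exact Or.inl h.symm
    · exact Or.inr ⟨m * n - 2, by omega⟩
  have hone : m * n = 1 → n = 1 := fun h => Nat.dvd_one.1 ⟨m, by rw [mul_comm]; exact h.symm⟩
  have hrank : ∀ s : ℕ, s ≤ n - 1 → PosNC.ExhibitsCyclicSievingFor (PosNC.divNCPlusRank m n s)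
      (1 / PosNC.qInt n * PosNC.qBinom n s * PosNC.qBinom (m * n - 2) (n - s - 1))
      (Subgroup.zpowers κ) := by
    intro s hs
    rw [PosNC.divNCPlusRank_eq hm (show s ≤ n by omega)]
    rcases hmn with h1 | ⟨L, hL⟩
    · obtain rfl : n = 1 := hone h1
      obtain rfl : s = 0 := by omega
      obtain ⟨P, hP, hP1⟩ := PosNC.exists_polynomial_one
        (F := 1 / PosNC.qInt (1 : ℕ) * PosNC.qBinom (1 : ℕ) 0 *
          PosNC.qBinom (m * (1 : ℕ) - 2) (1 - 0 - 1))
        (by rw [Nat.cast_one, PosNC.qInt_one, PosNC.qBinom_zero, PosNC.qBinom_zero]; simp)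
      refine ⟨P, hP, hsieve (fun β => ∑ i ∈ Finset.Icc 1 1, β i = 1 - 0) P
        (fun _ => ⟨by simp, hP1⟩) (fun L hL => by omega) fun d K ω _ _ h => by omega⟩
    · obtain ⟨P, hP1, hP2⟩ := PosNC.exists_poly_blocks (show 1 ≤ n - s by omega)
        (show n - s ≤ n by omega) (hL ▸ dvd_mul_left n m)
      have hsymm : PosNC.gauss n (n - s) = PosNC.gauss n s := by
        have := PosNC.gauss_symm (n - s) s
        rwa [Nat.sub_add_cancel (show s ≤ n by omega)] at this
      refine ⟨P, ?_, hsieve (fun β => ∑ i ∈ Finset.Icc 1 n, β i = n - s) P ?_ ?_ ?_⟩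
      · have hcast : ((m : ℤ) * n - 2) = (L : ℕ) := by
          have : ((m * n : ℕ) : ℤ) = ((L + 2 : ℕ) : ℤ) := by rw [hL]
          push_cast at this
          linarith
        rw [PosNC.algebraMap_eq_of_mul hn hP1, map_mul, hcast, PosNC.qBinom_eq, PosNC.qBinom_eq,
          hsymm, mul_assoc]
      · intro h
        omega
      · intro L' hL'
        obtain rfl : L' = L := by omega
        exact (PosNC.values_blocks (by omega) hn P hP2).1
      · intro d K ω hd _ hN hω
        exact (PosNC.values_blocks (by omega) hn P hP2).2 d K ω hd (by omega) hω
  refine ⟨κ, hκ, ?_, ?_, fun s hs => ⟨fun π hπ => ?_, hrank s hs⟩, fun b hb => ?_⟩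
  · rw [PosNC.divNCPlus_eq]
    rcases hmn with h1 | ⟨L, hL⟩
    · obtain rfl : n = 1 := hone h1
      obtain ⟨P, hP, hP1⟩ := PosNC.exists_polynomial_one
        (F := 1 / PosNC.qInt (1 : ℕ) * PosNC.qBinom ((m + 1) * (1 : ℕ) - 2) (1 - 1))
        (by rw [Nat.cast_one, PosNC.qInt_one, PosNC.qBinom_zero]; simp)
      exact ⟨P, hP, hsieve (fun _ => True) P (fun _ => ⟨trivial, hP1⟩) (fun L hL => by omega)
        fun d K ω _ _ h => by omega⟩
    · obtain ⟨P, hP1, hP2⟩ := PosNC.exists_poly_all hn (hL ▸ dvd_mul_left n m)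
      have hv := PosNC.values_all hn P hP1 hP2
      refine ⟨P, ?_, hsieve (fun _ => True) P ?_ ?_ ?_⟩
      · have hcast : (((m : ℤ) + 1) * n - 2) = (L + n : ℕ) := by
          have : ((m * n : ℕ) : ℤ) = ((L + 2 : ℕ) : ℤ) := by rw [hL]
          push_cast at this ⊢
          linarith
        rw [PosNC.algebraMap_eq_of_mul hn hP1, hcast, PosNC.qBinom_eq]
      · intro h
        omega
      · intro L' hL'
        obtain rfl : L' = L := by omega
        simp only [and_true]
        rw [hv.1, PosNC.ncard_sum_eq, Fintype.card_fin, Nat.multichoose_eq]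
        congr 1
        omega
      · intro d K ω hd _ hN hω
        simp only [and_true]
        rw [PosNC.ncard_codes_all (by omega), hv.2 d K ω hd (by omega) hω]
  · have h := hrank 0 (Nat.zero_le _)
    rw [PosNC.divNCPlusUniform_eq hm]
    rwa [PosNC.qBinom_zero, mul_one, Nat.sub_zero] at h
  · rw [PosNC.mem_divNCPlusRank hm (by omega)]
    exact and_iff_right hπ
  · rw [← Nat.cast_sum]
    change PosNC.ExhibitsCyclicSievingFor {π : PosNC.NCPlus (m * n) |
      PosNC.IsDivisible m π.1 ∧ ∀ i ∈ Finset.Icc 1 n, PosNC.blockCount π (m * i) = b i} _ _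
    have hmulti : PosNC.qMultinom ((∑ i ∈ Finset.Icc 1 n, b i : ℕ) : ℤ) n b =
        PosNC.toRat (PosNC.gaussMulti b n) := by
      rw [← PosNC.qMultinom_eq, Nat.cast_sum]
    rw [hmulti]
    have hpos : 1 ≤ ∑ i ∈ Finset.Icc 1 n, b i := by
      by_contra! h0
      rw [Nat.lt_one_iff, Finset.sum_eq_zero_iff] at h0
      rw [Finset.sum_eq_zero fun i hi => by rw [h0 i hi, mul_zero]] at hb
      omega
    rcases hmn with h1 | ⟨L, hL⟩
    · obtain rfl : n = 1 := hone h1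
      have hb1 : b 1 = 1 := by simpa using hb
      simp only [Finset.Icc_self, Finset.sum_singleton, hb1]
      obtain ⟨P, hP, hP1⟩ := PosNC.exists_polynomial_one
        (F := 1 / PosNC.qInt (1 : ℕ) * PosNC.toRat (PosNC.gaussMulti b 1) *
          PosNC.qBinom (m * (1 : ℕ) - 2) (1 - 1))
        (by rw [Nat.cast_one, PosNC.qInt_one, PosNC.qBinom_zero]
            simp [PosNC.gaussMulti, hb1, PosNC.gauss_self])
      refine ⟨P, hP, hsieve (fun β => ∀ i ∈ ({1} : Finset ℕ), β i = b i) P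
        (fun _ => ⟨by simp [hb1], hP1⟩) (fun L hL => by omega) fun d K ω _ _ h => by omega⟩
    · obtain ⟨P, hP1, hP2⟩ := PosNC.exists_poly_type hn (hL ▸ dvd_mul_left n m) hb
      refine ⟨P, ?_, hsieve (fun β => ∀ i ∈ Finset.Icc 1 n, β i = b i) P ?_ ?_ ?_⟩
      · have hcast : ((m : ℤ) * n - 2) = (L : ℕ) := by
          have : ((m * n : ℕ) : ℤ) = ((L + 2 : ℕ) : ℤ) := by rw [hL]
          push_cast at this
          linarith
        rw [PosNC.algebraMap_eq_of_mul hpos hP1, map_mul, hcast, PosNC.qBinom_eq, mul_assoc]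
      · intro h
        omega
      · intro L' hL'
        obtain rfl : L' = L := by omega
        exact (PosNC.values_type hb P hP2).1
      · intro d K ω hd _ hN hω
        exact (PosNC.values_type hb P hP2).2 d K ω hd (by omega) hω
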